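/- **Setting.** Let $n\ge 1$, $m=n^7$, and let $H$ be a Hermitian operator on $n$ qubits with orthonormal eigenbasis $(|\nu_\alpha\rangle)$ and energies $E_\alpha\in[0,1]$. For a width $w$ let $\Pi_w$ be the projector onto the span of the $|\nu_\alpha\rangle$ with $E_\alpha\in[e_0-\tfrac w2,e_0+\tfrac w2]$. Fix a window $[e_0-\tfrac\Delta2,e_0+\tfrac\Delta2]\subseteq[0,1]$, a number $f>0$, a step size $\varepsilon$, and a resolution $L\in\mathbb N$ so large that $L\ge f^{-28}$ and $3/\sqrt L\le\eta$, where $\eta$ (an inverse polynomial in $n$) satisfies $\operatorname{Tr}\Pi_{\Delta-\eta}/\operatorname{Tr}\Pi_\Delta\ge 1-f^{25}$. **The test.** Given $m$ Hermitian operators $A_i$ with $A_i^2=I$, the energy subspace test acts on a state of two $n$-qubit registers $S_1S_2$. Let $|u\rangle=L^{-1/2}\sum_{k<L}|k\rangle$, let $U=L^{-1/2}\sum_{j,k<L}e^{2\pi i(H-j/L)k}\otimes|j\rangle\langle k|$, and let $\Pi_{SP}=U^{-1}\big(I\otimes\sum_j|j\rangle\langle j|\big)U$, where the sum is over the $j$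 with $|j/L-e_0|\le\omega/2$, $\omega=\Delta-1/\sqrt L$. A bar denotes complex conjugation in the computational basis, and on $S_2P_2$ the projector $\Pi_{SP}$ is formed with $\bar H$ (which is $H$ if $H$ is real). The test 1. appends $|u\rangle_{P_1}|u\rangle_{P_2}$; 2. measures $\Pi_{S_1P_1}$ and $\Pi_{S_2P_2}$ and rejects if either fails; 3. measures $|u\rangle\langle u|$ on $P_1$ and on $P_2$ and rejects if either fails; 4. prepares $|t\rangle_T=(2m)^{-1/2}\sum_i(|i,0\rangle+|i,1\rangle)$, applies $e^{i\varepsilon A_i}\otimes e^{-i\varepsilon\bar A_i}$ on $S_1S_2$ controlled on $|i,0\rangle$ and $e^{-i\varepsilon A_i}\otimes e^{i\varepsilon\bar A_i}$ controlled on $|i,1\rangle$; 5. repeats steps 2 and 3; 6. accepts if and only if a measurement of $T$ finds $|t\rangle$. Let $\mathcal N_A$ be the channel from $S_1S_2$ to one qubit that outputs the resulting accept/reject bit. **The random ansatz.** Let $g^i_{\alpha,\beta}=\overline{g^i_{\beta,\alpha}}$ ($i\le m$; $\alpha,\beta$ in the window) be Gaussians of mean $0$ and variance $1$, independent over $i$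 and over $\alpha\le\beta$, complex standard Gaussians for $\alpha<\beta$ and real for $\alpha=\beta$. Let $f_{\alpha,\beta}=f_{\beta,\alpha}\in[f,1]$, and let $\mu^i_\alpha\in\mathbb R$ with $|\mu^i_\alpha-\mu^i_\beta|\le f^7$ for all $\alpha,\beta$ in the window. A *realization* of the ansatz is a family of Hermitian operators $A'_1,\dots,A'_m$ with $A_i'^2=I$ and, for $\alpha,\beta$ in the window, $$\langle\nu_\alpha|A'_i|\nu_\beta\rangle=\mu^i_\alpha\delta_{\alpha,\beta}+\frac{f_{\alpha,\beta}}{\sqrt{\operatorname{Tr}\Pi_\Delta}}\,g^i_{\alpha,\beta}.$$ **Theorem.** For all $0<a\le b$ there are constants $f_0,C,c,\kappa>0$, depending only on $a$ and $b$, such that in every setting as above with $0<f\le f_0$ and $af^7\le\varepsilon\le bf^7$ (that is, $\varepsilon=\Theta(f^7)$) the following holds with probability at least $1-e^{-\kappa m^{1/3}}$ over the Gaussians $g$. For every realization $A'$ of the ansatz, every $\varepsilon_{\mathrm{ETH}}\ge0$, and every family $A_1,\dots,A_m$ of Hermitian operators with $A_i^2=I$ and $\|\mathcal N_A-\mathcal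 N_{A'}\|_\diamond\le\varepsilon_{\mathrm{ETH}}$, there are a number $p$ with $$1-Cf^{14}-\varepsilon_{\mathrm{ETH}}\le p\le 1$$ and a unit vector $|\Psi\rangle$ such that the test with the operators $A_i$ accepts $|\Psi\rangle$ with probability $p$, accepts no unit vector with probability larger than $p$, and accepts every unit vector orthogonal to $|\Psi\rangle$ with probability at most $$p-c f^{20}+\varepsilon_{\mathrm{ETH}}+C\big(m^{-1/3}+L^{-1/2}\big).$$ The last term is $1/\operatorname{poly}(n)$, since $m=n^7$ and $L$ is taken to be a sufficiently large polynomial in $n$. The choice $A=A'$, $\varepsilon_{\mathrm{ETH}}=0$ gives the statement for the random ansatz itself. -/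

import Mathlib

open MeasureTheory ProbabilityTheory
open scoped Kronecker ENNReal

noncomputable section

namespace EnergyTest

/-! ### Trace norm, channels and the diamond norm -/

/-- The trace norm `‖X‖₁`: the sum of the singular values of `X`. -/
def traceNorm {ι : Type*} [Fintype ι] [DecidableEq ι] (X : Matrix ι ι ℂ) : ℝ :=
  (Matrix.toEuclideanLin X).singularValues.sum fun _ s => s

/-- `(Φ ⊗ id_k)(X)`: the map `Φ` applied to the first tensor factor. -/
def ampliate {a b : Type*} (Φ : Matrix a a ℂ →ₗ[ℂ] Matrix b b ℂ) (k : ℕ)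
    (X : Matrix (a × Fin k) (a × Fin k) ℂ) : Matrix (b × Fin k) (b × Fin k) ℂ :=
  Matrix.of fun p q => Φ (Matrix.of fun x y => X (x, p.2) (y, q.2)) p.1 q.1

/-- The diamond norm `sup_k sup_{‖X‖₁ ≤ 1} ‖(Φ ⊗ id_k)(X)‖₁`. -/
def diamondNorm {a b : Type*} [Fintype a] [DecidableEq a] [Fintype b] [DecidableEq b]
    (Φ : Matrix a a ℂ →ₗ[ℂ] Matrix b b ℂ) : ℝ≥0∞ :=
  ⨆ (k : ℕ) (X : Matrix (a × Fin k) (a × Fin k) ℂ) (_ : traceNorm X ≤ 1),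
    ENNReal.ofReal (traceNorm (ampliate Φ k X))

/-! ### Phase estimation -/

/-- The inverse quantum Fourier transform on the `L`-dimensional register. -/
def invQFT (L : ℕ) : Matrix (Fin L) (Fin L) ℂ :=
  Matrix.of fun j k =>
    (1 / (Real.sqrt L : ℂ)) *
      Complex.exp (2 * Real.pi * Complex.I * (-((j : ℕ) : ℂ) * ((k : ℕ) : ℂ) / (L : ℂ)))

/-- `U_QPE`: evolution `e^{2πikH}` controlled on `|k⟩`, followed by the inverse Fourier transform
on the ancilla register. -/
def qpe {ι : Type*} [Fintype ι] [DecidableEq ι] (H : Matrix ι ι ℂ) (L : ℕ) :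
    Matrix (ι × Fin L) (ι × Fin L) ℂ :=
  ((1 : Matrix ι ι ℂ) ⊗ₖ invQFT L) *
    Matrix.blockDiagonal fun k : Fin L =>
      NormedSpace.exp ((2 * Real.pi * Complex.I * ((k : ℕ) : ℂ)) • H)

open Classical in
/-- Projector onto the ancilla values `j` with `j / L ∈ [e₀ - w/2, e₀ + w/2]`. -/
def gridProj (L : ℕ) (e₀ w : ℝ) : Matrix (Fin L) (Fin L) ℂ :=
  Matrix.diagonal fun j =>
    if ((j : ℕ) : ℝ) / L ∈ Set.Icc (e₀ - w / 2) (e₀ + w / 2) then 1 else 0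

/-- `Π_SP = U_QPE⁻¹ (I ⊗ ∑_j |j⟩⟨j|) U_QPE`, the sum over grid points in the window of width `w`. -/
def projSP {ι : Type*} [Fintype ι] [DecidableEq ι] (H : Matrix ι ι ℂ) (L : ℕ) (e₀ w : ℝ) :
    Matrix (ι × Fin L) (ι × Fin L) ℂ :=
  (qpe H L)⁻¹ * ((1 : Matrix ι ι ℂ) ⊗ₖ gridProj L e₀ w) * qpe H L

/-- Projector onto the uniform superposition over a finite basis. -/
def unifProj (κ : Type*) [Fintype κ] : Matrix κ κ ℂ :=
  Matrix.of fun _ _ => 1 / (Fintype.card κ : ℂ)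

/-! ### The energy subspace test

The registers are `(S₁ × P₁) × (S₂ × P₂) × T`, where `T` has the basis
`|i, 0⟩, |i, 1⟩` (`i < m`), with `false` for `0` and `true` for `1`. The second copy `S₂` carries
the complex conjugate picture (entrywise conjugation in the computational basis): `conj A_i` acts
on it and its phase estimation is the one for `conj H`. -/

/-- The basis of all registers of the test. -/
abbrev Reg (ι : Type*) (L m : ℕ) : Type _ :=
  (ι × Fin L) × (ι × Fin L) × (Fin m × Bool)

/-- Append the uniform superpositions on `P₁`, `P₂` and `T` to a state on `S₁ S₂`. -/
def prepare (ι : Type*) [DecidableEq ι] (L m : ℕ) : Matrix (Reg ι L m) (ι × ι) ℂ :=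
  Matrix.of fun r s =>
    if r.1.1 = s.1 ∧ r.2.1.1 = s.2 then
      (1 / (Real.sqrt L : ℂ)) * (1 / (Real.sqrt L : ℂ)) * (1 / (Real.sqrt (2 * m) : ℂ))
    else 0

/-- The `accept` outcome of the measurements of `Π_{S₁P₁}` and `Π_{S₂P₂}`, followed by the
`accept` outcome of the measurements of `Π_{P₁}` and `Π_{P₂}`. -/
def energyCheck {ι : Type*} [Fintype ι] [DecidableEq ι] (H : Matrix ι ι ℂ) (L m : ℕ)
    (e₀ w : ℝ) : Matrix (Reg ι L m) (Reg ι L m) ℂ :=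
  (((1 : Matrix ι ι ℂ) ⊗ₖ unifProj (Fin L)) ⊗ₖ (((1 : Matrix ι ι ℂ) ⊗ₖ unifProj (Fin L)) ⊗ₖ
      (1 : Matrix (Fin m × Bool) (Fin m × Bool) ℂ))) *
    (projSP H L e₀ w ⊗ₖ (projSP (H.map star) L e₀ w ⊗ₖ
      (1 : Matrix (Fin m × Bool) (Fin m × Bool) ℂ)))

/-- Controlled on `|i, 0⟩` apply `e^{iεA_i}` on `S₁` and `e^{-iε conj A_i}` on `S₂`; controlled on
`|i, 1⟩` apply `e^{-iεA_i}` on `S₁` and `e^{iε conj A_i}` on `S₂`. -/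
def controlledStep {ι : Type*} [Fintype ι] [DecidableEq ι] {m : ℕ} (A : Fin m → Matrix ι ι ℂ)
    (ε : ℝ) (L : ℕ) : Matrix (Reg ι L m) (Reg ι L m) ℂ :=
  ∑ t : Fin m × Bool,
    let θ : ℂ := (if t.2 then -1 else 1) * (Complex.I * (ε : ℂ))
    (NormedSpace.exp (θ • A t.1) ⊗ₖ (1 : Matrix (Fin L) (Fin L) ℂ)) ⊗ₖ
      ((NormedSpace.exp ((-θ) • (A t.1).map star) ⊗ₖ (1 : Matrix (Fin L) (Fin L) ℂ)) ⊗ₖ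
        Matrix.single t t (1 : ℂ))

/-- The operator that maps the input state on `S₁ S₂` to the unnormalised final state of the
accepting branch of the test. Phase estimation uses the window width `ω = Δ - 1/√L`. -/
def acceptBranch {ι : Type*} [Fintype ι] [DecidableEq ι] {m : ℕ} (H : Matrix ι ι ℂ)
    (A : Fin m → Matrix ι ι ℂ) (ε e₀ Δ : ℝ) (L : ℕ) : Matrix (Reg ι L m) (ι × ι) ℂ :=
  ((1 : Matrix (ι × Fin L) (ι × Fin L) ℂ) ⊗ₖ ((1 : Matrix (ι × Fin L) (ι × Fin L) ℂ) ⊗ₖ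
      unifProj (Fin m × Bool))) *
    energyCheck H L m e₀ (Δ - 1 / Real.sqrt L) * controlledStep A ε L *
    energyCheck H L m e₀ (Δ - 1 / Real.sqrt L) * prepare ι L m

/-- The probability that the test accepts the pure state `ψ` on `S₁ S₂`. -/
def acceptProb {ι : Type*} [Fintype ι] [DecidableEq ι] {m : ℕ} (H : Matrix ι ι ℂ)
    (A : Fin m → Matrix ι ι ℂ) (ε e₀ Δ : ℝ) (L : ℕ) (ψ : EuclideanSpace ℂ (ι × ι)) : ℝ :=
  ‖Matrix.toEuclideanLin (acceptBranch H A ε e₀ Δ L) ψ‖ ^ 2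

/-- The test as a channel from `S₁ S₂` to one qubit, which is `|1⟩` if the test accepts and
`|0⟩` if it rejects. -/
def testChannel {ι : Type*} [Fintype ι] [DecidableEq ι] {m : ℕ} (H : Matrix ι ι ℂ)
    (A : Fin m → Matrix ι ι ℂ) (ε e₀ Δ : ℝ) (L : ℕ) :
    Matrix (ι × ι) (ι × ι) ℂ →ₗ[ℂ] Matrix (Fin 2) (Fin 2) ℂ where
  toFun X :=
    (X.trace - (acceptBranch H A ε e₀ Δ L * X * (acceptBranch H A ε e₀ Δ L).conjTranspose).trace) •
        Matrix.single 0 0 (1 : ℂ) +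
      (acceptBranch H A ε e₀ Δ L * X * (acceptBranch H A ε e₀ Δ L).conjTranspose).trace •
        Matrix.single 1 1 (1 : ℂ)
  map_add' X Y := by
    simp only [Matrix.mul_add, Matrix.add_mul, Matrix.trace_add]
    module
  map_smul' c X := by
    simp only [Matrix.mul_smul, Matrix.smul_mul, Matrix.trace_smul, RingHom.id_apply, smul_eq_mul]
    module

/-! ### The random matrix ansatz in an energy window -/

/-- The eigenstates with energy in `[e₀ - Δ/2, e₀ + Δ/2]`. -/
abbrev Window {ι : Type*} (E : ι → ℝ) (e₀ Δ : ℝ) : Type _ :=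
  {α : ι // E α ∈ Set.Icc (e₀ - Δ / 2) (e₀ + Δ / 2)}

/-- `Tr Π_Δ`, the number of eigenstates with energy in the window of width `Δ` around `e₀`. -/
def windowDim {ι : Type*} (E : ι → ℝ) (e₀ Δ : ℝ) : ℕ :=
  Nat.card (Window E e₀ Δ)

/-- The standard complex Gaussian law `CN(0, 1)`: independent real and imaginary parts of mean `0`
and variance `1/2`. -/
def stdComplexGaussian : Measure ℂ :=
  ((gaussianReal 0 (1 / 2)).prod (gaussianReal 0 (1 / 2))).map fun x : ℝ × ℝ =>
    (x.1 : ℂ) + (x.2 : ℂ) * Complex.I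

/-- `m` independent Hermitian arrays of Gaussians of mean `0` and variance `1`: the entries on and
above the diagonal are independent, those above it have the law `CN(0, 1)`, and those on it are
real standard Gaussians. -/
structure IsHermitianGaussian {Ω : Type*} [MeasurableSpace Ω] (P : Measure Ω) {W : Type*}
    [LinearOrder W] {m : ℕ} (g : Fin m → W → W → Ω → ℂ) : Prop where
  hermitian : ∀ i α β ω, g i α β ω = star (g i β α ω)
  law_offDiag : ∀ i α β, α < β → HasLaw (g i α β) stdComplexGaussian P
  law_diag : ∀ i α, HasLaw (g i α α) ((gaussianReal 0 1).map Complex.ofReal) P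
  indep : iIndepFun
    (fun k : Fin m × {p : W × W // p.1 ≤ p.2} => g k.1 k.2.1.1 k.2.1.2) P

/-- A Hermitian operator with square `I`. -/
def IsReflection {ι : Type*} [Fintype ι] [DecidableEq ι] (A : Matrix ι ι ℂ) : Prop :=
  A.IsHermitian ∧ A * A = 1

/-- `A₁, …, A_m` are Hermitian, square to `I`, and have in the window the matrix elements
`⟨ν_α|A_i|ν_β⟩ = μ^i_α δ_{αβ} + f_{αβ} G^i_{αβ} / √(Tr Π_Δ)`. Nothing is asked of the matrix
elements outside the window. -/
def IsRealization {ι : Type*} [Fintype ι] [DecidableEq ι]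
    (ν : OrthonormalBasis ι ℂ (EuclideanSpace ℂ ι)) (E : ι → ℝ) (e₀ Δ : ℝ) {m : ℕ}
    (μ : Fin m → Window E e₀ Δ → ℝ) (F : Window E e₀ Δ → Window E e₀ Δ → ℝ)
    (G : Fin m → Window E e₀ Δ → Window E e₀ Δ → ℂ) (A : Fin m → Matrix ι ι ℂ) : Prop :=
  (∀ i, IsReflection (A i)) ∧
    ∀ (i : Fin m) (α β : Window E e₀ Δ),
      inner ℂ (ν α) (Matrix.toEuclideanLin (A i) (ν β)) =
        (if α = β then (μ i α : ℂ) else 0) +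
          (F α β : ℂ) / (Real.sqrt (windowDim E e₀ Δ) : ℂ) * G i α β

/-- An acceptance probability `acc` singles out a vector with margin `δ`: there is a unit vector of
maximal acceptance probability `p`, and every unit vector orthogonal to it is accepted with
probability at most `p - δ`. -/
def SinglesOut {V : Type*} [NormedAddCommGroup V] [InnerProductSpace ℂ V] (acc : V → ℝ)
    (p δ : ℝ) : Prop :=
  ∃ Ψ : V, ‖Ψ‖ = 1 ∧ acc Ψ = p ∧ (∀ Φ : V, ‖Φ‖ = 1 → acc Φ ≤ p) ∧
    ∀ Φ : V, ‖Φ‖ = 1 → inner ℂ Ψ Φ = 0 → acc Φ ≤ p - δ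

end EnergyTest

end

noncomputable section

namespace EnergyTest

/-! ### Trace moments of sums of independent Hermitian matrices -/

/-! Reduction to two eigenvalues. Appending |u⟩, measuring Π_SP and projecting back onto |u⟩ acts on
a system register as an operator that is diagonal in the energy basis. Its eigenvalue q is the
probability that phase estimation returns a grid point of the window; up to O(1/√L) it is 1 well
inside the window and 0 outside. Because A_i² = 1, e^{±iεA_i} = cos ε ± i sin ε A_i, and projecting
T onto |t⟩ averages over i and over the two signs, which cancels the odd terms and leaves cos²ε +
sin²ε · (1/m) ∑ A_i ⊗ conj A_i (`stepAverage`). Hence ψ is accepted with probability ‖Xψ‖², where X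
is this average between two filters q ⊗ q (`acceptProb_eq`). X is Hermitian and, as sin²ε ≤ 1/2,
positive, so everything is decided by its two largest eigenvalues.

The spectral gap. For the ansatz, (1/m) ∑ A'_i ⊗ conj A'_i restricted to the window is close to a
scalar μ₂ plus the kernel B = F²/D on the span of the |αα⟩, with D the window dimension
(`WindowForm`). The entries of B lie in [f²/D, 1/D], so B has a positive Perron vector v with
eigenvalue l ≥ f² and v_α² ≤ 1/(f⁴D). Thus f⁶ v vᵀ ≤ B entrywise; B − f⁶ v vᵀ is nonnegative with
the positive eigenvector v, and the Schur test bounds its form by l − f⁶ (`exists_perron`). Since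
sin²ε is of order f¹⁴, the gap of X is of order f²⁰. It dominates the variation of the μ^i, which
costs sin²ε · f⁷, of order f²¹, and the energies near the edge of the window, which carry weight
f²⁵/f⁴ = f²¹ of v. The remaining errors are 1/√L and a statistical error t (`margin_bounds`).

The statistical error. Entries of ∑ A'_i ⊗ conj A'_i that survive averaging over diagonal phases are
scalar sums of independent variables, controlled by Chernoff bounds. The rest (`phaseDeviation`)
needs no norm bound for Gaussian matrices: the law of the arrays is invariant under independent
diagonal phases for each i, and a ⊗ conj a is a contraction when a is a block of a reflection. With
the array fixed and only the phases random, the deviation is a sum of m independent, centred,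
bounded Hermitian matrices, and an exchangeable-pair argument bounds its trace moments
(`sum_trace_pow_le`). Moments of order about m^{1/3} ≥ n absorb the dimension factor 4ⁿ and give t
of order m^{-1/3} outside an event of probability e^{-m^{1/3}}. The good event depends on g alone;
the contraction property is supplied by the realization.

Passing from A' to A. The diamond distance changes acceptance probabilities by at most half its
value (`abs_acceptProb_sub_le`), and the min-max principle carries both eigenvalue bounds over to
the acceptance operator of A (`singlesOut_of_close`). -/

theorem exists_unitary_diagonal {κ : Type*} [Fintype κ] [DecidableEq κ] {A : Matrix κ κ ℂ}
    (hA : A.IsHermitian) :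
    ∃ (U : Matrix κ κ ℂ) (a : κ → ℝ), U.conjTranspose * U = 1 ∧ U * U.conjTranspose = 1 ∧
      A = U * Matrix.diagonal (fun i => (a i : ℂ)) * U.conjTranspose := by
  refine ⟨hA.eigenvectorUnitary, hA.eigenvalues, ?_, ?_, ?_⟩
  · exact Unitary.coe_star_mul_self hA.eigenvectorUnitary
  · exact Unitary.coe_mul_star_self hA.eigenvectorUnitary
  · conv_lhs => rw [hA.spectral_theorem]
    rfl

theorem conj_diagonal_pow {κ : Type*} [Fintype κ] [DecidableEq κ] {U : Matrix κ κ ℂ}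
    (hU : U.conjTranspose * U = 1) (hU' : U * U.conjTranspose = 1) (a : κ → ℂ) (k : ℕ) :
    (U * Matrix.diagonal a * U.conjTranspose) ^ k =
      U * Matrix.diagonal (fun i => a i ^ k) * U.conjTranspose := by
  induction k with
  | zero => simp [hU']
  | succ k ih =>
    rw [pow_succ, ih]
    calc _ = U * Matrix.diagonal (fun i => a i ^ k) * (U.conjTranspose * U) *
          Matrix.diagonal a * U.conjTranspose := by simp only [Matrix.mul_assoc]
      _ = _ := by
        rw [hU, Matrix.mul_one, Matrix.mul_assoc U, Matrix.diagonal_mul_diagonal]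
        simp only [pow_succ]

/-- The weights |⟨u_j, v_l⟩|² of two eigenbases act like a joint distribution of the two spectra, so
scalar inequalities can be applied to traces of noncommuting matrices. -/
theorem trace_conj_diagonal_mul {κ : Type*} [Fintype κ] [DecidableEq κ] (U V : Matrix κ κ ℂ)
    (a b : κ → ℂ) :
    ((U * Matrix.diagonal a * U.conjTranspose) *
      (V * Matrix.diagonal b * V.conjTranspose)).trace =
      ∑ j, ∑ l, a j * b l * ((‖(U.conjTranspose * V) j l‖ ^ 2 : ℝ) : ℂ) := by
  have h1 : ((U * Matrix.diagonal a * U.conjTranspose) *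
      (V * Matrix.diagonal b * V.conjTranspose)).trace =
      (Matrix.diagonal a * (U.conjTranspose * V) * Matrix.diagonal b *
        (U.conjTranspose * V).conjTranspose).trace := by
    rw [Matrix.conjTranspose_mul, Matrix.conjTranspose_conjTranspose]
    calc _ = (U * (Matrix.diagonal a * U.conjTranspose *
          (V * Matrix.diagonal b * V.conjTranspose))).trace := by simp only [Matrix.mul_assoc]
      _ = _ := by rw [Matrix.trace_mul_comm]; simp only [Matrix.mul_assoc]
  rw [h1, Matrix.trace]
  refine Finset.sum_congr rfl fun j _ => ?_
  rw [Matrix.diag_apply, Matrix.mul_apply]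
  refine Finset.sum_congr rfl fun l _ => ?_
  rw [Matrix.mul_diagonal, Matrix.diagonal_mul, Matrix.conjTranspose_apply]
  have : (U.conjTranspose * V) j l * star ((U.conjTranspose * V) j l) =
      ((‖(U.conjTranspose * V) j l‖ ^ 2 : ℝ) : ℂ) := by
    rw [Complex.star_def, Complex.mul_conj, Complex.normSq_eq_norm_sq]
  rw [← this]; ring

theorem sum_sq_norm_mul_eq_diag {κ : Type*} [Fintype κ] [DecidableEq κ] {U V : Matrix κ κ ℂ}
    (hV' : V * V.conjTranspose = 1) (D : Matrix κ κ ℂ) (j : κ) :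
    ∑ l, ‖(U.conjTranspose * D * V) j l‖ ^ 2 =
      ∑ i, ‖(Matrix.mulVec D.conjTranspose fun x => U x j) i‖ ^ 2 := by
  have key : ∀ (M : Matrix κ κ ℂ) (j : κ),
      ((∑ l, ‖M j l‖ ^ 2 : ℝ) : ℂ) = (M * M.conjTranspose) j j := by
    intro M j
    rw [Matrix.mul_apply]; push_cast
    refine Finset.sum_congr rfl fun l _ => ?_
    rw [Matrix.conjTranspose_apply, Complex.star_def, Complex.mul_conj,
      Complex.normSq_eq_norm_sq]; push_cast; rfl
  have h2 : ∑ i, ‖(Matrix.mulVec D.conjTranspose fun x => U x j) i‖ ^ 2 =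
      ∑ l, ‖(U.conjTranspose * D) j l‖ ^ 2 := by
    refine Finset.sum_congr rfl fun l _ => ?_
    have : (Matrix.mulVec D.conjTranspose fun x => U x j) l =
        star ((U.conjTranspose * D) j l) := by
      simp [Matrix.mulVec, dotProduct, Matrix.mul_apply, mul_comm]
    rw [this, norm_star]
  rw [h2]
  apply Complex.ofReal_injective
  rw [key, key]
  rw [Matrix.conjTranspose_mul (U.conjTranspose * D) V, Matrix.mul_assoc (U.conjTranspose * D) V,
    ← Matrix.mul_assoc V, hV', Matrix.one_mul]

/-- In the two eigenbases A − B has the entries (a_j − b_l)⟨u_j, v_l⟩, so the weighted sum is ‖(A −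
B)u_j‖². -/
theorem sum_weight_sq_sub_le {κ : Type*} [Fintype κ] [DecidableEq κ] {U V : Matrix κ κ ℂ}
    (hU : U.conjTranspose * U = 1)
    (hV : V.conjTranspose * V = 1) (hV' : V * V.conjTranspose = 1) (a b : κ → ℝ) {A B : Matrix κ κ ℂ}
    (hA : A = U * Matrix.diagonal (fun i => (a i : ℂ)) * U.conjTranspose)
    (hB : B = V * Matrix.diagonal (fun i => (b i : ℂ)) * V.conjTranspose) {r : ℝ}
    (hAB : (A - B).IsHermitian)
    (hr : ∀ x : κ → ℂ, ∑ i, ‖((A - B).mulVec x) i‖ ^ 2 ≤ r * ∑ i, ‖x i‖ ^ 2) (j : κ) :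
    ∑ l, ‖(U.conjTranspose * V) j l‖ ^ 2 * (a j - b l) ^ 2 ≤ r := by
  have h1 : ∀ l, ‖(U.conjTranspose * V) j l‖ ^ 2 * (a j - b l) ^ 2 =
      ‖(U.conjTranspose * (A - B) * V) j l‖ ^ 2 := by
    intro l
    have : U.conjTranspose * (A - B) * V =
        Matrix.diagonal (fun i => (a i : ℂ)) * (U.conjTranspose * V) -
        (U.conjTranspose * V) * Matrix.diagonal (fun i => (b i : ℂ)) := by
      rw [Matrix.mul_sub, Matrix.sub_mul, hA, hB]
      congr 1
      · calc _ = (U.conjTranspose * U) * Matrix.diagonal (fun i => (a i : ℂ)) *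
              (U.conjTranspose * V) := by simp only [Matrix.mul_assoc]
          _ = _ := by rw [hU, Matrix.one_mul]
      · calc _ = U.conjTranspose * V * Matrix.diagonal (fun i => (b i : ℂ)) *
              (V.conjTranspose * V) := by simp only [Matrix.mul_assoc]
          _ = _ := by rw [hV, Matrix.mul_one]
    rw [this, Matrix.sub_apply, Matrix.diagonal_mul, Matrix.mul_diagonal]
    have : (a j : ℂ) * (U.conjTranspose * V) j l - (U.conjTranspose * V) j l * (b l : ℂ) =
        (U.conjTranspose * V) j l * ((a j - b l : ℝ) : ℂ) := by push_cast; ring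
    rw [this, norm_mul, mul_pow, Complex.norm_real, Real.norm_eq_abs, sq_abs]
  rw [Finset.sum_congr rfl fun l _ => h1 l, sum_sq_norm_mul_eq_diag hV', hAB.eq]
  refine (hr _).trans_eq ?_
  have : ∑ i, ‖U i j‖ ^ 2 = 1 := by
    have h := congrFun (congrFun hU j) j
    rw [Matrix.mul_apply, Matrix.one_apply_eq] at h
    apply Complex.ofReal_injective
    rw [Complex.ofReal_one, ← h]; push_cast
    refine Finset.sum_congr rfl fun l _ => ?_
    rw [Matrix.conjTranspose_apply, Complex.star_def, mul_comm, Complex.mul_conj,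
      Complex.normSq_eq_norm_sq]; push_cast; rfl
  rw [this, mul_one]

/-- Factoring the difference of powers leaves (x − y)² times 2p + 1 monomials of degree 2p, each at
most the larger of the two even powers. -/
theorem sub_mul_pow_sub_le (x y : ℝ) {p : ℕ} :
    (x - y) * (x ^ (2 * p + 1) - y ^ (2 * p + 1)) ≤
      (2 * p + 1) * ((x - y) ^ 2 * x ^ (2 * p) + (x - y) ^ 2 * y ^ (2 * p)) := by
  have h := (Commute.all x y).mul_geom_sum₂ (2 * p + 1)
  rw [← h, ← mul_assoc, ← sq, ← mul_add, mul_left_comm]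
  refine mul_le_mul_of_nonneg_left ?_ (sq_nonneg _)
  have : ∀ i ∈ Finset.range (2 * p + 1),
      x ^ i * y ^ (2 * p + 1 - 1 - i) ≤ x ^ (2 * p) + y ^ (2 * p) := by
    intro i hi
    have hi' : i ≤ 2 * p := by simpa [Nat.lt_succ_iff] using hi
    have e1 : x ^ (2 * p) = |x| ^ (2 * p) := by rw [Even.pow_abs ⟨p, by ring⟩]
    have e2 : y ^ (2 * p) = |y| ^ (2 * p) := by rw [Even.pow_abs ⟨p, by ring⟩]
    refine (le_abs_self _).trans ?_
    rw [abs_mul, abs_pow, abs_pow, e1, e2, Nat.add_sub_cancel]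
    rcases le_total |x| |y| with hxy | hxy
    · calc |x| ^ i * |y| ^ (2 * p - i) ≤ |y| ^ i * |y| ^ (2 * p - i) := by gcongr
        _ = |y| ^ (2 * p) := by rw [← pow_add, Nat.add_sub_cancel' hi']
        _ ≤ _ := by have := pow_nonneg (abs_nonneg x) (2 * p); linarith
    · calc |x| ^ i * |y| ^ (2 * p - i) ≤ |x| ^ i * |x| ^ (2 * p - i) := by gcongr
        _ = |x| ^ (2 * p) := by rw [← pow_add, Nat.add_sub_cancel' hi']
        _ ≤ _ := by have := pow_nonneg (abs_nonneg y) (2 * p); linarith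
  refine (Finset.sum_le_sum this).trans_eq ?_
  simp; ring

/-- The scalar inequality, summed against the joint weights of the two spectra. Summing out one
index turns the factor (a_j − b_l)² into at most r. -/
theorem trace_sub_mul_pow_sub_le {κ : Type*} [Fintype κ] [DecidableEq κ] {A B : Matrix κ κ ℂ}
    (hA : A.IsHermitian) (hB : B.IsHermitian) {r : ℝ}
    (hr : ∀ x : κ → ℂ, ∑ i, ‖((A - B).mulVec x) i‖ ^ 2 ≤ r * ∑ i, ‖x i‖ ^ 2) (p : ℕ) :
    ((A - B) * (A ^ (2 * p + 1) - B ^ (2 * p + 1))).trace.re ≤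
      (2 * p + 1) * r * ((A ^ (2 * p)).trace.re + (B ^ (2 * p)).trace.re) := by
  have hr' : ∀ x : κ → ℂ, ∑ i, ‖((B - A).mulVec x) i‖ ^ 2 ≤ r * ∑ i, ‖x i‖ ^ 2 := by
    intro x
    have : (B - A).mulVec x = -((A - B).mulVec x) := by
      rw [← Matrix.neg_mulVec, neg_sub]
    simpa [this] using hr x
  have hAB := hA.sub hB
  have hBA := hB.sub hA
  obtain ⟨U, a, hU, hU', ha⟩ := exists_unitary_diagonal hA
  obtain ⟨V, b, hV, hV', hb⟩ := exists_unitary_diagonal hB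
  set w : κ → κ → ℝ := fun j l => ‖(U.conjTranspose * V) j l‖ ^ 2 with hw
  have hw0 : ∀ j l, 0 ≤ w j l := fun j l => sq_nonneg _
  have hwsymm : ∀ j l, ‖(V.conjTranspose * U) l j‖ ^ 2 = w j l := by
    intro j l
    have : (V.conjTranspose * U) l j = star ((U.conjTranspose * V) j l) := by
      rw [← Matrix.conjTranspose_apply, Matrix.conjTranspose_mul,
        Matrix.conjTranspose_conjTranspose]
    rw [this, norm_star]
  have hpow : ∀ k k' : ℕ, (A ^ k * B ^ k').trace.re = ∑ j, ∑ l, a j ^ k * b l ^ k' * w j l := by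
    intro k k'
    rw [ha, hb, conj_diagonal_pow hU hU', conj_diagonal_pow hV hV', trace_conj_diagonal_mul]
    rw [Complex.re_sum]
    refine Finset.sum_congr rfl fun j _ => ?_
    rw [Complex.re_sum]
    refine Finset.sum_congr rfl fun l _ => ?_
    rw [← Complex.ofReal_pow, ← Complex.ofReal_pow, ← Complex.ofReal_mul, ← Complex.ofReal_mul,
      Complex.ofReal_re]
  have hApow : ∀ k, (A ^ k).trace.re = ∑ j, ∑ l, a j ^ k * w j l := by
    intro k; simpa using hpow k 0
  have hBpow : ∀ k, (B ^ k).trace.re = ∑ j, ∑ l, b l ^ k * w j l := by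
    intro k; simpa using hpow 0 k
  have hAtr : ∀ k, (A ^ k).trace.re = ∑ j, a j ^ k := by
    intro k
    rw [ha, conj_diagonal_pow hU hU', Matrix.trace_mul_comm, ← Matrix.mul_assoc, hU,
      Matrix.one_mul, Matrix.trace_diagonal, Complex.re_sum]
    simp [← Complex.ofReal_pow]
  have hBtr : ∀ k, (B ^ k).trace.re = ∑ j, b j ^ k := by
    intro k
    rw [hb, conj_diagonal_pow hV hV', Matrix.trace_mul_comm, ← Matrix.mul_assoc, hV,
      Matrix.one_mul, Matrix.trace_diagonal, Complex.re_sum]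
    simp [← Complex.ofReal_pow]
  have e1 : ((A - B) * (A ^ (2 * p + 1) - B ^ (2 * p + 1))).trace.re =
      ∑ j, ∑ l, w j l * ((a j - b l) * (a j ^ (2 * p + 1) - b l ^ (2 * p + 1))) := by
    have : (A - B) * (A ^ (2 * p + 1) - B ^ (2 * p + 1)) =
        A ^ (2 * p + 2) - A ^ 1 * B ^ (2 * p + 1) - B * A ^ (2 * p + 1) + B ^ (2 * p + 2) := by
      rw [Matrix.sub_mul, Matrix.mul_sub, Matrix.mul_sub, ← pow_succ', ← pow_succ', pow_one]
      abel
    rw [this]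
    have h3 : (B * A ^ (2 * p + 1)).trace.re = (A ^ (2 * p + 1) * B ^ 1).trace.re := by
      rw [Matrix.trace_mul_comm, pow_one]
    simp only [Matrix.trace_add, Matrix.trace_sub, Complex.add_re, Complex.sub_re]
    rw [h3, hpow, hpow, hApow, hBpow]
    simp only [← Finset.sum_add_distrib, ← Finset.sum_sub_distrib]
    refine Finset.sum_congr rfl fun j _ => Finset.sum_congr rfl fun l _ => ?_
    ring
  rw [e1]
  calc _ ≤ ∑ j, ∑ l, w j l * ((2 * p + 1) * ((a j - b l) ^ 2 * a j ^ (2 * p) +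
        (a j - b l) ^ 2 * b l ^ (2 * p))) :=
        Finset.sum_le_sum fun j _ => Finset.sum_le_sum fun l _ =>
          mul_le_mul_of_nonneg_left (sub_mul_pow_sub_le _ _) (hw0 j l)
    _ = (2 * p + 1) * (∑ j, a j ^ (2 * p) * ∑ l, w j l * (a j - b l) ^ 2) +
        (2 * p + 1) * (∑ l, b l ^ (2 * p) * ∑ j, w j l * (b l - a j) ^ 2) := by
        simp only [Finset.mul_sum]
        conv_rhs => rw [add_comm, Finset.sum_comm, add_comm]
        simp only [← Finset.sum_add_distrib]
        refine Finset.sum_congr rfl fun j _ => Finset.sum_congr rfl fun l _ => ?_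
        ring
    _ ≤ (2 * p + 1) * (∑ j, a j ^ (2 * p) * r) + (2 * p + 1) * (∑ l, b l ^ (2 * p) * r) := by
        have hp0 : (0 : ℝ) ≤ 2 * p + 1 := by positivity
        refine add_le_add (mul_le_mul_of_nonneg_left (Finset.sum_le_sum fun j _ =>
          mul_le_mul_of_nonneg_left ?_ ?_) hp0) (mul_le_mul_of_nonneg_left
            (Finset.sum_le_sum fun l _ => mul_le_mul_of_nonneg_left ?_ ?_) hp0)
        · exact sum_weight_sq_sub_le hU hV hV' a b ha hb hAB hr j
        · rw [pow_mul]; positivity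
        · have := sum_weight_sq_sub_le hV hU hU' b a hb ha hBA hr' l
          simpa only [hwsymm] using this
        · rw [pow_mul]; positivity
    _ = _ := by
        rw [hAtr, hBtr, ← Finset.sum_mul, ← Finset.sum_mul]; ring

/-- The swap `(u, v) ↦ (u with `u i` replaced by `v`, u i)`. -/
def swapCoord {I Γ : Type*} [DecidableEq I] (i : I) : (I → Γ) × Γ ≃ (I → Γ) × Γ where
  toFun x := (Function.update x.1 i x.2, x.1 i)
  invFun x := (Function.update x.1 i x.2, x.1 i)
  left_inv x := by simp
  right_inv x := by simp

/-- Method of exchangeable pairs. One factor S of S^{2p+2} is expanded as ∑ Y_i. Since Y_i is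
centred, Y_i(u_i) may be replaced by Y_i(u_i) − Y_i(v) with a fresh v, which is S − S' for S' the
sum with coordinate i resampled. Exchanging S and S' also turns the other factor into a difference,
where `trace_sub_mul_pow_sub_le` applies, and S' has the same distribution as S. -/
theorem sum_trace_pow_step {I Γ κ : Type*} [Fintype I] [DecidableEq I] [Fintype Γ] [Nonempty Γ]
    [Fintype κ] [DecidableEq κ] (Y : I → Γ → Matrix κ κ ℂ) (hY : ∀ i v, (Y i v).IsHermitian)
    (hmean : ∀ i, ∑ v, Y i v = 0) {r : ℝ}
    (hr : ∀ i v v' (x : κ → ℂ), ∑ k, ‖((Y i v - Y i v').mulVec x) k‖ ^ 2 ≤ r * ∑ k, ‖x k‖ ^ 2)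
    (p : ℕ) :
    ∑ u : I → Γ, ((∑ i, Y i (u i)) ^ (2 * (p + 1))).trace.re ≤
      (2 * p + 1) * Fintype.card I * r *
        ∑ u : I → Γ, ((∑ i, Y i (u i)) ^ (2 * p)).trace.re := by
  set S : (I → Γ) → Matrix κ κ ℂ := fun u => ∑ i, Y i (u i) with hS
  have hSh : ∀ u, (S u).IsHermitian := by
    intro u
    rw [hS, Matrix.IsHermitian, Matrix.conjTranspose_sum]
    exact Finset.sum_congr rfl fun i _ => hY i _
  have hdiff : ∀ u i v, S u - S (Function.update u i v) = Y i (u i) - Y i v := by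
    intro u i v
    simp only [hS]
    rw [← Finset.sum_sub_distrib, Finset.sum_eq_single i]
    · simp
    · intro j _ hj; simp [Function.update_of_ne hj]
    · simp
  have hG : (0 : ℝ) < Fintype.card Γ := by exact_mod_cast Fintype.card_pos
  set q := 2 * p + 1 with hq
  have hstep : ∀ i, (Fintype.card Γ : ℝ) * ∑ u, (Y i (u i) * S u ^ q).trace.re ≤
      Fintype.card Γ * ((2 * p + 1) * r * ∑ u, (S u ^ (2 * p)).trace.re) := by
    intro i
    set h : (I → Γ) × Γ → ℝ := fun x => ((Y i (x.1 i) - Y i x.2) * S x.1 ^ q).trace.re with hh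
    -- The fresh copy v is independent of S and has mean zero, so its term drops out.
    have e0 : ∑ x : (I → Γ) × Γ, (Y i x.2 * S x.1 ^ q).trace.re = 0 := by
      rw [Fintype.sum_prod_type]
      refine Finset.sum_eq_zero fun u _ => ?_
      simp only
      rw [← Complex.re_sum, ← Matrix.trace_sum, ← Finset.sum_mul, hmean]
      simp
    have e1 : (Fintype.card Γ : ℝ) * ∑ u, (Y i (u i) * S u ^ q).trace.re = ∑ x, h x := by
      have : ∑ x, h x = ∑ x : (I → Γ) × Γ, (Y i (x.1 i) * S x.1 ^ q).trace.re -
          ∑ x : (I → Γ) × Γ, (Y i x.2 * S x.1 ^ q).trace.re := by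
        rw [← Finset.sum_sub_distrib]
        refine Finset.sum_congr rfl fun x _ => ?_
        rw [hh, ← Complex.sub_re, ← Matrix.trace_sub, ← Matrix.sub_mul]
      rw [this, e0, sub_zero, Fintype.sum_prod_type, Finset.mul_sum]
      simp
    have e2 : ∑ x, h x = ∑ x, h (swapCoord i x) := (Equiv.sum_comp (swapCoord i) h).symm
    have e3 : 2 * ∑ x, h x = ∑ x : (I → Γ) × Γ, ((S x.1 - S (Function.update x.1 i x.2)) *
        (S x.1 ^ q - S (Function.update x.1 i x.2) ^ q)).trace.re := by
      rw [two_mul]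
      nth_rewrite 2 [e2]
      rw [← Finset.sum_add_distrib]
      refine Finset.sum_congr rfl fun x _ => ?_
      simp only [hh, swapCoord, Equiv.coe_fn_mk, Function.update_self]
      rw [hdiff, ← Complex.add_re, ← Matrix.trace_add]
      congr 2
      noncomm_ring
    have e4 : 2 * ∑ x, h x ≤ ∑ x : (I → Γ) × Γ, (2 * p + 1) * r *
        ((S x.1 ^ (2 * p)).trace.re + (S (Function.update x.1 i x.2) ^ (2 * p)).trace.re) := by
      rw [e3]
      refine Finset.sum_le_sum fun x _ => ?_
      refine trace_sub_mul_pow_sub_le (hSh _) (hSh _) ?_ p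
      rw [hdiff]
      exact hr i _ _
    have e5 : ∑ x : (I → Γ) × Γ, (S (Function.update x.1 i x.2) ^ (2 * p)).trace.re =
        ∑ x : (I → Γ) × Γ, (S x.1 ^ (2 * p)).trace.re :=
      Equiv.sum_comp (swapCoord i) fun x : (I → Γ) × Γ => (S x.1 ^ (2 * p)).trace.re
    have e6 : ∑ x : (I → Γ) × Γ, (S x.1 ^ (2 * p)).trace.re =
        Fintype.card Γ * ∑ u, (S u ^ (2 * p)).trace.re := by
      rw [Fintype.sum_prod_type, Finset.mul_sum]; simp
    rw [← Finset.mul_sum, Finset.sum_add_distrib, e5, e6] at e4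
    rw [e1]; nlinarith
  have hstep' : ∀ i, ∑ u, (Y i (u i) * S u ^ q).trace.re ≤
      (2 * p + 1) * r * ∑ u, (S u ^ (2 * p)).trace.re :=
    fun i => le_of_mul_le_mul_left (hstep i) hG
  have : ∑ u : I → Γ, (S u ^ (2 * (p + 1))).trace.re =
      ∑ i, ∑ u, (Y i (u i) * S u ^ q).trace.re := by
    rw [Finset.sum_comm]
    refine Finset.sum_congr rfl fun u _ => ?_
    rw [← Complex.re_sum, ← Matrix.trace_sum, ← Finset.sum_mul]
    rw [show 2 * (p + 1) = q + 1 by omega, pow_succ']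
  rw [this]
  refine (Finset.sum_le_sum fun i _ => hstep' i).trans_eq ?_
  rw [Finset.sum_const, nsmul_eq_mul, Finset.card_univ]; ring

/-- The recursion is iterated p times with the factors 2q + 1 all replaced by 2p; this loses only a
constant to the power p. -/
theorem sum_trace_pow_le {I Γ κ : Type*} [Fintype I] [DecidableEq I] [Fintype Γ] [Nonempty Γ]
    [Fintype κ] [DecidableEq κ] (Y : I → Γ → Matrix κ κ ℂ) (hY : ∀ i v, (Y i v).IsHermitian)
    (hmean : ∀ i, ∑ v, Y i v = 0) {r : ℝ} (hr0 : 0 ≤ r)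
    (hr : ∀ i v v' (x : κ → ℂ), ∑ k, ‖((Y i v - Y i v').mulVec x) k‖ ^ 2 ≤ r * ∑ k, ‖x k‖ ^ 2)
    (p : ℕ) :
    ∑ u : I → Γ, ((∑ i, Y i (u i)) ^ (2 * p)).trace.re ≤
      Fintype.card (I → Γ) * Fintype.card κ * (2 * p * Fintype.card I * r) ^ p := by
  have key : ∀ q ≤ p, ∑ u : I → Γ, ((∑ i, Y i (u i)) ^ (2 * q)).trace.re ≤
      Fintype.card (I → Γ) * Fintype.card κ * (2 * p * Fintype.card I * r) ^ q := by
    intro q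
    induction q with
    | zero => intro _; simp
    | succ q ih =>
      intro hq
      refine (sum_trace_pow_step Y hY hmean hr q).trans ?_
      have h1 := ih (by omega)
      have h2 : ((2 * q + 1 : ℝ)) ≤ 2 * p := by
        have : 2 * q + 1 ≤ 2 * p := by omega
        exact_mod_cast this
      calc _ ≤ (2 * q + 1) * Fintype.card I * r * (Fintype.card (I → Γ) * Fintype.card κ *
            (2 * p * Fintype.card I * r) ^ q) := by gcongr
        _ ≤ 2 * p * Fintype.card I * r * (Fintype.card (I → Γ) * Fintype.card κ *
            (2 * p * Fintype.card I * r) ^ q) := by gcongr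
        _ = _ := by rw [pow_succ]; ring
  exact key p le_rfl

/-- Jensen's inequality for the even power, with the spectral weights of x as probabilities; each
weight is at most 1. -/
theorem re_quadratic_pow_le_trace {κ : Type*} [Fintype κ] [DecidableEq κ] {A : Matrix κ κ ℂ}
    (hA : A.IsHermitian) (p : ℕ) (x : κ → ℂ) (hx : ∑ i, ‖x i‖ ^ 2 = 1) :
    (star x ⬝ᵥ A.mulVec x).re ^ (2 * p) ≤ (A ^ (2 * p)).trace.re := by
  obtain ⟨U, a, hU, hU', ha⟩ := exists_unitary_diagonal hA
  set y : κ → ℂ := U.conjTranspose.mulVec x with hy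
  have hsum : ∀ z : κ → ℂ, star z ⬝ᵥ z = ((∑ i, ‖z i‖ ^ 2 : ℝ) : ℂ) := by
    intro z
    simp only [dotProduct, Pi.star_apply]
    push_cast
    refine Finset.sum_congr rfl fun i _ => ?_
    rw [Complex.star_def, mul_comm, Complex.mul_conj, Complex.normSq_eq_norm_sq]
    push_cast; rfl
  have hy1 : ∑ i, ‖y i‖ ^ 2 = 1 := by
    have h : star y ⬝ᵥ y = star x ⬝ᵥ x := by
      rw [hy, Matrix.star_mulVec, Matrix.conjTranspose_conjTranspose, Matrix.dotProduct_mulVec,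
        Matrix.vecMul_vecMul, hU', Matrix.vecMul_one]
    rw [hsum, hsum] at h
    rw [Complex.ofReal_injective h, hx]
  have hq : (star x ⬝ᵥ A.mulVec x).re = ∑ i, ‖y i‖ ^ 2 * a i := by
    have : star x ⬝ᵥ A.mulVec x = star y ⬝ᵥ (Matrix.diagonal fun i => (a i : ℂ)).mulVec y := by
      rw [hy, Matrix.star_mulVec, Matrix.conjTranspose_conjTranspose, ha,
        ← Matrix.mulVec_mulVec, ← Matrix.mulVec_mulVec, ← Matrix.dotProduct_mulVec]
    rw [this]
    simp only [dotProduct, Pi.star_apply, Matrix.mulVec_diagonal]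
    rw [Complex.re_sum]
    refine Finset.sum_congr rfl fun i _ => ?_
    have : star (y i) * ((a i : ℂ) * y i) = ((‖y i‖ ^ 2 * a i : ℝ) : ℂ) := by
      rw [mul_left_comm, Complex.star_def, mul_comm ((starRingEnd ℂ) (y i)), Complex.mul_conj,
        Complex.normSq_eq_norm_sq]; push_cast; ring
    rw [this, Complex.ofReal_re]
  have htr : (A ^ (2 * p)).trace.re = ∑ j, a j ^ (2 * p) := by
    rw [ha, conj_diagonal_pow hU hU', Matrix.trace_mul_comm, ← Matrix.mul_assoc, hU,
      Matrix.one_mul, Matrix.trace_diagonal, Complex.re_sum]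
    simp [← Complex.ofReal_pow]
  rw [hq, htr]
  refine (Real.pow_arith_mean_le_arith_mean_pow_of_even Finset.univ (fun i => ‖y i‖ ^ 2) a
    (fun i _ => sq_nonneg _) hy1 ⟨p, by ring⟩).trans ?_
  refine Finset.sum_le_sum fun i _ => ?_
  have h1 : ‖y i‖ ^ 2 ≤ 1 := by
    rw [← hy1]
    exact Finset.single_le_sum (f := fun i => ‖y i‖ ^ 2) (fun i _ => sq_nonneg _)
      (Finset.mem_univ i)
  have h2 : 0 ≤ a i ^ (2 * p) := by rw [pow_mul]; positivity
  nlinarith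

/-! ### A min-max principle for the two largest eigenvalues -/

open scoped InnerProductSpace

/-- The supremum of the Rayleigh quotient is an eigenvalue. The scalar field is left general because
the result serves over ℂ for the test and over ℝ for the Perron vector. -/
theorem exists_top_eigenvector {𝕜 V : Type*} [RCLike 𝕜] [NormedAddCommGroup V]
    [InnerProductSpace 𝕜 V] [FiniteDimensional 𝕜 V] [Nontrivial V] {T : V →ₗ[𝕜] V}
    (hT : T.IsSymmetric) :
    ∃ (x : V) (l : ℝ), ‖x‖ = 1 ∧ T x = (l : 𝕜) • x ∧
      ∀ y, RCLike.re ⟪T y, y⟫_𝕜 ≤ l * ‖y‖ ^ 2 := by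
  set l : ℝ := ⨆ x : { x : V // x ≠ 0 }, RCLike.re ⟪T x, x⟫_𝕜 / ‖(x : V)‖ ^ 2 with hl
  obtain ⟨x, hx⟩ := (hT.hasEigenvalue_iSup_of_finiteDimensional).exists_hasEigenvector
  have hx0 : x ≠ 0 := hx.2
  have hx1 : T x = ((l : ℝ) : 𝕜) • x := by
    have := hx.apply_eq_smul
    simpa using this
  refine ⟨((‖x‖⁻¹ : ℝ) : 𝕜) • x, l, ?_, ?_, ?_⟩
  · rw [norm_smul, RCLike.norm_ofReal, abs_of_nonneg (by positivity),
      inv_mul_cancel₀ (norm_ne_zero_iff.2 hx0)]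
  · rw [map_smul, hx1, smul_comm]
  · intro y
    by_cases hy : y = 0
    · simp [hy]
    have hbdd : BddAbove (Set.range fun x : { x : V // x ≠ 0 } =>
        RCLike.re ⟪T x, x⟫_𝕜 / ‖(x : V)‖ ^ 2) := by
      refine ⟨‖LinearMap.toContinuousLinearMap T‖, ?_⟩
      rintro _ ⟨z, rfl⟩
      have := (LinearMap.toContinuousLinearMap T).rayleighQuotient_le_norm z
      refine (le_abs_self _).trans (le_trans (le_of_eq ?_) this)
      rfl
    have h := le_ciSup hbdd ⟨y, hy⟩
    have hy0 : 0 < ‖y‖ ^ 2 := by positivity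
    rwa [div_le_iff₀ hy0] at h

/-- If `x` is a top eigenvector and the quadratic form is at most `r` on the orthogonal complement
of some vector, then it is at most `r` on the orthogonal complement of `x`. -/
theorem form_le_on_orthogonal {V : Type*} [NormedAddCommGroup V]
    [InnerProductSpace ℂ V] {T : V →ₗ[ℂ] V} (hT : T.IsSymmetric) {x : V} {l : ℝ} (hx : ‖x‖ = 1)
    (hTx : T x = (l : ℂ) • x) (hl : ∀ y, (⟪T y, y⟫_ℂ).re ≤ l * ‖y‖ ^ 2) {v : V} {r : ℝ}
    (hv : ∀ y, ⟪v, y⟫_ℂ = 0 → (⟪T y, y⟫_ℂ).re ≤ r * ‖y‖ ^ 2) {y : V} (hy : ⟪x, y⟫_ℂ = 0) :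
    (⟪T y, y⟫_ℂ).re ≤ r * ‖y‖ ^ 2 := by
  by_cases hvx : ⟪v, x⟫_ℂ = 0
  · have h1 := hv x hvx
    have h2 : (⟪T x, x⟫_ℂ).re = l := by
      rw [hTx, inner_smul_left, inner_self_eq_norm_sq_to_K, hx]; simp
    rw [h2, hx] at h1
    have := hl y
    nlinarith [sq_nonneg ‖y‖]
  set a : ℂ := ⟪v, y⟫_ℂ
  set b : ℂ := ⟪v, x⟫_ℂ with hb
  have hyx : ⟪y, x⟫_ℂ = 0 := by rw [← inner_conj_symm, hy]; simp
  have hTxy : ⟪T x, y⟫_ℂ = 0 := by rw [hTx, inner_smul_left, hy, mul_zero]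
  have hTyx : ⟪T y, x⟫_ℂ = 0 := by rw [hT, hTx, inner_smul_right, hyx, mul_zero]
  -- The plane spanned by x and y meets the hyperplane orthogonal to v in this vector. As x is an
  -- eigenvector orthogonal to y, both the form and the norm split without cross terms.
  have h1 := hv (a • x - b • y) (by
    rw [inner_sub_right, inner_smul_right, inner_smul_right]; ring)
  have hTxx : ⟪T x, x⟫_ℂ = l := by
    rw [hTx, inner_smul_left, inner_self_eq_norm_sq_to_K, hx]; simp
  have e1 : ⟪T (a • x - b • y), a • x - b • y⟫_ℂ =
      ((‖a‖ ^ 2 * l : ℝ) : ℂ) + ((‖b‖ ^ 2 : ℝ) : ℂ) * ⟪T y, y⟫_ℂ := by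
    simp only [map_sub, map_smul, inner_sub_left, inner_sub_right, inner_smul_left,
      inner_smul_right, hTxy, hTyx, hTxx]
    have h3 : ∀ z : ℂ, ((‖z‖ ^ 2 : ℝ) : ℂ) = (starRingEnd ℂ) z * z := by
      intro z; rw [mul_comm, Complex.mul_conj, Complex.normSq_eq_norm_sq]
    push_cast
    have h4 := h3 a; have h5 := h3 b
    push_cast at h4 h5
    rw [h4, h5]; ring
  have e2 : ‖a • x - b • y‖ ^ 2 = ‖a‖ ^ 2 + ‖b‖ ^ 2 * ‖y‖ ^ 2 := by
    have := norm_sub_sq (𝕜 := ℂ) (a • x) (b • y)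
    rw [inner_smul_left, inner_smul_right, hy] at this
    rw [this, norm_smul, norm_smul, hx]; simp; ring
  rw [e1, e2, Complex.add_re, Complex.ofReal_re, Complex.re_ofReal_mul] at h1
  have h2 := hl y
  have hb0 : 0 < ‖b‖ ^ 2 := by have := norm_pos_iff.2 hvx; positivity
  by_contra hcon
  push Not at hcon
  have hrl : r < l ∨ ‖y‖ ^ 2 = 0 := by
    rcases (sq_nonneg ‖y‖).eq_or_lt with h | h
    · right; exact h.symm
    · left; by_contra h'; push Not at h'; nlinarith
  rcases hrl with h | h
  · nlinarith [sq_nonneg ‖a‖, mul_lt_mul_of_pos_left hcon hb0]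
  · rw [h] at h2 hcon; linarith

/-- A positive operator whose quadratic form is at most `r` on a hyperplane expands no vector of
some hyperplane by more than the factor `r`. -/
theorem exists_norm_sq_le_on_orthogonal {V : Type*} [NormedAddCommGroup V]
    [InnerProductSpace ℂ V] [FiniteDimensional ℂ V] [Nontrivial V] {T : V →ₗ[ℂ] V}
    (hT : T.IsSymmetric) (hpos : ∀ y, 0 ≤ (⟪T y, y⟫_ℂ).re) {v : V} {r : ℝ}
    (hv : ∀ y, ⟪v, y⟫_ℂ = 0 → (⟪T y, y⟫_ℂ).re ≤ r * ‖y‖ ^ 2) :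
    ∃ x : V, ∀ y, ⟪x, y⟫_ℂ = 0 → ‖T y‖ ^ 2 ≤ r ^ 2 * ‖y‖ ^ 2 := by
  obtain ⟨x, l, hx, hTx, hl⟩ := exists_top_eigenvector hT
  refine ⟨x, fun y hy => ?_⟩
  have h1 : ∀ z, ⟪x, z⟫_ℂ = 0 → (⟪T z, z⟫_ℂ).re ≤ r * ‖z‖ ^ 2 :=
    fun z hz => form_le_on_orthogonal hT hx hTx hl hv hz
  have hTy : ⟪x, T y⟫_ℂ = 0 := by rw [← hT, hTx, inner_smul_left, hy, mul_zero]
  by_cases h0 : T y = 0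
  · rw [h0, norm_zero, zero_pow two_ne_zero]; positivity
  have hn : 0 < ‖T y‖ := norm_pos_iff.2 h0
  have hyn : 0 < ‖y‖ := norm_pos_iff.2 (by rintro rfl; simp at h0)
  have hA := h1 y hy
  have hB := h1 (T y) hTy
  -- Cauchy-Schwarz for the positive form, through the nonnegative quadratic `s ↦ form (y + s T y)`
  have hq : ∀ s : ℝ, 0 ≤ (⟪T y, y⟫_ℂ).re + 2 * s * ‖T y‖ ^ 2 + s ^ 2 * (⟪T (T y), T y⟫_ℂ).re := by
    intro s
    have h := hpos (y + (s : ℂ) • T y)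
    have e : ⟪T (y + (s : ℂ) • T y), y + (s : ℂ) • T y⟫_ℂ =
        ⟪T y, y⟫_ℂ + ((2 * s * ‖T y‖ ^ 2 : ℝ) : ℂ) + ((s ^ 2 : ℝ) : ℂ) * ⟪T (T y), T y⟫_ℂ := by
      have e2 : ⟪T (T y), y⟫_ℂ = ((‖T y‖ : ℝ) : ℂ) ^ 2 := by
        rw [hT]; exact inner_self_eq_norm_sq_to_K _
      have e3 : ⟪T y, T y⟫_ℂ = ((‖T y‖ : ℝ) : ℂ) ^ 2 := inner_self_eq_norm_sq_to_K _
      simp only [map_add, map_smul, inner_add_left, inner_add_right, inner_smul_left,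
        inner_smul_right, e2, e3, Complex.conj_ofReal]
      push_cast; ring
    rw [e, Complex.add_re, Complex.add_re, Complex.ofReal_re, Complex.re_ofReal_mul] at h
    exact h
  have hr0 : 0 ≤ r := by
    have := hpos y
    by_contra hr
    push Not at hr
    have : 0 < ‖y‖ ^ 2 := by positivity
    nlinarith
  rcases hr0.eq_or_lt with hr | hr
  · exfalso
    rw [← hr] at hA hB
    have h2 := hq (-1)
    have : 0 < ‖T y‖ ^ 2 := by positivity
    linarith
  -- The value s = -1/r makes the bound r‖Ty‖² on the quadratic term half as large as the linear
  -- term, which yields ‖Ty‖² ≤ r²‖y‖².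
  · have h2 := hq (-(1 / r))
    have h3 : 2 * (1 / r) * ‖T y‖ ^ 2 ≤ r * ‖y‖ ^ 2 + (1 / r) ^ 2 * (r * ‖T y‖ ^ 2) := by
      have := mul_le_mul_of_nonneg_left hB (sq_nonneg (1 / r))
      nlinarith
    have h4 : (1 / r) ^ 2 * (r * ‖T y‖ ^ 2) = 1 / r * ‖T y‖ ^ 2 := by field_simp
    rw [h4] at h3
    have h5 : 1 / r * ‖T y‖ ^ 2 ≤ r * ‖y‖ ^ 2 := by linarith
    have h6 := mul_le_mul_of_nonneg_left h5 hr.le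
    have h7 : r * (1 / r * ‖T y‖ ^ 2) = ‖T y‖ ^ 2 := by field_simp
    rw [h7] at h6
    nlinarith

/-- Ψ is the top eigenvector of the form `acc` itself. The hyperplane bound for `acc'` costs e/2
when passed to `acc`, and by the min-max principle it then holds orthogonally to Ψ; the lower bound
p₀ costs another e/2. -/
theorem singlesOut_of_close {V : Type*} [NormedAddCommGroup V]
    [InnerProductSpace ℂ V] [FiniteDimensional ℂ V] [Nontrivial V] {M : V →ₗ[ℂ] V}
    (hM : M.IsSymmetric) {acc acc' : V → ℝ} (hacc : ∀ y, acc y = (⟪M y, y⟫_ℂ).re) {e : ℝ}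
    (hclose : ∀ y, ‖y‖ = 1 → |acc y - acc' y| ≤ e / 2) {v x₀ : V} {r p₀ δ : ℝ}
    (hv : ∀ y, ‖y‖ = 1 → ⟪v, y⟫_ℂ = 0 → acc' y ≤ r) (hx₀ : ‖x₀‖ = 1) (hp₀ : p₀ ≤ acc' x₀)
    (hδ : δ ≤ p₀ - r - e) :
    ∃ p, p₀ - e / 2 ≤ p ∧ SinglesOut acc p δ := by
  obtain ⟨x, l, hx, hTx, hl⟩ := exists_top_eigenvector hM
  have hl' : ∀ y, (⟪M y, y⟫_ℂ).re ≤ l * ‖y‖ ^ 2 := hl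
  have hp : p₀ - e / 2 ≤ l := by
    have h1 := hl' x₀
    rw [← hacc, hx₀] at h1
    have := abs_le.1 (hclose x₀ hx₀)
    linarith [this.1]
  have hhom : ∀ y, ⟪v, y⟫_ℂ = 0 → (⟪M y, y⟫_ℂ).re ≤ (r + e / 2) * ‖y‖ ^ 2 := by
    intro y hy
    by_cases hy0 : y = 0
    · simp [hy0]
    have hn : ‖y‖ ≠ 0 := norm_ne_zero_iff.2 hy0
    set z : V := ((‖y‖⁻¹ : ℝ) : ℂ) • y with hz
    have hz1 : ‖z‖ = 1 := by
      rw [hz, norm_smul, Complex.norm_real, Real.norm_of_nonneg (by positivity),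
        inv_mul_cancel₀ hn]
    have h1 := hv z hz1 (by rw [hz, inner_smul_right, hy, mul_zero])
    have h2 := abs_le.1 (hclose z hz1)
    have h3 : y = ((‖y‖ : ℝ) : ℂ) • z := by
      rw [hz, smul_smul, ← Complex.ofReal_mul, mul_inv_cancel₀ hn, Complex.ofReal_one, one_smul]
    have h4 : (⟪M y, y⟫_ℂ).re = ‖y‖ ^ 2 * acc z := by
      rw [hacc]
      conv_lhs => rw [h3]
      rw [map_smul, inner_smul_left, inner_smul_right, Complex.conj_ofReal, ← mul_assoc,
        ← Complex.ofReal_mul, Complex.re_ofReal_mul]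
      ring
    rw [h4]
    nlinarith [sq_nonneg ‖y‖]
  refine ⟨l, hp, x, hx, ?_, ?_, ?_⟩
  · rw [hacc, hTx, inner_smul_left, inner_self_eq_norm_sq_to_K, hx]; simp
  · intro y hy
    have := hl' y
    rw [hy] at this
    rw [hacc]; linarith
  · intro y hy hxy
    have := form_le_on_orthogonal hM hx hTx hl' hhom hxy
    rw [hy] at this
    rw [hacc]; linarith

/-! ### The diamond norm bounds the difference of acceptance probabilities -/

theorem sum_singularValues_eq {V : Type*} [NormedAddCommGroup V] [InnerProductSpace ℂ V]
    [FiniteDimensional ℂ V] (T : V →ₗ[ℂ] V) :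
    (T.singularValues.sum fun _ s => s) =
      ∑ i : Fin (Module.finrank ℂ V), T.singularValues i := by
  rw [Finsupp.sum_of_support_subset (s := Finset.range (Module.finrank ℂ V)) _ _ _ (by simp),
    Finset.sum_range]
  intro i hi
  rw [Finset.mem_range]
  by_contra h
  exact (Finsupp.mem_support_iff.1 hi) (T.singularValues_of_finrank_le (not_lt.1 h))

theorem adjoint_comp_toEuclideanLin {ι : Type*} [Fintype ι] [DecidableEq ι] (X : Matrix ι ι ℂ) :
    (Matrix.toEuclideanLin X).adjoint ∘ₗ Matrix.toEuclideanLin X =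
      Matrix.toEuclideanLin (X.conjTranspose * X) := by
  rw [← Matrix.toEuclideanLin_conjTranspose_eq_adjoint]
  exact (Matrix.toLpLin_mul_same 2 _ _).symm

/-- The hypothesis says that X is an orthogonal projection. Its singular values are 0 or 1, hence
equal to their squares, whose sum is the trace of X†X = X. -/
theorem traceNorm_le_one_of_projection {ι : Type*} [Fintype ι] [DecidableEq ι] {X : Matrix ι ι ℂ}
    (h1 : X.conjTranspose * X = X) (h2 : X.trace = 1) : traceNorm X ≤ 1 := by
  have hX : X.IsHermitian := by
    have := congrArg Matrix.conjTranspose h1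
    rw [Matrix.conjTranspose_mul, Matrix.conjTranspose_conjTranspose, h1] at this
    exact this.symm
  have hXX : X * X = X := by nth_rewrite 1 [← hX.eq]; exact h1
  set T := Matrix.toEuclideanLin X with hT
  have hTT : T.adjoint ∘ₗ T = T := by rw [hT, adjoint_comp_toEuclideanLin, h1]
  have hid : T ∘ₗ T = T := by
    rw [hT, ← Matrix.toLpLin_mul_same, hXX]
  rw [traceNorm, sum_singularValues_eq]
  have hsq : ∀ i : Fin (Module.finrank ℂ (EuclideanSpace ℂ ι)),
      T.singularValues i = T.singularValues i ^ 2 := by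
    intro i
    have hev := T.hasEigenvalue_adjoint_comp_self_sq_singularValues i.2
    rw [hTT] at hev
    obtain ⟨w, hw⟩ := hev.exists_hasEigenvector
    have hw1 := hw.apply_eq_smul
    have hw2 : T (T w) = T w := by
      have := congrArg (fun f => f w) hid; simpa using this
    rw [hw1, map_smul, hw1, smul_smul] at hw2
    have hs := smul_left_injective ℂ hw.2 hw2
    have hs' : (T.singularValues i ^ 2) * (T.singularValues i ^ 2) = T.singularValues i ^ 2 := by
      have hs2 : (((T.singularValues i ^ 2) * (T.singularValues i ^ 2) : ℝ) : ℂ) =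
        ((T.singularValues i ^ 2 : ℝ) : ℂ) := by
        push_cast; simpa using hs
      exact_mod_cast hs2
    have h0 := T.singularValues_nonneg i
    rcases h0.eq_or_lt with h | h
    · rw [← h]; norm_num
    · have h3 : T.singularValues i ^ 2 = 1 := by
        have : T.singularValues i ^ 2 ≠ 0 := by positivity
        exact mul_left_cancel₀ this (by rw [hs', mul_one])
      have h4 : T.singularValues i = 1 := by nlinarith
      rw [h4]; norm_num
  rw [Finset.sum_congr rfl fun i _ => hsq i,
    Finset.sum_congr rfl fun i _ => T.sq_singularValues_fin rfl i]
  have htr := (congrArg (LinearMap.trace ℂ _) hTT).symm.trans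
    (T.isSymmetric_adjoint_comp_self.trace_eq_sum_eigenvalues rfl)
  have htr2 : LinearMap.trace ℂ _ T = X.trace := by
    rw [hT]
    change LinearMap.trace ℂ _ (Matrix.toLpLin 2 2 X) = _
    rw [Matrix.toLpLin_eq_toLin, LinearMap.trace_eq_matrix_trace ℂ
      (PiLp.basisFun 2 ℂ ι), LinearMap.toMatrix_toLin]
  rw [htr2, h2] at htr
  apply le_of_eq
  have : ((1 : ℝ) : ℂ) = ((∑ i, T.isSymmetric_adjoint_comp_self.eigenvalues rfl i : ℝ) : ℂ) := by
    rw [Complex.ofReal_one]; exact htr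
  exact (Complex.ofReal_injective this).symm

theorem traceNorm_eq_of_conjTranspose_mul {ι : Type*} [Fintype ι] [DecidableEq ι]
    {X : Matrix ι ι ℂ} {d : ℝ} (h : X.conjTranspose * X = ((d ^ 2 : ℝ) : ℂ) • 1) :
    traceNorm X = Fintype.card ι * |d| := by
  set T := Matrix.toEuclideanLin X with hT
  rw [traceNorm, sum_singularValues_eq]
  have hs : ∀ i : Fin (Module.finrank ℂ (EuclideanSpace ℂ ι)), T.singularValues i = |d| := by
    intro i
    have hev := T.hasEigenvalue_adjoint_comp_self_sq_singularValues i.2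
    rw [hT, adjoint_comp_toEuclideanLin, h, map_smul, ← hT, Matrix.toLpLin_one] at hev
    obtain ⟨w, hw⟩ := hev.exists_hasEigenvector
    have hw1 := hw.apply_eq_smul
    rw [LinearMap.smul_apply, LinearMap.id_apply] at hw1
    have hs := smul_left_injective ℂ hw.2 hw1
    have hs' : ((d ^ 2 : ℝ) : ℂ) = ((T.singularValues i ^ 2 : ℝ) : ℂ) := by
      simpa using hs
    have := Complex.ofReal_injective hs'
    rw [← abs_of_nonneg (T.singularValues_nonneg i), ← sq_eq_sq_iff_abs_eq_abs, this]
  rw [Finset.sum_congr rfl fun i _ => hs i]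
  simp

theorem trace_acceptBranch {ι κ : Type*} [Fintype ι] [DecidableEq ι] [Fintype κ]
    (B : Matrix κ ι ℂ) (ψ : EuclideanSpace ℂ ι) :
    (B * Matrix.of (fun x y => ψ x * star (ψ y)) * B.conjTranspose).trace =
      ((‖Matrix.toEuclideanLin B ψ‖ ^ 2 : ℝ) : ℂ) := by
  have h1 : Matrix.of (fun x y => ψ x * star (ψ y)) = Matrix.vecMulVec ψ.ofLp (star ψ.ofLp) := by
    ext x y; simp [Matrix.vecMulVec_apply]
  rw [h1, Matrix.mul_vecMulVec, Matrix.vecMulVec_mul, ← Matrix.star_mulVec, Matrix.trace_vecMulVec,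
    EuclideanSpace.norm_sq_eq]
  simp only [dotProduct, Matrix.toLpLin_apply]
  push_cast
  refine Finset.sum_congr rfl fun i _ => ?_
  rw [Pi.star_apply, Complex.star_def, Complex.mul_conj, Complex.normSq_eq_norm_sq]
  push_cast; rfl

/-- On a pure state the two output qubits differ by diag(−d, d), with d the difference of acceptance
probabilities. Its trace norm is 2|d|, whence the factor 1/2. No entanglement is needed: the ancilla
of dimension 1 suffices. -/
theorem abs_acceptProb_sub_le {ι : Type*} [Fintype ι] [DecidableEq ι] {m : ℕ} (H : Matrix ι ι ℂ)
    (A A' : Fin m → Matrix ι ι ℂ) (ε e₀ Δ : ℝ) (L : ℕ) {e : ℝ} (he : 0 ≤ e)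
    (h : diamondNorm (testChannel H A ε e₀ Δ L - testChannel H A' ε e₀ Δ L) ≤ ENNReal.ofReal e)
    (ψ : EuclideanSpace ℂ (ι × ι)) (hψ : ‖ψ‖ = 1) :
    |acceptProb H A ε e₀ Δ L ψ - acceptProb H A' ε e₀ Δ L ψ| ≤ e / 2 := by
  set d := acceptProb H A ε e₀ Δ L ψ - acceptProb H A' ε e₀ Δ L ψ with hd
  set R : Matrix (ι × ι) (ι × ι) ℂ := Matrix.of fun x y => ψ x * star (ψ y) with hR
  set X : Matrix ((ι × ι) × Fin 1) ((ι × ι) × Fin 1) ℂ :=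
    Matrix.of fun x y => ψ x.1 * star (ψ y.1) with hX
  have hψ2 : ∑ i, star (ψ i) * ψ i = 1 := by
    have := EuclideanSpace.norm_sq_eq ψ
    rw [hψ] at this
    have h2 : ((1 ^ 2 : ℝ) : ℂ) = ∑ i, ((‖ψ i‖ ^ 2 : ℝ) : ℂ) := by rw [this]; push_cast; rfl
    rw [show ((1 ^ 2 : ℝ) : ℂ) = 1 by simp] at h2
    rw [h2]
    refine Finset.sum_congr rfl fun i _ => ?_
    rw [Complex.star_def, mul_comm, Complex.mul_conj, Complex.normSq_eq_norm_sq]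
  have hX1 : traceNorm X ≤ 1 := by
    apply traceNorm_le_one_of_projection
    · ext x y
      rw [Matrix.mul_apply]
      simp only [Matrix.conjTranspose_apply, hX, Matrix.of_apply, star_mul', star_star]
      rw [Fintype.sum_prod_type]
      simp only [Finset.univ_unique]
      calc _ = ∑ i, (star (ψ i) * ψ i) * (ψ x.1 * star (ψ y.1)) := by
            refine Finset.sum_congr rfl fun i _ => ?_
            simp; ring
        _ = _ := by rw [← Finset.sum_mul, hψ2, one_mul]
    · rw [Matrix.trace, Fintype.sum_prod_type]
      simp only [Matrix.diag_apply, hX, Matrix.of_apply]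
      rw [← hψ2]
      refine Finset.sum_congr rfl fun i _ => ?_
      simp [mul_comm]
  have hval : ampliate (testChannel H A ε e₀ Δ L - testChannel H A' ε e₀ Δ L) 1 X =
      Matrix.of fun p q => ((-d : ℝ) : ℂ) * Matrix.single (0 : Fin 2) 0 (1 : ℂ) p.1 q.1 +
        ((d : ℝ) : ℂ) * Matrix.single (1 : Fin 2) 1 (1 : ℂ) p.1 q.1 := by
    ext p q
    simp only [ampliate, Matrix.of_apply, LinearMap.sub_apply]
    have : (Matrix.of fun x y => X (x, p.2) (y, q.2)) = R := by ext x y; simp [hX, hR]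
    rw [this]
    simp only [testChannel, LinearMap.coe_mk, AddHom.coe_mk, hR]
    rw [trace_acceptBranch, trace_acceptBranch]
    simp only [hd, acceptProb, Matrix.sub_apply, Matrix.add_apply, Matrix.smul_apply, smul_eq_mul]
    push_cast; ring
  have htn : traceNorm (ampliate (testChannel H A ε e₀ Δ L - testChannel H A' ε e₀ Δ L) 1 X) =
      2 * |d| := by
    rw [traceNorm_eq_of_conjTranspose_mul (d := d)]
    · simp
    · rw [hval]
      ext ⟨p, p'⟩ ⟨q, q'⟩
      rw [Matrix.mul_apply, Fintype.sum_prod_type]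
      simp only [Finset.univ_unique, Finset.sum_singleton, Fin.sum_univ_two]
      fin_cases p <;> fin_cases q <;> fin_cases p' <;> fin_cases q' <;>
        simp [Matrix.single_apply, sq]
  have h1 : ENNReal.ofReal (2 * |d|) ≤ ENNReal.ofReal e := by
    refine le_trans ?_ h
    rw [← htn, diamondNorm]
    exact le_iSup₂_of_le 1 X (le_iSup_of_le hX1 le_rfl)
  rw [ENNReal.ofReal_le_ofReal_iff he] at h1
  linarith

/-! ### Phase estimation on the uniform superposition -/

/-- The amplitude of the grid point `j` after phase estimation of the energy `E`. -/
def phaseAmp (L : ℕ) (E : ℝ) (j : Fin L) : ℂ :=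
  ∑ k : Fin L, (1 / (L : ℂ)) *
    Complex.exp (2 * Real.pi * Complex.I * ((k : ℕ) : ℂ) * ((E : ℂ) - ((j : ℕ) : ℂ) / (L : ℂ)))

open Classical in
/-- The probability that phase estimation of the energy `E` returns a grid point in the window. -/
def gridWeight (L : ℕ) (e₀ w E : ℝ) : ℝ :=
  ∑ j : Fin L, if ((j : ℕ) : ℝ) / L ∈ Set.Icc (e₀ - w / 2) (e₀ + w / 2)
    then ‖phaseAmp L E j‖ ^ 2 else 0

/-- Appending the uniform superposition of the ancilla register. -/
def appendUnif (ι : Type*) [DecidableEq ι] (L : ℕ) : Matrix (ι × Fin L) ι ℂ :=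
  Matrix.of fun r s => if r.1 = s then 1 / (Real.sqrt L : ℂ) else 0

theorem one_div_sqrt_mul_self {L : ℕ} : (1 / (Real.sqrt L : ℂ)) * (1 / (Real.sqrt L : ℂ)) =
    1 / (L : ℂ) := by
  rw [div_mul_div_comm, one_mul, ← Complex.ofReal_mul, Real.mul_self_sqrt (Nat.cast_nonneg L)]
  simp

theorem sum_exp_eq_zero {L : ℕ} {d : ℤ} (hd : d ≠ 0) (hd' : |d| < L) :
    ∑ j : Fin L, Complex.exp (2 * Real.pi * Complex.I * (((j : ℕ) : ℂ) * (d : ℂ) / (L : ℂ))) = 0 := by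
  have hL : (L : ℂ) ≠ 0 := by
    have : (0 : ℤ) < L := lt_of_le_of_lt (abs_nonneg d) hd'
    exact_mod_cast this.ne'
  set z := Complex.exp (2 * Real.pi * Complex.I * ((d : ℂ) / L)) with hz
  have h1 : ∀ j : Fin L, Complex.exp (2 * Real.pi * Complex.I * (((j : ℕ) : ℂ) * (d : ℂ) / (L : ℂ)))
      = z ^ (j : ℕ) := by
    intro j
    rw [hz, ← Complex.exp_nat_mul]; congr 1; ring
  rw [Finset.sum_congr rfl fun j _ => h1 j, Fin.sum_univ_eq_sum_range (fun i => z ^ i)]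
  have hz1 : z ≠ 1 := by
    intro h
    rw [hz, Complex.exp_eq_one_iff] at h
    obtain ⟨n, hn⟩ := h
    have h2 : (d : ℂ) = n * L := by
      have hpi : (2 * Real.pi * Complex.I : ℂ) ≠ 0 := Complex.two_pi_I_ne_zero
      have : (2 * Real.pi * Complex.I : ℂ) * (d / L) = (2 * Real.pi * Complex.I) * n := by
        rw [hn]; ring
      have := mul_left_cancel₀ hpi this
      field_simp at this
      rw [this]; ring
    have h3 : d = n * L := by exact_mod_cast h2
    have hn0 : n ≠ 0 := by rintro rfl; simp at h3; exact hd h3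
    have : (1 : ℤ) ≤ |n| := Int.one_le_abs hn0
    rw [h3, abs_mul] at hd'
    have hLL : |(L : ℤ)| = L := abs_of_nonneg (by positivity)
    rw [hLL] at hd'
    nlinarith
  have hzL : z ^ L = 1 := by
    rw [hz, ← Complex.exp_nat_mul, Complex.exp_eq_one_iff]
    exact ⟨d, by field_simp⟩
  rw [geom_sum_eq hz1, hzL, sub_self, zero_div]

theorem invQFT_unitary (L : ℕ) : (invQFT L).conjTranspose * invQFT L = 1 := by
  ext k k'
  have hL : (L : ℂ) ≠ 0 := by
    have := k.pos; exact_mod_cast this.ne'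
  rw [Matrix.mul_apply]
  have h1 : ∀ j : Fin L, (invQFT L).conjTranspose k j * invQFT L j k' = (1 / (L : ℂ)) *
      Complex.exp (2 * Real.pi * Complex.I *
        (((j : ℕ) : ℂ) * (((k : ℕ) - (k' : ℕ) : ℤ) : ℂ) / (L : ℂ))) := by
    intro j
    rw [Matrix.conjTranspose_apply, invQFT, Matrix.of_apply, Matrix.of_apply, star_mul',
      mul_mul_mul_comm, Complex.star_def, ← Complex.exp_conj]
    have : (starRingEnd ℂ) (1 / (Real.sqrt L : ℂ)) = 1 / (Real.sqrt L : ℂ) := by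
      simp
    rw [this, one_div_sqrt_mul_self, ← Complex.exp_add]
    congr 2
    simp [map_ofNat]
    ring
  rw [Finset.sum_congr rfl fun j _ => h1 j, ← Finset.mul_sum]
  by_cases h : k = k'
  · subst h
    simp [hL]
  · rw [Matrix.one_apply_ne h, sum_exp_eq_zero, mul_zero]
    · intro h2; apply h; ext; omega
    · rw [abs_lt]; omega

section QPE

variable {ι : Type*} [Fintype ι] [DecidableEq ι]

theorem exp_smul_of_mul_eq {H U : Matrix ι ι ℂ} (hU : U.conjTranspose * U = 1) (e : ι → ℂ)
    (hH : H = U * Matrix.diagonal e * U.conjTranspose) (c : ℂ) :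
    NormedSpace.exp (c • H) =
      U * Matrix.diagonal (fun i => Complex.exp (c * e i)) * U.conjTranspose := by
  have hinv : U⁻¹ = U.conjTranspose := Matrix.inv_eq_left_inv hU
  have hunit : IsUnit U := by
    rw [Matrix.isUnit_iff_isUnit_det]
    exact Matrix.isUnit_det_of_left_inverse hU
  have : c • H = U * (c • Matrix.diagonal e) * U⁻¹ := by
    rw [hinv, hH, Matrix.mul_smul, Matrix.smul_mul]
  rw [this, Matrix.exp_conj _ _ hunit, hinv, ← Matrix.diagonal_smul, Matrix.exp_diagonal]
  congr 3
  funext i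
  rw [Pi.coe_exp, Complex.exp_eq_exp_ℂ]
  simp

theorem qpe_unitary {H U : Matrix ι ι ℂ} (hU : U.conjTranspose * U = 1)
    (hU' : U * U.conjTranspose = 1) (e : ι → ℝ)
    (hH : H = U * Matrix.diagonal (fun i => (e i : ℂ)) * U.conjTranspose) (L : ℕ) :
    (qpe H L).conjTranspose * qpe H L = 1 := by
  have hblock : ∀ k : Fin L,
      (NormedSpace.exp ((2 * Real.pi * Complex.I * ((k : ℕ) : ℂ)) • H)).conjTranspose *
      NormedSpace.exp ((2 * Real.pi * Complex.I * ((k : ℕ) : ℂ)) • H) = 1 := by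
    intro k
    rw [exp_smul_of_mul_eq hU _ hH, Matrix.conjTranspose_mul, Matrix.conjTranspose_mul,
      Matrix.conjTranspose_conjTranspose, Matrix.diagonal_conjTranspose]
    calc _ = U * (Matrix.diagonal _ * ((U.conjTranspose * U) * Matrix.diagonal _)) *
          U.conjTranspose := by simp only [Matrix.mul_assoc]; rfl
      _ = _ := by
        rw [hU, Matrix.one_mul, Matrix.diagonal_mul_diagonal]
        have : (fun i => (star fun i => Complex.exp (2 * Real.pi * Complex.I * ((k : ℕ) : ℂ) *
            (e i : ℂ))) i * Complex.exp (2 * Real.pi * Complex.I * ((k : ℕ) : ℂ) * (e i : ℂ))) =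
            fun _ => (1 : ℂ) := by
          funext i
          rw [Pi.star_apply, Complex.star_def, ← Complex.exp_conj, ← Complex.exp_add]
          simp [map_ofNat]
        rw [this, Matrix.diagonal_one, Matrix.mul_one, hU']
  rw [qpe, Matrix.conjTranspose_mul, Matrix.conjTranspose_kronecker, Matrix.conjTranspose_one]
  rw [Matrix.mul_assoc, ← Matrix.mul_assoc _ _ (Matrix.blockDiagonal _),
    ← Matrix.mul_kronecker_mul, Matrix.one_mul, invQFT_unitary, Matrix.one_kronecker_one,
    Matrix.one_mul, Matrix.blockDiagonal_conjTranspose, ← Matrix.blockDiagonal_mul]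
  simp only [hblock]
  exact Matrix.blockDiagonal_one

theorem qpe_appendUnif_mul_apply {H U : Matrix ι ι ℂ} (hU : U.conjTranspose * U = 1) (e : ι → ℝ)
    (hH : H = U * Matrix.diagonal (fun i => (e i : ℂ)) * U.conjTranspose) (L : ℕ)
    (x : ι) (j : Fin L) (α : ι) :
    (qpe H L * (appendUnif ι L * U)) (x, j) α = U x α * phaseAmp L (e α) j := by
  have h1 : ∀ (y : ι) (k : Fin L), (Matrix.blockDiagonal (fun k : Fin L =>
      NormedSpace.exp ((2 * Real.pi * Complex.I * ((k : ℕ) : ℂ)) • H)) *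
        (appendUnif ι L * U)) (y, k) α =
      1 / (Real.sqrt L : ℂ) * (U y α * Complex.exp (2 * Real.pi * Complex.I * ((k : ℕ) : ℂ) * e α)) := by
    intro y k
    have hV : ∀ z k', (appendUnif ι L * U) (z, k') α = 1 / (Real.sqrt L : ℂ) * U z α := by
      intro z k'
      rw [Matrix.mul_apply, Finset.sum_eq_single z]
      · simp [appendUnif]
      · intro b _ hb; simp [appendUnif, hb.symm]
      · simp
    rw [Matrix.mul_apply, Fintype.sum_prod_type, Finset.sum_comm, Finset.sum_eq_single k]
    · simp only [Matrix.blockDiagonal_apply, if_true, hV]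
      have h2 : NormedSpace.exp ((2 * Real.pi * Complex.I * ((k : ℕ) : ℂ)) • H) * U =
          U * Matrix.diagonal
            (fun i => Complex.exp (2 * Real.pi * Complex.I * ((k : ℕ) : ℂ) * (e i : ℂ))) := by
        rw [exp_smul_of_mul_eq hU _ hH, Matrix.mul_assoc _ U.conjTranspose, hU, Matrix.mul_one]
      have h3 := congrFun (congrFun h2 y) α
      rw [Matrix.mul_apply, Matrix.mul_diagonal] at h3
      rw [← h3, Finset.mul_sum]
      exact Finset.sum_congr rfl fun z _ => by ring
    · intro k' _ hk'
      simp [Matrix.blockDiagonal_apply, hk'.symm]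
    · simp
  rw [qpe, Matrix.mul_assoc, Matrix.mul_apply, Fintype.sum_prod_type, Finset.sum_eq_single x]
  · simp only [h1, Matrix.kroneckerMap_apply, Matrix.one_apply_eq, one_mul, phaseAmp,
      Finset.mul_sum]
    refine Finset.sum_congr rfl fun k _ => ?_
    rw [invQFT, Matrix.of_apply]
    calc _ = ((1 / (Real.sqrt L : ℂ)) * (1 / (Real.sqrt L : ℂ))) * (U x α *
          (Complex.exp (2 * Real.pi * Complex.I * (-((j : ℕ) : ℂ) * ((k : ℕ) : ℂ) / (L : ℂ))) *
          Complex.exp (2 * Real.pi * Complex.I * ((k : ℕ) : ℂ) * e α))) := by ring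
      _ = _ := by
        rw [one_div_sqrt_mul_self, ← Complex.exp_add]
        rw [show 2 * Real.pi * Complex.I * (-((j : ℕ) : ℂ) * ((k : ℕ) : ℂ) / (L : ℂ)) +
          2 * Real.pi * Complex.I * ((k : ℕ) : ℂ) * e α =
          2 * Real.pi * Complex.I * ((k : ℕ) : ℂ) * ((e α : ℂ) - ((j : ℕ) : ℂ) / (L : ℂ)) by ring]
        ring
  · intro y _ hy
    simp [Matrix.kroneckerMap_apply, Matrix.one_apply_ne hy.symm]
  · simp

/-- Phase estimation maps |ν_α⟩|u⟩ to |ν_α⟩ tensored with a state of the ancilla. The first factors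
stay orthogonal, so the compression is diagonal in the energy basis, with the measured probability
of the window as eigenvalue. -/
theorem compress_projSP {H U : Matrix ι ι ℂ} (hU : U.conjTranspose * U = 1)
    (hU' : U * U.conjTranspose = 1) (e : ι → ℝ)
    (hH : H = U * Matrix.diagonal (fun i => (e i : ℂ)) * U.conjTranspose) (L : ℕ) (e₀ w : ℝ) :
    (appendUnif ι L).conjTranspose * projSP H L e₀ w * appendUnif ι L =
      U * Matrix.diagonal (fun α => (gridWeight L e₀ w (e α) : ℂ)) * U.conjTranspose := by
  have hinv : (qpe H L)⁻¹ = (qpe H L).conjTranspose :=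
    Matrix.inv_eq_left_inv (qpe_unitary hU hU' e hH L)
  obtain ⟨N, hN⟩ : ∃ N : Matrix (ι × Fin L) ι ℂ, N = qpe H L * (appendUnif ι L * U) := ⟨_, rfl⟩
  have hNe : ∀ x j α, N (x, j) α = U x α * phaseAmp L (e α) j := by
    intro x j α; rw [hN, qpe_appendUnif_mul_apply hU e hH]
  have key : N.conjTranspose * (((1 : Matrix ι ι ℂ) ⊗ₖ gridProj L e₀ w) * N) =
      Matrix.diagonal (fun α => (gridWeight L e₀ w (e α) : ℂ)) := by
    ext α β
    rw [Matrix.mul_apply, Fintype.sum_prod_type]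
    have h1 : ∀ x j, (((1 : Matrix ι ι ℂ) ⊗ₖ gridProj L e₀ w) * N) (x, j) β =
        gridProj L e₀ w j j * N (x, j) β := by
      intro x j
      rw [gridProj, ← Matrix.diagonal_one, Matrix.diagonal_kronecker_diagonal, Matrix.diagonal_mul,
        Matrix.diagonal_apply_eq, one_mul]
    simp only [h1, Matrix.conjTranspose_apply, hNe]
    rw [Finset.sum_comm]
    have h2 : ∑ x, star (U x α) * U x β = if α = β then 1 else 0 := by
      have := congrFun (congrFun hU α) β
      rw [Matrix.mul_apply, Matrix.one_apply] at this
      simpa [Matrix.conjTranspose_apply] using this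
    have h3 : ∀ j : Fin L, ∑ x, star (U x α * phaseAmp L (e α) j) *
        (gridProj L e₀ w j j * (U x β * phaseAmp L (e β) j)) =
        (if α = β then 1 else 0) * (gridProj L e₀ w j j *
          (star (phaseAmp L (e α) j) * phaseAmp L (e β) j)) := by
      intro j
      rw [← h2, Finset.sum_mul]
      refine Finset.sum_congr rfl fun x _ => ?_
      rw [star_mul']; ring
    rw [Finset.sum_congr rfl fun j _ => h3 j]
    by_cases hab : α = β
    · subst hab
      rw [Matrix.diagonal_apply_eq]
      simp only [if_true, one_mul, gridWeight]
      push_cast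
      refine Finset.sum_congr rfl fun j _ => ?_
      rw [gridProj, Matrix.diagonal_apply_eq, Complex.star_def, mul_comm ((starRingEnd ℂ) _),
        Complex.mul_conj, Complex.normSq_eq_norm_sq]
      split_ifs <;> simp
    · simp [hab]
  rw [← key, hN, projSP, hinv]
  simp only [Matrix.conjTranspose_mul, Matrix.mul_assoc]
  rw [hU', Matrix.mul_one]
  simp only [← Matrix.mul_assoc]
  rw [hU', Matrix.one_mul]

end QPE

/-- The unitarity of phase estimation, applied to the one-dimensional Hamiltonian with energy E. -/
theorem sum_norm_sq_phaseAmp {L : ℕ} (hL : 0 < L) (E : ℝ) :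
    ∑ j : Fin L, ‖phaseAmp L E j‖ ^ 2 = 1 := by
  have hU : (1 : Matrix (Fin 1) (Fin 1) ℂ).conjTranspose * 1 = 1 := by simp
  have hU' : (1 : Matrix (Fin 1) (Fin 1) ℂ) * (1 : Matrix (Fin 1) (Fin 1) ℂ).conjTranspose = 1 := by
    simp
  set H : Matrix (Fin 1) (Fin 1) ℂ := Matrix.diagonal fun _ => (E : ℂ)
  have hH : H = 1 * Matrix.diagonal (fun _ => (E : ℂ)) *
    (1 : Matrix (Fin 1) (Fin 1) ℂ).conjTranspose := by simp [H]
  obtain ⟨N, hN⟩ : ∃ N : Matrix (Fin 1 × Fin L) (Fin 1) ℂ,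
      N = qpe H L * (appendUnif (Fin 1) L * (1 : Matrix (Fin 1) (Fin 1) ℂ)) := ⟨_, rfl⟩
  have hNe : ∀ x j α, N (x, j) α = (1 : Matrix (Fin 1) (Fin 1) ℂ) x α * phaseAmp L E j := by
    intro x j α; rw [hN, qpe_appendUnif_mul_apply hU _ hH]
  have h1 : N.conjTranspose * N = 1 := by
    have : N.conjTranspose * N = (appendUnif (Fin 1) L).conjTranspose *
        ((qpe H L).conjTranspose * qpe H L) * appendUnif (Fin 1) L := by
      simp only [hN, Matrix.mul_one, Matrix.conjTranspose_mul, Matrix.mul_assoc]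
    rw [this, qpe_unitary hU hU' _ hH, Matrix.mul_one]
    ext a b
    fin_cases a; fin_cases b
    rw [Matrix.mul_apply, Fintype.sum_prod_type]
    have hL' : (L : ℂ) ≠ 0 := by exact_mod_cast hL.ne'
    have h2 : star (1 / (Real.sqrt L : ℂ)) = 1 / (Real.sqrt L : ℂ) := by simp
    simp only [appendUnif, Matrix.conjTranspose_apply, Matrix.of_apply, Finset.univ_unique,
      Finset.sum_singleton]
    simp only [Fin.default_eq_zero, Fin.zero_eta, if_true, h2, one_div_sqrt_mul_self]
    simp [hL']
  have h3 := congrFun (congrFun h1 0) 0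
  rw [Matrix.mul_apply, Fintype.sum_prod_type] at h3
  simp only [Matrix.conjTranspose_apply, hNe] at h3
  apply Complex.ofReal_injective
  rw [Complex.ofReal_one, ← Matrix.one_apply_eq (0 : Fin 1), ← h3]
  simp only [Finset.univ_unique, Finset.sum_singleton]
  push_cast
  refine Finset.sum_congr rfl fun j _ => ?_
  rw [show (default : Fin 1) = 0 from rfl, Matrix.one_apply_eq, one_mul, Complex.star_def,
    mul_comm ((starRingEnd ℂ) _), Complex.mul_conj, Complex.normSq_eq_norm_sq]
  push_cast; rfl

/-! ### Tails of phase estimation -/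

theorem sum_inv_sq_one_sided (T : Finset ℤ) {a d : ℝ} (hd : 1 ≤ d)
    (hT : ∀ j ∈ T, d ≤ (j : ℝ) - a) : ∑ j ∈ T, 1 / ((j : ℝ) - a) ^ 2 ≤ 2 / d := by
  obtain ⟨n₀, hn₀⟩ : ∃ n₀ : ℤ, n₀ = ⌈a + d⌉ := ⟨_, rfl⟩
  have hn₀' : a + d ≤ n₀ := by rw [hn₀]; exact Int.le_ceil _
  have hTn : ∀ j ∈ T, n₀ ≤ j := by
    intro j hj
    rw [hn₀]; exact Int.ceil_le.2 (by have := hT j hj; linarith)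
  -- With y = n₀ + i − a, the increment of g is 1/(y² − 1/4) ≥ 1/y², so the sum telescopes to at
  -- most g 0 ≤ 1/(d − 1/2) ≤ 2/d.
  set g : ℕ → ℝ := fun i => 1 / ((n₀ : ℝ) + i - a - 1 / 2) with hg
  have hpos : ∀ i : ℕ, 1 / 2 ≤ (n₀ : ℝ) + i - a - 1 / 2 := by
    intro i
    have : (0 : ℝ) ≤ i := Nat.cast_nonneg i
    linarith
  obtain ⟨N, hN⟩ : ∃ N : ℕ, ∀ j ∈ T, (j - n₀).toNat < N := by
    refine ⟨T.sup (fun j => (j - n₀).toNat) + 1, fun j hj => ?_⟩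
    exact Nat.lt_succ_of_le (Finset.le_sup (f := fun j => (j - n₀).toNat) hj)
  have h1 : ∑ j ∈ T, 1 / ((j : ℝ) - a) ^ 2 ≤
      ∑ i ∈ Finset.range N, 1 / ((n₀ : ℝ) + i - a) ^ 2 := by
    have hinj : Set.InjOn (fun j : ℤ => (j - n₀).toNat) T := by
      intro x hx y hy hxy
      have h1 := hTn x hx
      have h2 := hTn y hy
      simp only at hxy
      omega
    calc _ = ∑ i ∈ T.image (fun j : ℤ => (j - n₀).toNat), 1 / ((n₀ : ℝ) + i - a) ^ 2 := by
          rw [Finset.sum_image hinj]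
          refine Finset.sum_congr rfl fun j hj => ?_
          have : (((j - n₀).toNat : ℕ) : ℝ) = (j : ℝ) - n₀ := by
            have h := hTn j hj
            have : (((j - n₀).toNat : ℤ)) = j - n₀ := Int.toNat_of_nonneg (by omega)
            exact_mod_cast this
          rw [this]; congr 2; ring
      _ ≤ _ := by
          refine Finset.sum_le_sum_of_subset_of_nonneg ?_ (fun i _ _ => by positivity)
          intro i hi
          obtain ⟨j, hj, rfl⟩ := Finset.mem_image.1 hi
          exact Finset.mem_range.2 (hN j hj)
  have h2 : ∀ i ∈ Finset.range N, 1 / ((n₀ : ℝ) + i - a) ^ 2 ≤ g i - g (i + 1) := by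
    intro i _
    have hp := hpos i
    simp only [hg]
    push_cast
    set y := (n₀ : ℝ) + i - a with hy
    have e1 : (n₀ : ℝ) + (i + 1) - a - 1 / 2 = y + 1 / 2 := by rw [hy]; ring
    rw [e1, div_sub_div _ _ (by linarith) (by linarith)]
    rw [div_le_div_iff₀ (by nlinarith) (by nlinarith)]
    nlinarith
  refine h1.trans ((Finset.sum_le_sum h2).trans ?_)
  rw [Finset.sum_range_sub']
  have h3 : 0 ≤ g N := by
    have := hpos N
    simp only [hg]; exact div_nonneg zero_le_one (by linarith)
  have h4 : g 0 ≤ 2 / d := by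
    have := hpos 0
    simp only [hg]
    rw [div_le_div_iff₀ (by linarith) (by linarith)]
    push_cast; linarith
  linarith

theorem sum_inv_sq_le {L : ℕ} (S : Finset (Fin L)) {a d : ℝ} (hd : 1 ≤ d)
    (hS : ∀ j ∈ S, d ≤ |((j : ℕ) : ℝ) - a|) : ∑ j ∈ S, 1 / (((j : ℕ) : ℝ) - a) ^ 2 ≤ 4 / d := by
  rw [← Finset.sum_filter_add_sum_filter_not S (fun j : Fin L => a < ((j : ℕ) : ℝ))]
  have h1 : ∑ j ∈ S.filter (fun j : Fin L => a < ((j : ℕ) : ℝ)), 1 / (((j : ℕ) : ℝ) - a) ^ 2 ≤ 2 / d := by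
    set T := (S.filter (fun j : Fin L => a < ((j : ℕ) : ℝ))).image fun j : Fin L => ((j : ℕ) : ℤ)
    have := sum_inv_sq_one_sided T hd (a := a) (by
      intro j hj
      obtain ⟨i, hi, rfl⟩ := Finset.mem_image.1 hj
      rw [Finset.mem_filter] at hi
      have h := hS i hi.1
      rw [abs_of_pos (by linarith [hi.2])] at h
      exact_mod_cast h)
    rw [Finset.sum_image (fun x _ y _ hxy => Fin.ext (by exact_mod_cast hxy))] at this
    exact_mod_cast this
  have h2 : ∑ j ∈ S.filter (fun j : Fin L => ¬ a < ((j : ℕ) : ℝ)), 1 / (((j : ℕ) : ℝ) - a) ^ 2 ≤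
      2 / d := by
    set T := (S.filter (fun j : Fin L => ¬ a < ((j : ℕ) : ℝ))).image fun j : Fin L => -((j : ℕ) : ℤ)
    have := sum_inv_sq_one_sided T hd (a := -a) (by
      intro j hj
      obtain ⟨i, hi, rfl⟩ := Finset.mem_image.1 hj
      rw [Finset.mem_filter] at hi
      have h := hS i hi.1
      rw [abs_of_nonpos (by linarith [not_lt.1 hi.2])] at h
      push_cast; linarith)
    rw [Finset.sum_image (fun x _ y _ hxy => Fin.ext (by
      have h := neg_injective hxy
      exact_mod_cast h))] at this
    refine le_trans (le_of_eq (Finset.sum_congr rfl fun j _ => ?_)) this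
    push_cast
    congr 1; ring
  have : 4 / d = 2 / d + 2 / d := by ring
  linarith

/-- The left side measures the distance of x to the nearest integer; the norm is 2|sin πx|, and
Jordan's inequality bounds the sine below. -/
theorem norm_one_sub_exp_ge {x : ℝ} (hx : |x| ≤ 1) :
    4 * min |x| (1 - |x|) ≤ ‖1 - Complex.exp (2 * Real.pi * Complex.I * x)‖ := by
  have h1 : ‖1 - Complex.exp (2 * Real.pi * Complex.I * x)‖ = 2 * |Real.sin (Real.pi * x)| := by
    rw [norm_sub_rev, show (2 * Real.pi * Complex.I * x : ℂ) = Complex.I * ((2 * Real.pi * x : ℝ) : ℂ)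
      by push_cast; ring, Complex.norm_exp_I_mul_ofReal_sub_one, Real.norm_eq_abs, abs_mul,
      abs_of_pos (by norm_num : (0 : ℝ) < 2)]
    congr 3; ring
  have h2 : |Real.sin (Real.pi * x)| = |Real.sin (Real.pi * |x|)| := by
    rcases abs_cases x with ⟨h, _⟩ | ⟨h, _⟩ <;> rw [h]
    rw [mul_neg, Real.sin_neg, abs_neg]
  rw [h1, h2]
  have hpi := Real.pi_pos
  have hx0 := abs_nonneg x
  rcases le_total |x| (1 / 2) with h | h
  · have h3 := Real.mul_le_sin (x := Real.pi * |x|) (by positivity) (by nlinarith)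
    have h4 : 2 / Real.pi * (Real.pi * |x|) = 2 * |x| := by field_simp
    have := min_le_left |x| (1 - |x|)
    have := le_abs_self (Real.sin (Real.pi * |x|))
    linarith
  · have h3 := Real.mul_le_sin (x := Real.pi * (1 - |x|)) (by nlinarith) (by nlinarith)
    have h4 : 2 / Real.pi * (Real.pi * (1 - |x|)) = 2 * (1 - |x|) := by field_simp
    have h5 : Real.sin (Real.pi * (1 - |x|)) = Real.sin (Real.pi * |x|) := by
      rw [mul_sub, mul_one, Real.sin_pi_sub]
    have := min_le_right |x| (1 - |x|)
    have := le_abs_self (Real.sin (Real.pi * |x|))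
    linarith

/-- The amplitude is a geometric sum, at most 2/(L|1 − z|). Phase estimation sees energies only
modulo 1, so the relevant distance is that of j/L to the nearest of E, E + 1, E − 1; the sum of
three terms avoids deciding which. -/
theorem norm_sq_phaseAmp_le {L : ℕ} (hL : 0 < L) {E : ℝ} (hE : E ∈ Set.Icc (0 : ℝ) 1) (j : Fin L)
    (h0 : ((j : ℕ) : ℝ) - L * E ≠ 0) (h1 : ((j : ℕ) : ℝ) - (L * E + L) ≠ 0)
    (h2 : ((j : ℕ) : ℝ) - (L * E - L) ≠ 0) :
    ‖phaseAmp L E j‖ ^ 2 ≤ 1 / 4 * (1 / (((j : ℕ) : ℝ) - L * E) ^ 2 +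
      1 / (((j : ℕ) : ℝ) - (L * E + L)) ^ 2 + 1 / (((j : ℕ) : ℝ) - (L * E - L)) ^ 2) := by
  have hLr : (0 : ℝ) < L := by exact_mod_cast hL
  set x : ℝ := E - ((j : ℕ) : ℝ) / L with hx
  have hjL : ((j : ℕ) : ℝ) / L < 1 := by
    rw [div_lt_one hLr]; exact_mod_cast j.2
  have hj0 : 0 ≤ ((j : ℕ) : ℝ) / L := by positivity
  have hx1 : |x| ≤ 1 := by rw [abs_le]; constructor <;> linarith [hE.1, hE.2]
  have hLx : L * x = L * E - ((j : ℕ) : ℝ) := by rw [hx]; field_simp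
  set z := Complex.exp (2 * Real.pi * Complex.I * x) with hz
  have hz1 : ‖z‖ = 1 := by
    rw [hz, show (2 * Real.pi * Complex.I * x : ℂ) = ((2 * Real.pi * x : ℝ) : ℂ) * Complex.I
      by push_cast; ring, Complex.norm_exp_ofReal_mul_I]
  have hamp : phaseAmp L E j = (1 / (L : ℂ)) * ∑ k ∈ Finset.range L, z ^ k := by
    rw [phaseAmp, ← Finset.mul_sum, ← Fin.sum_univ_eq_sum_range (fun k => z ^ k)]
    congr 1
    refine Finset.sum_congr rfl fun k _ => ?_
    rw [hz, ← Complex.exp_nat_mul]; congr 1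
    rw [hx]; push_cast; ring
  have hmul : ‖phaseAmp L E j‖ * ‖1 - z‖ ≤ 2 / L := by
    rw [← norm_mul, hamp, mul_assoc, ← neg_sub z 1, mul_neg, geom_sum_mul, norm_mul, norm_neg,
      norm_div, norm_one, Complex.norm_natCast]
    have : ‖z ^ L - 1‖ ≤ 2 := by
      refine (norm_sub_le _ _).trans ?_
      rw [norm_pow, hz1]; norm_num
    calc 1 / (L : ℝ) * ‖z ^ L - 1‖ ≤ 1 / L * 2 := by gcongr
      _ = _ := by ring
  have hge := norm_one_sub_exp_ge hx1
  have hbound : ∀ y : ℝ, 0 < y → 4 * y ≤ ‖1 - z‖ →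
      ‖phaseAmp L E j‖ ^ 2 ≤ 1 / 4 * (1 / (L * y) ^ 2) := by
    intro y hy hyz
    have h3 : ‖phaseAmp L E j‖ * (4 * y) ≤ 2 / L :=
      (mul_le_mul_of_nonneg_left hyz (norm_nonneg _)).trans hmul
    have h4 : ‖phaseAmp L E j‖ ≤ 1 / (2 * (L * y)) := by
      rw [le_div_iff₀ (by positivity)]
      have := mul_le_mul_of_nonneg_left h3 hLr.le
      have e : (L : ℝ) * (2 / L) = 2 := by field_simp
      rw [e] at this
      linarith
    calc ‖phaseAmp L E j‖ ^ 2 ≤ (1 / (2 * (L * y))) ^ 2 := by gcongr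
      _ = _ := by field_simp; norm_num
  have hsq : ∀ u : ℝ, 0 ≤ 1 / u ^ 2 := fun u => by positivity
  rcases min_cases |x| (1 - |x|) with ⟨hm, _⟩ | ⟨hm, _⟩
  · rw [hm] at hge
    have hxp : 0 < |x| := by
      rw [abs_pos]; intro h; rw [h] at hLx; apply h0; linarith
    refine (hbound _ hxp hge).trans ?_
    have : (L * |x|) ^ 2 = (((j : ℕ) : ℝ) - L * E) ^ 2 := by
      rw [mul_pow, sq_abs, ← mul_pow, hLx]; ring
    rw [this]
    linarith [hsq (((j : ℕ) : ℝ) - (L * E + L)), hsq (((j : ℕ) : ℝ) - (L * E - L))]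
  · rw [hm] at hge
    rcases abs_cases x with ⟨hax, _⟩ | ⟨hax, _⟩
    · have e : L * (1 - |x|) = ((j : ℕ) : ℝ) - (L * E - L) := by
        rw [hax, mul_sub, hLx]; ring
      have hyp : 0 < 1 - |x| := by
        rcases (sub_nonneg.2 hx1).eq_or_lt with h | h
        · exfalso; apply h2; rw [← e, ← h, mul_zero]
        · exact h
      refine (hbound _ hyp hge).trans ?_
      rw [e]
      linarith [hsq (((j : ℕ) : ℝ) - (L * E + L)), hsq (((j : ℕ) : ℝ) - L * E)]
    · have e : L * (1 - |x|) = -(((j : ℕ) : ℝ) - (L * E + L)) := by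
        rw [hax, mul_sub, mul_neg, hLx]; ring
      have hyp : 0 < 1 - |x| := by
        rcases (sub_nonneg.2 hx1).eq_or_lt with h | h
        · exfalso; apply h1; rw [← neg_eq_zero, ← e, ← h, mul_zero]
        · exact h
      refine (hbound _ hyp hge).trans ?_
      rw [e, neg_sq]
      linarith [hsq (((j : ℕ) : ℝ) - (L * E - L)), hsq (((j : ℕ) : ℝ) - L * E)]

/-- All points of S are at distance at least √L/2, in grid units, from LE and its two images. Each
of the three inverse-square sums is then at most 8/√L, and (1/4)·3·8 = 6. The upper bound on |j/L −
E| is what excludes wrap-around. -/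
theorem sum_norm_sq_phaseAmp_tail {L : ℕ} (hL : 4 ≤ L) {E : ℝ} (hE : E ∈ Set.Icc (0 : ℝ) 1)
    (S : Finset (Fin L))
    (hS : ∀ j ∈ S, 1 / (2 * Real.sqrt L) ≤ |((j : ℕ) : ℝ) / L - E| ∧
      |((j : ℕ) : ℝ) / L - E| ≤ 1 - 1 / (2 * Real.sqrt L)) :
    ∑ j ∈ S, ‖phaseAmp L E j‖ ^ 2 ≤ 6 / Real.sqrt L := by
  have hL4 : (4 : ℝ) ≤ L := by exact_mod_cast hL
  have hLr : (0 : ℝ) < L := by linarith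
  have hs2 : 2 ≤ Real.sqrt L := by
    rw [show (2 : ℝ) = Real.sqrt 4 by rw [show (4 : ℝ) = 2 ^ 2 by norm_num]; simp]
    exact Real.sqrt_le_sqrt hL4
  have hss : Real.sqrt L * Real.sqrt L = L := Real.mul_self_sqrt hLr.le
  set d := Real.sqrt L / 2 with hd
  have hd1 : 1 ≤ d := by rw [hd]; linarith
  have hLd : (L : ℝ) * (1 / (2 * Real.sqrt L)) = d := by
    rw [hd]; nth_rewrite 1 [← hss]; field_simp
  have hdist : ∀ j ∈ S, d ≤ |((j : ℕ) : ℝ) - L * E| ∧ d ≤ |((j : ℕ) : ℝ) - (L * E + L)| ∧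
      d ≤ |((j : ℕ) : ℝ) - (L * E - L)| := by
    intro j hj
    obtain ⟨h1, h2⟩ := hS j hj
    set y := ((j : ℕ) : ℝ) / L - E with hy
    have hLy : ((j : ℕ) : ℝ) - L * E = L * y := by rw [hy]; field_simp
    have h3 := mul_le_mul_of_nonneg_left h1 hLr.le
    have h4 := mul_le_mul_of_nonneg_left h2 hLr.le
    rw [hLd] at h3
    rw [mul_sub, hLd, mul_one] at h4
    have h5 : |(L : ℝ) * y| = L * |y| := by rw [abs_mul, abs_of_pos hLr]
    refine ⟨by rw [hLy, h5]; exact h3, ?_, ?_⟩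
    · have : ((j : ℕ) : ℝ) - (L * E + L) = L * y - L := by linarith
      rw [this, abs_sub_comm]
      refine le_trans ?_ (le_abs_self _)
      have := le_abs_self (L * y)
      linarith
    · have : ((j : ℕ) : ℝ) - (L * E - L) = L * y + L := by linarith
      rw [this]
      refine le_trans ?_ (le_abs_self _)
      have := neg_abs_le (L * y)
      linarith
  have hne : ∀ u : ℝ, d ≤ |u| → u ≠ 0 := by
    rintro u hu rfl
    rw [abs_zero] at hu; linarith
  calc ∑ j ∈ S, ‖phaseAmp L E j‖ ^ 2 ≤ ∑ j ∈ S, 1 / 4 * (1 / (((j : ℕ) : ℝ) - L * E) ^ 2 +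
      1 / (((j : ℕ) : ℝ) - (L * E + L)) ^ 2 + 1 / (((j : ℕ) : ℝ) - (L * E - L)) ^ 2) := by
        refine Finset.sum_le_sum fun j hj => ?_
        obtain ⟨h1, h2, h3⟩ := hdist j hj
        exact norm_sq_phaseAmp_le (by omega) hE j (hne _ h1) (hne _ h2) (hne _ h3)
    _ = 1 / 4 * (∑ j ∈ S, 1 / (((j : ℕ) : ℝ) - L * E) ^ 2 +
        ∑ j ∈ S, 1 / (((j : ℕ) : ℝ) - (L * E + L)) ^ 2 +
        ∑ j ∈ S, 1 / (((j : ℕ) : ℝ) - (L * E - L)) ^ 2) := by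
        rw [← Finset.mul_sum, Finset.sum_add_distrib, Finset.sum_add_distrib]
    _ ≤ 1 / 4 * (4 / d + 4 / d + 4 / d) := by
        gcongr
        · exact sum_inv_sq_le S hd1 fun j hj => (hdist j hj).1
        · exact sum_inv_sq_le S hd1 fun j hj => (hdist j hj).2.1
        · exact sum_inv_sq_le S hd1 fun j hj => (hdist j hj).2.2
    _ = _ := by rw [hd]; field_simp; norm_num

theorem gridWeight_nonneg (L : ℕ) (e₀ w E : ℝ) : 0 ≤ gridWeight L e₀ w E :=
  Finset.sum_nonneg fun j _ => by split_ifs <;> positivity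

theorem gridWeight_le_one {L : ℕ} (hL : 0 < L) (e₀ w E : ℝ) : gridWeight L e₀ w E ≤ 1 := by
  rw [← sum_norm_sq_phaseAmp hL E]
  exact Finset.sum_le_sum fun j _ => by split_ifs <;> [exact le_rfl; positivity]

/-- The widths Δ − 3/√L and Δ − 1/√L keep E at distance 1/√L from every grid point outside the
measured window. As the full window lies in [0, 1], E also keeps the distance from 0 and 1 that
prevents aliasing. -/
theorem gridWeight_ge {L : ℕ} (hL : 4 ≤ L) {e₀ Δ E : ℝ} (h0 : 0 ≤ e₀ - Δ / 2)
    (h1 : e₀ + Δ / 2 ≤ 1) (hE : E ∈ Set.Icc (e₀ - (Δ - 3 / Real.sqrt L) / 2)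
      (e₀ + (Δ - 3 / Real.sqrt L) / 2)) :
    1 - 6 / Real.sqrt L ≤ gridWeight L e₀ (Δ - 1 / Real.sqrt L) E := by
  classical
  have hLr : (0 : ℝ) < L := by have : 0 < L := by omega
                               exact_mod_cast this
  have hs : 0 < Real.sqrt L := Real.sqrt_pos.2 hLr
  obtain ⟨hE1, hE2⟩ := hE
  set s := 1 / Real.sqrt L with hsdef
  have hspos : 0 < s := by positivity
  have e3 : 3 / Real.sqrt L = 3 * s := by rw [hsdef]; ring
  have e2 : 1 / (2 * Real.sqrt L) = s / 2 := by rw [hsdef]; field_simp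
  rw [e3] at hE1 hE2
  set S : Finset (Fin L) := Finset.univ.filter fun j : Fin L =>
    ¬ ((j : ℕ) : ℝ) / L ∈ Set.Icc (e₀ - (Δ - s) / 2) (e₀ + (Δ - s) / 2) with hS
  have htail : ∑ j ∈ S, ‖phaseAmp L E j‖ ^ 2 ≤ 6 / Real.sqrt L := by
    refine sum_norm_sq_phaseAmp_tail hL ⟨by linarith, by linarith⟩ S fun j hj => ?_
    rw [hS, Finset.mem_filter, Set.mem_Icc, not_and_or, not_le, not_le] at hj
    have hj0 : 0 ≤ ((j : ℕ) : ℝ) / L := by positivity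
    have hj1 : ((j : ℕ) : ℝ) / L < 1 := by
      rw [div_lt_one hLr]; exact_mod_cast j.2
    rw [e2]
    rcases hj.2 with h | h
    · rw [abs_of_nonpos (by linarith)]; constructor <;> linarith
    · rw [abs_of_nonneg (by linarith)]; constructor <;> linarith
  have hsum := sum_norm_sq_phaseAmp (L := L) (by omega) E
  have hgw : gridWeight L e₀ (Δ - s) E = ∑ j ∈ Finset.univ.filter (fun j : Fin L =>
      ((j : ℕ) : ℝ) / L ∈ Set.Icc (e₀ - (Δ - s) / 2) (e₀ + (Δ - s) / 2)),
      ‖phaseAmp L E j‖ ^ 2 := by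
    rw [gridWeight, Finset.sum_filter]
  rw [← Finset.sum_filter_add_sum_filter_not Finset.univ (fun j : Fin L =>
      ((j : ℕ) : ℝ) / L ∈ Set.Icc (e₀ - (Δ - s) / 2) (e₀ + (Δ - s) / 2)), ← hgw] at hsum
  linarith

/-- The measured window is narrower than Δ by 1/(2√L) on either side. This separates its grid points
from E, and also from 0 and 1, so that they do not alias to E either. -/
theorem gridWeight_le {L : ℕ} (hL : 4 ≤ L) {e₀ Δ E : ℝ} (h0 : 0 ≤ e₀ - Δ / 2)
    (h1 : e₀ + Δ / 2 ≤ 1) (hE : E ∈ Set.Icc (0 : ℝ) 1)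
    (hE' : E ∉ Set.Icc (e₀ - Δ / 2) (e₀ + Δ / 2)) :
    gridWeight L e₀ (Δ - 1 / Real.sqrt L) E ≤ 6 / Real.sqrt L := by
  classical
  have hLr : (0 : ℝ) < L := by have : 0 < L := by omega
                               exact_mod_cast this
  have hs : 0 < Real.sqrt L := Real.sqrt_pos.2 hLr
  set s := 1 / Real.sqrt L with hsdef
  have hspos : 0 < s := by positivity
  have e2 : 1 / (2 * Real.sqrt L) = s / 2 := by rw [hsdef]; field_simp
  rw [Set.mem_Icc, not_and_or, not_le, not_le] at hE'
  rw [gridWeight]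
  have := sum_norm_sq_phaseAmp_tail hL hE (Finset.univ.filter (fun j : Fin L =>
      ((j : ℕ) : ℝ) / L ∈ Set.Icc (e₀ - (Δ - s) / 2) (e₀ + (Δ - s) / 2))) (by
    intro j hj
    rw [Finset.mem_filter, Set.mem_Icc] at hj
    obtain ⟨_, hj1, hj2⟩ := hj
    rw [e2]
    rcases hE' with h | h
    · rw [abs_of_nonneg (by linarith)]; constructor <;> linarith [hE.1]
    · rw [abs_of_nonpos (by linarith)]; constructor <;> linarith [hE.2])
  rw [Finset.sum_filter] at this
  refine le_trans (le_of_eq (Finset.sum_congr rfl fun j _ => ?_)) this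
  split_ifs <;> rfl

/-! ### The accepting branch of the test -/

/-- The eigenvalues are ±1, where exp(ca) = cosh c + a sinh c. -/
theorem exp_smul_reflection {ι : Type*} [Fintype ι] [DecidableEq ι] {A : Matrix ι ι ℂ}
    (hA : IsReflection A) (c : ℂ) :
    NormedSpace.exp (c • A) = Complex.cosh c • (1 : Matrix ι ι ℂ) + Complex.sinh c • A := by
  obtain ⟨U, a, hU, hU', ha⟩ := exists_unitary_diagonal hA.1
  rw [exp_smul_of_mul_eq hU _ ha]
  have hsq : ∀ i, (a i) ^ 2 = 1 := by
    intro i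
    have h1 : A ^ 2 = 1 := by rw [sq, hA.2]
    rw [ha, conj_diagonal_pow hU hU'] at h1
    have h2 : Matrix.diagonal (fun i => (a i : ℂ) ^ 2) = 1 := by
      have := congrArg (fun X => U.conjTranspose * X * U) h1
      simp only [Matrix.mul_one] at this
      rw [hU] at this
      rw [← this]
      calc _ = (U.conjTranspose * U) * Matrix.diagonal (fun i => (a i : ℂ) ^ 2) *
            (U.conjTranspose * U) := by rw [hU, Matrix.one_mul, Matrix.mul_one]
        _ = _ := by simp only [Matrix.mul_assoc]
    have h3 := congrFun (congrFun h2 i) i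
    rw [Matrix.diagonal_apply_eq, Matrix.one_apply_eq] at h3
    exact_mod_cast h3
  have hexp : ∀ i, Complex.exp (c * a i) = Complex.cosh c + Complex.sinh c * a i := by
    intro i
    have : (a i - 1) * (a i + 1) = 0 := by have := hsq i; linarith
    rcases mul_eq_zero.1 this with h | h
    · rw [show a i = 1 by linarith]; simp
    · rw [show a i = -1 by linarith]
      push_cast
      rw [mul_neg_one, mul_neg_one, ← sub_eq_add_neg, Complex.cosh_sub_sinh]
  have h4 : Matrix.diagonal (fun i => Complex.exp (c * a i)) =
      Complex.cosh c • (1 : Matrix ι ι ℂ) +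
        Complex.sinh c • Matrix.diagonal (fun i => (a i : ℂ)) := by
    rw [← Matrix.diagonal_one, ← Matrix.diagonal_smul, ← Matrix.diagonal_smul,
      Matrix.diagonal_add]
    congr 1; funext i
    simp [hexp]
  rw [h4, Matrix.mul_add, Matrix.add_mul, Matrix.mul_smul, Matrix.mul_smul, Matrix.mul_one,
    Matrix.smul_mul, Matrix.smul_mul, hU', ← ha]

theorem IsReflection.map_star {ι : Type*} [Fintype ι] [DecidableEq ι] {A : Matrix ι ι ℂ}
    (hA : IsReflection A) : IsReflection (A.map star) := by
  constructor
  · have h := hA.1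
    ext i j
    simpa [Matrix.conjTranspose_apply] using congrArg star (congrFun (congrFun h i) j)
  · have : (A * A).map (starRingEnd ℂ) = A.map (starRingEnd ℂ) * A.map (starRingEnd ℂ) :=
      Matrix.map_mul
    rw [hA.2] at this
    change A.map (starRingEnd ℂ) * A.map (starRingEnd ℂ) = 1
    rw [← this, Matrix.map_one _ (map_zero _) (map_one _)]

/-- The average over the controls of `e^{±iεA_i} ⊗ e^{∓iε conj A_i}`. -/
def stepAverage {ι : Type*} [Fintype ι] [DecidableEq ι] {m : ℕ} (A : Fin m → Matrix ι ι ℂ)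
    (ε : ℝ) : Matrix (ι × ι) (ι × ι) ℂ :=
  ((Real.cos ε ^ 2 : ℝ) : ℂ) • 1 +
    ((Real.sin ε ^ 2 / m : ℝ) : ℂ) • ∑ i, A i ⊗ₖ (A i).map star

/-- For one sign the product is (cosh θ + sinh θ A) ⊗ (cosh θ − sinh θ conj A). Adding the opposite
sign cancels the terms linear in A, and −sinh²(iε) = sin²ε. -/
theorem sum_exp_kronecker {ι : Type*} [Fintype ι] [DecidableEq ι] {m : ℕ} (hm : 0 < m)
    {A : Fin m → Matrix ι ι ℂ} (hA : ∀ i, IsReflection (A i)) (ε : ℝ) :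
    (1 / (2 * m : ℂ)) • ∑ t : Fin m × Bool,
      (NormedSpace.exp (((if t.2 then -1 else 1) * (Complex.I * (ε : ℂ))) • A t.1) ⊗ₖ
        NormedSpace.exp ((-((if t.2 then -1 else 1) * (Complex.I * (ε : ℂ)))) • (A t.1).map star)) =
      stepAverage A ε := by
  have hm' : (m : ℂ) ≠ 0 := by exact_mod_cast hm.ne'
  have hcosh : Complex.cosh (Complex.I * ε) = Complex.cos ε := by
    rw [mul_comm, Complex.cosh_mul_I]
  have hsinh : Complex.sinh (Complex.I * ε) = Complex.sin ε * Complex.I := by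
    rw [mul_comm, Complex.sinh_mul_I]
  have key : ∀ i, ∑ b : Bool,
      (NormedSpace.exp (((if b then -1 else 1) * (Complex.I * (ε : ℂ))) • A i) ⊗ₖ
        NormedSpace.exp ((-((if b then -1 else 1) * (Complex.I * (ε : ℂ)))) • (A i).map star)) =
      (2 * Complex.cos ε ^ 2) • (1 : Matrix (ι × ι) (ι × ι) ℂ) +
        (2 * Complex.sin ε ^ 2) • (A i ⊗ₖ (A i).map star) := by
    intro i
    simp only [exp_smul_reflection (hA i), exp_smul_reflection (hA i).map_star]
    rw [Fintype.sum_bool]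
    simp only [if_true, Bool.false_eq_true, if_false, neg_mul, one_mul, neg_neg, Complex.cosh_neg,
      Complex.sinh_neg, hcosh, hsinh]
    rw [← Matrix.one_kronecker_one]
    ext p q
    simp only [Matrix.add_apply, Matrix.smul_apply, Matrix.kroneckerMap_apply, smul_eq_mul]
    ring_nf
    rw [Complex.I_sq]
    ring
  rw [Fintype.sum_prod_type, Finset.sum_congr rfl fun i _ => key i, Finset.sum_add_distrib,
    ← Finset.smul_sum, Finset.sum_const, Finset.card_univ, Fintype.card_fin, smul_add, smul_smul,
    ← Nat.cast_smul_eq_nsmul ℂ, smul_smul, ← Finset.smul_sum,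
    smul_smul, stepAverage]
  congr 2
  · push_cast; field_simp
  · push_cast; field_simp

/-- The operator `M₁ ⊗ M₂ ⊗ w` from `S₁ S₂` to all registers. -/
def triple {ι : Type*} {L m : ℕ} (M₁ M₂ : Matrix (ι × Fin L) ι ℂ) (w : Fin m × Bool → ℂ) :
    Matrix (Reg ι L m) (ι × ι) ℂ :=
  Matrix.of fun r s => M₁ r.1 s.1 * M₂ r.2.1 s.2 * w r.2.2

section Triple

variable {ι : Type*} [Fintype ι] [DecidableEq ι] {L m : ℕ}

theorem kronecker_mul_triple (B₁ B₂ : Matrix (ι × Fin L) (ι × Fin L) ℂ)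
    (B₃ : Matrix (Fin m × Bool) (Fin m × Bool) ℂ) (M₁ M₂ : Matrix (ι × Fin L) ι ℂ)
    (w : Fin m × Bool → ℂ) :
    (B₁ ⊗ₖ (B₂ ⊗ₖ B₃)) * triple M₁ M₂ w = triple (B₁ * M₁) (B₂ * M₂) (B₃.mulVec w) := by
  ext ⟨r₁, r₂, r₃⟩ ⟨s₁, s₂⟩
  simp only [triple, Matrix.mul_apply, Matrix.of_apply, Matrix.kroneckerMap_apply, Matrix.mulVec,
    dotProduct]
  rw [Finset.sum_mul_sum, Finset.sum_mul_sum, Fintype.sum_prod_type]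
  refine Finset.sum_congr rfl fun x _ => ?_
  rw [Fintype.sum_prod_type, Finset.sum_comm]
  refine Finset.sum_congr rfl fun z _ => ?_
  rw [Finset.sum_mul]
  refine Finset.sum_congr rfl fun y _ => ?_
  ring

theorem triple_mul_kronecker (M₁ M₂ : Matrix (ι × Fin L) ι ℂ) (w : Fin m × Bool → ℂ)
    (X₁ X₂ : Matrix ι ι ℂ) :
    triple M₁ M₂ w * (X₁ ⊗ₖ X₂) = triple (M₁ * X₁) (M₂ * X₂) w := by
  ext ⟨r₁, r₂, r₃⟩ ⟨s₁, s₂⟩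
  simp only [triple, Matrix.mul_apply, Matrix.of_apply, Matrix.kroneckerMap_apply]
  rw [Finset.sum_mul_sum, Finset.sum_mul, Fintype.sum_prod_type]
  refine Finset.sum_congr rfl fun x _ => ?_
  rw [Finset.sum_mul]
  refine Finset.sum_congr rfl fun y _ => ?_
  ring

theorem triple_smul (M₁ M₂ : Matrix (ι × Fin L) ι ℂ) (c : ℂ) (w : Fin m × Bool → ℂ) :
    triple M₁ M₂ (c • w) = c • triple M₁ M₂ w := by
  ext r s; simp [triple]; ring

theorem prepare_eq_triple :
    prepare ι L m = triple (appendUnif ι L) (appendUnif ι L)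
      (fun _ => 1 / (Real.sqrt (2 * m) : ℂ)) := by
  ext ⟨r₁, r₂, r₃⟩ ⟨s₁, s₂⟩
  simp only [prepare, triple, appendUnif, Matrix.of_apply]
  split_ifs <;> simp_all

theorem one_kronecker_unifProj :
    (1 : Matrix ι ι ℂ) ⊗ₖ unifProj (Fin L) = appendUnif ι L * (appendUnif ι L).conjTranspose := by
  ext ⟨x, k⟩ ⟨y, l⟩
  rw [Matrix.mul_apply, Finset.sum_eq_single x]
  · have h : star (1 / (Real.sqrt L : ℂ)) = 1 / (Real.sqrt L : ℂ) := by simp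
    by_cases hxy : x = y
    · subst hxy
      simp only [Matrix.kroneckerMap_apply, Matrix.one_apply_eq, unifProj, Matrix.of_apply,
        Fintype.card_fin, appendUnif, Matrix.conjTranspose_apply, if_true, h]
      rw [one_div_sqrt_mul_self, one_mul]
    · simp [Matrix.kroneckerMap_apply, Matrix.one_apply_ne hxy, appendUnif,
        Ne.symm hxy]
  · intro b _ hb
    simp [appendUnif, hb.symm]
  · simp

theorem appendUnif_conjTranspose_mul (hL : 0 < L) :
    (appendUnif ι L).conjTranspose * appendUnif ι L = 1 := by
  have hL' : (L : ℂ) ≠ 0 := by exact_mod_cast hL.ne'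
  have h : star (1 / (Real.sqrt L : ℂ)) = 1 / (Real.sqrt L : ℂ) := by simp
  ext x y
  rw [Matrix.mul_apply, Fintype.sum_prod_type, Finset.sum_eq_single x]
  · by_cases hxy : x = y
    · subst hxy
      simp only [appendUnif, Matrix.conjTranspose_apply, Matrix.of_apply, if_true, h,
        one_div_sqrt_mul_self]
      simp [hL']
    · simp [appendUnif, hxy]
  · intro z _ hz
    simp [appendUnif, hz]
  · simp

theorem kronecker_one_mul_appendUnif (X : Matrix ι ι ℂ) :
    (X ⊗ₖ (1 : Matrix (Fin L) (Fin L) ℂ)) * appendUnif ι L = appendUnif ι L * X := by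
  ext ⟨x, k⟩ y
  rw [Matrix.mul_apply, Matrix.mul_apply, Fintype.sum_prod_type, Finset.sum_eq_single y]
  · rw [Finset.sum_eq_single k, Finset.sum_eq_single x]
    · simp [appendUnif, mul_comm]
    · intro z _ hz; simp [appendUnif, hz.symm]
    · simp
    · intro l _ hl; simp [Matrix.one_apply_ne hl.symm]
    · simp
  · intro z _ hz
    simp [appendUnif, hz]
  · simp

theorem energyCheck_mul_triple (H : Matrix ι ι ℂ) (e₀ w : ℝ) (X₁ X₂ : Matrix ι ι ℂ)
    (v : Fin m × Bool → ℂ) :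
    energyCheck H L m e₀ w * triple (appendUnif ι L * X₁) (appendUnif ι L * X₂) v =
      triple (appendUnif ι L *
          (((appendUnif ι L).conjTranspose * projSP H L e₀ w * appendUnif ι L) * X₁))
        (appendUnif ι L *
          (((appendUnif ι L).conjTranspose * projSP (H.map star) L e₀ w * appendUnif ι L) * X₂))
        v := by
  rw [energyCheck, Matrix.mul_assoc, kronecker_mul_triple, kronecker_mul_triple,
    one_kronecker_unifProj]
  simp only [Matrix.one_mulVec, Matrix.mul_assoc]

theorem unifProj_mulVec_single {κ : Type*} [Fintype κ] [DecidableEq κ] (t : κ) (c : ℂ) :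
    (unifProj κ).mulVec ((Matrix.single t t (1 : ℂ)).mulVec fun _ => c) =
      (1 / (Fintype.card κ : ℂ)) • fun _ => c := by
  have : (Matrix.single t t (1 : ℂ)).mulVec (fun _ => c) = Pi.single t c := by
    ext x
    simp only [Matrix.mulVec, dotProduct, Matrix.single_apply, Pi.single_apply]
    by_cases h : t = x
    · subst h; simp
    · simp [h, Ne.symm h]
  rw [this]
  ext x
  simp [unifProj, Matrix.mulVec, dotProduct, ← Finset.mul_sum]

/-- The projector onto |u⟩ is V V† for the isometry V = `appendUnif`, so after each energy check the
state is again V ⊗ V applied to a state of S₁S₂, and only the compressions Q, Q' act. The final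
projection onto |t⟩ weights every control value by 1/(2m), which turns the controlled step into its
average. -/
theorem acceptBranch_eq (hm : 0 < m) (H : Matrix ι ι ℂ)
    {A : Fin m → Matrix ι ι ℂ} (hA : ∀ i, IsReflection (A i)) (ε e₀ Δ : ℝ)
    {Q Q' : Matrix ι ι ℂ}
    (hQ : (appendUnif ι L).conjTranspose * projSP H L e₀ (Δ - 1 / Real.sqrt L) *
      appendUnif ι L = Q)
    (hQ' : (appendUnif ι L).conjTranspose * projSP (H.map star) L e₀ (Δ - 1 / Real.sqrt L) *
      appendUnif ι L = Q') :
    acceptBranch H A ε e₀ Δ L =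
      prepare ι L m * ((Q ⊗ₖ Q') * stepAverage A ε * (Q ⊗ₖ Q')) := by
  have h1 : energyCheck H L m e₀ (Δ - 1 / Real.sqrt L) * prepare ι L m =
      triple (appendUnif ι L * Q) (appendUnif ι L * Q') (fun _ => 1 / (Real.sqrt (2 * m) : ℂ)) := by
    rw [prepare_eq_triple]
    have := energyCheck_mul_triple (L := L) (m := m) H e₀ (Δ - 1 / Real.sqrt L) 1 1
      (fun _ => 1 / (Real.sqrt (2 * m) : ℂ))
    rw [Matrix.mul_one, hQ, hQ', Matrix.mul_one, Matrix.mul_one] at this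
    exact this
  have hcard : (Fintype.card (Fin m × Bool) : ℂ) = 2 * m := by simp; ring
  rw [acceptBranch, Matrix.mul_assoc _ (energyCheck H L m e₀ _) (prepare ι L m), h1, controlledStep,
    Matrix.mul_assoc, Matrix.mul_assoc, Matrix.sum_mul, Matrix.mul_sum, Matrix.mul_sum]
  rw [← sum_exp_kronecker hm hA, Matrix.mul_smul, Matrix.smul_mul, Matrix.mul_smul,
    Matrix.mul_sum, Matrix.sum_mul, Matrix.mul_sum, Finset.smul_sum]
  refine Finset.sum_congr rfl fun t _ => ?_
  simp only
  rw [kronecker_mul_triple, ← Matrix.mul_assoc (_ ⊗ₖ 1), kronecker_one_mul_appendUnif,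
    ← Matrix.mul_assoc (_ ⊗ₖ 1), kronecker_one_mul_appendUnif, Matrix.mul_assoc, Matrix.mul_assoc,
    energyCheck_mul_triple, hQ, hQ', kronecker_mul_triple, unifProj_mulVec_single, Matrix.one_mul,
    Matrix.one_mul, triple_smul, hcard, ← Matrix.mul_kronecker_mul, ← Matrix.mul_kronecker_mul,
    prepare_eq_triple, triple_mul_kronecker]
  simp only [Matrix.mul_assoc]

theorem prepare_conjTranspose_mul (hL : 0 < L) (hm : 0 < m) :
    (prepare ι L m).conjTranspose * prepare ι L m = 1 := by
  rw [prepare_eq_triple]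
  have hV : (appendUnif ι L).conjTranspose * appendUnif ι L = 1 := appendUnif_conjTranspose_mul hL
  have hm' : (m : ℂ) ≠ 0 := by exact_mod_cast hm.ne'
  ext ⟨x₁, x₂⟩ ⟨y₁, y₂⟩
  rw [Matrix.mul_apply, Fintype.sum_prod_type]
  simp only [Fintype.sum_prod_type (α₁ := ι × Fin L) (α₂ := (Fin m × Bool))]
  have h1 := congrFun (congrFun hV x₁) y₁
  have h2 := congrFun (congrFun hV x₂) y₂
  rw [Matrix.mul_apply] at h1 h2
  have h3 : ∑ t : Fin m × Bool, star (1 / (Real.sqrt (2 * m) : ℂ)) *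
      (1 / (Real.sqrt (2 * m) : ℂ)) = 1 := by
    have h : star (1 / (Real.sqrt (2 * m) : ℂ)) = 1 / (Real.sqrt (2 * m) : ℂ) := by simp
    rw [Finset.sum_const, Finset.card_univ, h, div_mul_div_comm, one_mul, ← Complex.ofReal_mul,
      Real.mul_self_sqrt (by positivity), nsmul_eq_mul]
    simp only [Fintype.card_prod, Fintype.card_fin, Fintype.card_bool]
    push_cast
    field_simp
  calc _ = (∑ a, (appendUnif ι L).conjTranspose x₁ a * appendUnif ι L a y₁) *
      ((∑ b, (appendUnif ι L).conjTranspose x₂ b * appendUnif ι L b y₂) *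
        ∑ t : Fin m × Bool, star (1 / (Real.sqrt (2 * m) : ℂ)) *
          (1 / (Real.sqrt (2 * m) : ℂ))) := by
        rw [Finset.sum_mul_sum, Finset.sum_mul_sum]
        refine Finset.sum_congr rfl fun a _ => ?_
        refine Finset.sum_congr rfl fun b _ => ?_
        rw [Finset.mul_sum]
        refine Finset.sum_congr rfl fun t _ => ?_
        simp only [triple, Matrix.conjTranspose_apply, Matrix.of_apply, star_mul']
        ring
    _ = _ := by
        rw [h1, h2, h3, mul_one, ← Matrix.one_kronecker_one]
        rfl

end Triple

theorem norm_toEuclideanLin_isometry {κ κ' : Type*} [Fintype κ] [DecidableEq κ] [Fintype κ']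
    {J : Matrix κ' κ ℂ} (hJ : J.conjTranspose * J = 1) (ψ : EuclideanSpace ℂ κ) :
    ‖Matrix.toEuclideanLin J ψ‖ = ‖ψ‖ := by
  classical
  have h : ‖Matrix.toEuclideanLin J ψ‖ ^ 2 = ‖ψ‖ ^ 2 := by
    have h1 : inner ℂ (Matrix.toEuclideanLin J ψ) (Matrix.toEuclideanLin J ψ) = inner ℂ ψ ψ := by
      rw [← LinearMap.adjoint_inner_right, ← Matrix.toEuclideanLin_conjTranspose_eq_adjoint]
      have : Matrix.toEuclideanLin J.conjTranspose (Matrix.toEuclideanLin J ψ) = ψ := by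
        have h2 : Matrix.toEuclideanLin (J.conjTranspose * J) ψ =
            Matrix.toEuclideanLin J.conjTranspose (Matrix.toEuclideanLin J ψ) := by
          ext i
          simp [Matrix.mulVec_mulVec]
        rw [← h2, hJ]
        simp
      rw [this]
    rw [inner_self_eq_norm_sq_to_K, inner_self_eq_norm_sq_to_K] at h1
    exact_mod_cast h1
  exact (sq_eq_sq₀ (norm_nonneg _) (norm_nonneg _)).1 h

/-! ### The Perron vector of a positive symmetric kernel -/

/-- Schur test: the product x_α x_β is split by the arithmetic-geometric mean inequality with
weights v_β/v_α and v_α/v_β, after which the eigenvector equation sums each half exactly. -/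
theorem sum_sq_le_of_schur {W : Type*} [Fintype W] {B : W → W → ℝ} (hB0 : ∀ α β, 0 ≤ B α β)
    (hBs : ∀ α β, B α β = B β α) {v : W → ℝ} (hv : ∀ α, 0 < v α) {k : ℝ}
    (hBv : ∀ α, ∑ β, B α β * v β = k * v α) (x : W → ℝ) :
    ∑ α, ∑ β, B α β * (x α * x β) ≤ k * ∑ α, x α ^ 2 := by
  have h1 : ∀ α β, B α β * (x α * x β) ≤
      1 / 2 * (B α β * v β * (x α ^ 2 / v α)) + 1 / 2 * (B β α * v α * (x β ^ 2 / v β)) := by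
    intro α β
    have ha := hv α
    have hb := hv β
    have h2 : x α * x β ≤ 1 / 2 * (v β * (x α ^ 2 / v α)) + 1 / 2 * (v α * (x β ^ 2 / v β)) := by
      have e : 1 / 2 * (v β * (x α ^ 2 / v α)) + 1 / 2 * (v α * (x β ^ 2 / v β)) - x α * x β =
          (v β * x α - v α * x β) ^ 2 / (2 * (v α * v β)) := by
        field_simp; ring
      have : 0 ≤ (v β * x α - v α * x β) ^ 2 / (2 * (v α * v β)) := by positivity
      linarith
    have h3 := mul_le_mul_of_nonneg_left h2 (hB0 α β)
    rw [hBs β α]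
    linarith
  have h2 : ∑ α, ∑ β, B α β * v β * (x α ^ 2 / v α) = k * ∑ α, x α ^ 2 := by
    rw [Finset.mul_sum]
    refine Finset.sum_congr rfl fun α _ => ?_
    rw [← Finset.sum_mul, hBv]
    have := (hv α).ne'
    field_simp
  calc _ ≤ ∑ α, ∑ β, (1 / 2 * (B α β * v β * (x α ^ 2 / v α)) +
        1 / 2 * (B β α * v α * (x β ^ 2 / v β))) :=
        Finset.sum_le_sum fun α _ => Finset.sum_le_sum fun β _ => h1 α β
    _ = 1 / 2 * (k * ∑ α, x α ^ 2) + 1 / 2 * (k * ∑ α, x α ^ 2) := by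
        simp only [Finset.sum_add_distrib, ← Finset.mul_sum]
        rw [h2]
        congr 2
        rw [Finset.sum_comm, h2]
    _ = _ := by ring

/-- Perron's argument. Replacing a top eigenvector by its absolute values cannot lower the form;
strict positivity of B then forces all products x_α x_β to be nonnegative, so x has constant sign.
-/
theorem exists_nonneg_top_eigenvector {W : Type*} [Fintype W] [DecidableEq W] [Nonempty W]
    {B : W → W → ℝ} (hB0 : ∀ α β, 0 < B α β) (hBs : ∀ α β, B α β = B β α) :
    ∃ (v : W → ℝ) (l : ℝ), (∀ α, 0 ≤ v α) ∧ ∑ α, v α ^ 2 = 1 ∧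
      (∀ α, ∑ β, B α β * v β = l * v α) ∧
      ∀ x : W → ℝ, ∑ α, ∑ β, B α β * (x α * x β) ≤ l * ∑ α, x α ^ 2 := by
  set M : Matrix W W ℝ := Matrix.of B with hM
  have hMh : M.IsHermitian := by
    ext α β; simp [hM, hBs α β]
  set T := Matrix.toEuclideanLin M with hT
  have hTs : T.IsSymmetric := Matrix.isSymmetric_toEuclideanLin_iff.2 hMh
  have hTy : ∀ (y : EuclideanSpace ℝ W) α, T y α = ∑ β, B α β * y β := by
    intro y α
    simp [hT, hM, Matrix.mulVec, dotProduct]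
  have hin : ∀ y : EuclideanSpace ℝ W, inner ℝ (T y) y = ∑ α, ∑ β, B α β * (y α * y β) := by
    intro y
    rw [PiLp.inner_apply]
    refine Finset.sum_congr rfl fun α _ => ?_
    rw [hTy]
    simp only [RCLike.inner_apply, conj_trivial]
    rw [Finset.mul_sum]
    exact Finset.sum_congr rfl fun β _ => by ring
  have hnorm : ∀ y : EuclideanSpace ℝ W, ‖y‖ ^ 2 = ∑ α, y α ^ 2 := by
    intro y; rw [EuclideanSpace.norm_sq_eq]; simp
  obtain ⟨x, l, hx, hTx, hl⟩ := exists_top_eigenvector (𝕜 := ℝ) hTs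
  have hform : ∀ y : W → ℝ, ∑ α, ∑ β, B α β * (y α * y β) ≤ l * ∑ α, y α ^ 2 := by
    intro y
    have := hl (WithLp.toLp 2 y)
    rw [hnorm, hin] at this
    exact this
  have hx1 : ∑ α, x α ^ 2 = 1 := by rw [← hnorm, hx]; norm_num
  have hxe : ∀ α, ∑ β, B α β * x β = l * x α := by
    intro α; rw [← hTy, hTx]; simp
  have hxx : ∑ α, ∑ β, B α β * (x α * x β) = l := by
    have : ∑ α, ∑ β, B α β * (x α * x β) = ∑ α, x α * ∑ β, B α β * x β := by
      refine Finset.sum_congr rfl fun α _ => ?_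
      rw [Finset.mul_sum]
      exact Finset.sum_congr rfl fun β _ => by ring
    rw [this]
    simp only [hxe]
    calc ∑ α, x α * (l * x α) = l * ∑ α, x α ^ 2 := by
          rw [Finset.mul_sum]; exact Finset.sum_congr rfl fun α _ => by ring
      _ = l := by rw [hx1, mul_one]
  have habs := hform fun α => |x α|
  simp only [sq_abs] at habs
  rw [hx1, mul_one] at habs
  have hle : ∀ α β, 0 ≤ B α β * (|x α| * |x β|) - B α β * (x α * x β) := by
    intro α β
    rw [← mul_sub, ← abs_mul]
    exact mul_nonneg (hB0 α β).le (sub_nonneg.2 (le_abs_self _))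
  have hzero : ∑ α, ∑ β, (B α β * (|x α| * |x β|) - B α β * (x α * x β)) ≤ 0 := by
    simp only [Finset.sum_sub_distrib]
    rw [hxx]; linarith
  have hsame : ∀ α β, x α * x β = |x α| * |x β| := by
    intro α β
    have h1 : B α β * (|x α| * |x β|) - B α β * (x α * x β) ≤ 0 := by
      refine le_trans ?_ hzero
      refine le_trans ?_ (Finset.single_le_sum (f := fun α =>
        ∑ β, (B α β * (|x α| * |x β|) - B α β * (x α * x β)))
        (fun α _ => Finset.sum_nonneg fun β _ => hle α β) (Finset.mem_univ α))
      exact Finset.single_le_sum (f := fun β => B α β * (|x α| * |x β|) - B α β * (x α * x β))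
        (fun β _ => hle α β) (Finset.mem_univ β)
    have h2 := le_antisymm h1 (hle α β)
    rw [← mul_sub] at h2
    rcases mul_eq_zero.1 h2 with h | h
    · exact absurd h (hB0 α β).ne'
    · linarith
  obtain ⟨γ, hγ⟩ : ∃ γ, x γ ≠ 0 := by
    by_contra h
    push Not at h
    simp [h] at hx1
  have hsign : ∃ s : ℝ, s ^ 2 = 1 ∧ ∀ β, 0 ≤ s * x β := by
    rcases lt_or_gt_of_ne hγ with h | h
    · refine ⟨-1, by norm_num, fun β => ?_⟩
      have := hsame γ β
      rw [abs_of_neg h] at this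
      have h2 : x β = -|x β| := by
        have : x γ * (x β + |x β|) = 0 := by linarith
        rcases mul_eq_zero.1 this with h3 | h3
        · exact absurd h3 hγ
        · linarith
      have := abs_nonneg (x β)
      linarith
    · refine ⟨1, by norm_num, fun β => ?_⟩
      have := hsame γ β
      rw [abs_of_pos h] at this
      have h2 := mul_left_cancel₀ hγ this
      rw [one_mul, h2]; exact abs_nonneg _
  obtain ⟨s, hs, hsx⟩ := hsign
  refine ⟨fun α => s * x α, l, hsx, ?_, ?_, hform⟩
  · simp only [mul_pow, hs, one_mul]; exact hx1
  · intro α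
    have : ∀ β, B α β * (s * x β) = s * (B α β * x β) := fun β => by ring
    simp only [this]
    rw [← Finset.mul_sum, hxe]; ring

theorem norm_sum_le_of_schur {W : Type*} [Fintype W] {B : W → W → ℝ} (hB0 : ∀ α β, 0 ≤ B α β)
    (hBs : ∀ α β, B α β = B β α) {v : W → ℝ} (hv : ∀ α, 0 < v α) {k : ℝ}
    (hBv : ∀ α, ∑ β, B α β * v β = k * v α) (x : W → ℂ) :
    (∑ α, ∑ β, (B α β : ℂ) * (star (x α) * x β)).re ≤ k * ∑ α, ‖x α‖ ^ 2 := by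
  refine (Complex.re_le_norm _).trans ?_
  refine le_trans ?_ (sum_sq_le_of_schur hB0 hBs hv hBv fun α => ‖x α‖)
  refine (norm_sum_le _ _).trans (Finset.sum_le_sum fun α _ => ?_)
  refine (norm_sum_le _ _).trans (Finset.sum_le_sum fun β _ => ?_)
  rw [norm_mul, norm_mul, norm_star, Complex.norm_real, Real.norm_of_nonneg (hB0 α β)]

/-- The Perron vector of a symmetric kernel with entries in `[f² / D, 1 / D]`, and its spectral
gap. -/
theorem exists_perron {W : Type*} [Fintype W] [DecidableEq W] [Nonempty W] {f : ℝ} (hf : 0 < f)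
    {B : W → W → ℝ} (hBs : ∀ α β, B α β = B β α)
    (hBl : ∀ α β, f ^ 2 / Fintype.card W ≤ B α β) (hBu : ∀ α β, B α β ≤ 1 / Fintype.card W) :
    ∃ (v : W → ℝ) (l : ℝ), (∀ α, 0 < v α) ∧ ∑ α, v α ^ 2 = 1 ∧
      (∀ α, ∑ β, B α β * v β = l * v α) ∧ f ^ 2 ≤ l ∧ l ≤ 1 ∧
      (∀ α, v α ^ 2 ≤ 1 / (f ^ 4 * Fintype.card W)) ∧
      ∀ x : W → ℂ, ∑ α, (v α : ℂ) * x α = 0 →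
        (∑ α, ∑ β, (B α β : ℂ) * (star (x α) * x β)).re ≤ (l - f ^ 6) * ∑ α, ‖x α‖ ^ 2 := by
  set D : ℝ := (Fintype.card W : ℝ) with hD
  have hDpos : 0 < D := by rw [hD]; exact_mod_cast Fintype.card_pos
  have hB0 : ∀ α β, 0 < B α β := fun α β => lt_of_lt_of_le (by positivity) (hBl α β)
  obtain ⟨v, l, hv0, hv1, hve, hform⟩ := exists_nonneg_top_eigenvector hB0 hBs
  have hlf : f ^ 2 ≤ l := by
    have h1 := hform fun _ => 1
    have h2 : ∑ _α : W, ∑ _β : W, f ^ 2 / D ≤ ∑ α, ∑ β, B α β * (1 * 1) :=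
      Finset.sum_le_sum fun α _ => Finset.sum_le_sum fun β _ => by rw [one_mul, mul_one]; exact hBl α β
    have h3 : ∑ _α : W, ∑ _β : W, f ^ 2 / D = f ^ 2 * D := by
      simp only [Finset.sum_const, Finset.card_univ, nsmul_eq_mul, ← hD]
      field_simp
    have h4 : ∑ _α : W, (1 : ℝ) ^ 2 = D := by simp [hD]
    rw [h4] at h1
    rw [h3] at h2
    exact le_of_mul_le_mul_right (h2.trans h1) hDpos
  have hl0 : 0 < l := lt_of_lt_of_le (by positivity) hlf
  have hvsum : (∑ β, v β) ^ 2 ≤ D := by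
    have := sq_sum_le_card_mul_sum_sq (s := Finset.univ) (f := v)
    rw [hv1, mul_one] at this
    exact this
  have hsum0 : 0 ≤ ∑ β, v β := Finset.sum_nonneg fun β _ => hv0 β
  have hsumpos : 0 < ∑ β, v β := by
    rcases hsum0.eq_or_lt with h | h
    · exfalso
      have h2 := (Finset.sum_eq_zero_iff_of_nonneg fun β _ => hv0 β).1 h.symm
      have : ∑ α, v α ^ 2 = 0 := Finset.sum_eq_zero fun α ha => by rw [h2 α ha]; ring
      linarith
    · exact h
  -- The upper bound on B makes v flat: l v_α ≤ (1/D) ∑ v ≤ 1/√D, and with l ≥ f² this is the bound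
  -- on v_α².
  have hvle : ∀ α, l * v α ≤ 1 / D * ∑ β, v β := by
    intro α
    rw [← hve, Finset.mul_sum]
    exact Finset.sum_le_sum fun β _ => mul_le_mul_of_nonneg_right (hBu α β) (hv0 β)
  have hvpos : ∀ α, 0 < v α := by
    intro α
    have h1 : f ^ 2 / D * ∑ β, v β ≤ l * v α := by
      rw [← hve, Finset.mul_sum]
      exact Finset.sum_le_sum fun β _ => mul_le_mul_of_nonneg_right (hBl α β) (hv0 β)
    have h2 : 0 < l * v α := lt_of_lt_of_le (by positivity) h1
    exact pos_of_mul_pos_right h2 hl0.le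
  have hlv : ∀ α, (l * v α) ^ 2 ≤ 1 / D := by
    intro α
    calc (l * v α) ^ 2 ≤ (1 / D * ∑ β, v β) ^ 2 :=
          pow_le_pow_left₀ (mul_nonneg hl0.le (hv0 α)) (hvle α) 2
      _ = 1 / D ^ 2 * (∑ β, v β) ^ 2 := by ring
      _ ≤ 1 / D ^ 2 * D := by gcongr
      _ = _ := by field_simp
  have hl1 : l ≤ 1 := by
    have h1 : ∑ α, ∑ β, B α β * (v α * v β) = l := by
      have : ∑ α, ∑ β, B α β * (v α * v β) = ∑ α, v α * ∑ β, B α β * v β := by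
        refine Finset.sum_congr rfl fun α _ => ?_
        rw [Finset.mul_sum]
        exact Finset.sum_congr rfl fun β _ => by ring
      rw [this]
      simp only [hve]
      calc ∑ α, v α * (l * v α) = l * ∑ α, v α ^ 2 := by
            rw [Finset.mul_sum]; exact Finset.sum_congr rfl fun α _ => by ring
        _ = l := by rw [hv1, mul_one]
    rw [← h1]
    calc ∑ α, ∑ β, B α β * (v α * v β) ≤ ∑ α, ∑ β, 1 / D * (v α * v β) :=
          Finset.sum_le_sum fun α _ => Finset.sum_le_sum fun β _ =>
            mul_le_mul_of_nonneg_right (hBu α β) (mul_nonneg (hv0 α) (hv0 β))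
      _ = 1 / D * (∑ β, v β) ^ 2 := by
          rw [sq, Finset.sum_mul_sum, Finset.mul_sum]
          exact Finset.sum_congr rfl fun α _ => by rw [Finset.mul_sum]
      _ ≤ 1 / D * D := by gcongr
      _ = 1 := by field_simp
  have hvv : ∀ α, f ^ 4 * v α ^ 2 ≤ 1 / D := by
    intro α
    refine le_trans ?_ (hlv α)
    rw [mul_pow]
    have : f ^ 4 ≤ l ^ 2 := by
      calc f ^ 4 = (f ^ 2) ^ 2 := by ring
        _ ≤ l ^ 2 := by gcongr
    gcongr
  refine ⟨v, l, hvpos, hv1, hve, hlf, hl1, ?_, ?_⟩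
  · intro α
    rw [le_div_iff₀ (by positivity)]
    have := mul_le_mul_of_nonneg_right (hvv α) hDpos.le
    have e : 1 / D * D = 1 := by field_simp
    rw [e] at this
    linarith
  · intro x hx
    -- The gap f⁶ is the largest multiple of v vᵀ that these bounds allow to be subtracted from B:
    -- v_α v_β ≤ 1/(f⁴D) while B ≥ f²/D. On the complement of v the subtraction does not change the
    -- form.
    have hB' : ∀ α β, 0 ≤ B α β - f ^ 6 * (v α * v β) := by
      intro α β
      have h1 : v α * v β ≤ (v α ^ 2 + v β ^ 2) / 2 := by nlinarith [sq_nonneg (v α - v β)]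
      have h2 : f ^ 4 * (v α * v β) ≤ 1 / D := by
        have := hvv α
        have := hvv β
        have := mul_le_mul_of_nonneg_left h1 (by positivity : 0 ≤ f ^ 4)
        linarith
      have h3 : f ^ 6 * (v α * v β) ≤ f ^ 2 / D := by
        calc f ^ 6 * (v α * v β) = f ^ 2 * (f ^ 4 * (v α * v β)) := by ring
          _ ≤ f ^ 2 * (1 / D) := by gcongr
          _ = _ := by ring
      linarith [hBl α β]
    have hB's : ∀ α β, B α β - f ^ 6 * (v α * v β) = B β α - f ^ 6 * (v β * v α) := by
      intro α β; rw [hBs α β, mul_comm (v α)]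
    have hB've : ∀ α, ∑ β, (B α β - f ^ 6 * (v α * v β)) * v β = (l - f ^ 6) * v α := by
      intro α
      have : ∀ β, (B α β - f ^ 6 * (v α * v β)) * v β = B α β * v β - f ^ 6 * v α * v β ^ 2 :=
        fun β => by ring
      simp only [this]
      rw [Finset.sum_sub_distrib, hve, ← Finset.mul_sum, hv1]; ring
    refine le_trans (le_of_eq ?_) (norm_sum_le_of_schur hB' hB's hvpos hB've x)
    congr 1
    have hx' : ∑ α, (v α : ℂ) * star (x α) = 0 := by
      have := congrArg star hx
      simpa using this
    have h0 : ∑ α, ∑ β, ((f ^ 6 : ℝ) : ℂ) * (((v α : ℂ) * star (x α)) * ((v β : ℂ) * x β)) = 0 := by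
      simp only [← Finset.mul_sum, hx]; simp
    rw [← sub_zero (∑ α, ∑ β, (B α β : ℂ) * (star (x α) * x β)), ← h0, ← Finset.sum_sub_distrib]
    refine Finset.sum_congr rfl fun α _ => ?_
    rw [← Finset.sum_sub_distrib]
    refine Finset.sum_congr rfl fun β _ => ?_
    push_cast; ring

open scoped InnerProductSpace

/-! ### The compressed step operator -/

theorem toEuclideanLin_mul_apply {κ κ' κ'' : Type*} [Fintype κ] [DecidableEq κ] [Fintype κ']
    [DecidableEq κ'] (M : Matrix κ'' κ' ℂ) (N : Matrix κ' κ ℂ)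
    (ψ : EuclideanSpace ℂ κ) :
    Matrix.toEuclideanLin (M * N) ψ = Matrix.toEuclideanLin M (Matrix.toEuclideanLin N ψ) := by
  ext i
  simp [Matrix.mulVec_mulVec]

theorem inner_toEuclideanLin {κ κ' : Type*} [Fintype κ] [DecidableEq κ] [Fintype κ']
    [DecidableEq κ'] (M : Matrix κ' κ ℂ) (ψ : EuclideanSpace ℂ κ) (φ : EuclideanSpace ℂ κ') :
    ⟪φ, Matrix.toEuclideanLin M ψ⟫_ℂ = ⟪Matrix.toEuclideanLin M.conjTranspose φ, ψ⟫_ℂ := by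
  rw [Matrix.toEuclideanLin_conjTranspose_eq_adjoint, LinearMap.adjoint_inner_left]

theorem inner_toEuclideanLin_eq_dotProduct {κ : Type*} [Fintype κ] [DecidableEq κ]
    (M : Matrix κ κ ℂ) (φ : EuclideanSpace ℂ κ) :
    ⟪φ, Matrix.toEuclideanLin M φ⟫_ℂ = star φ.ofLp ⬝ᵥ M.mulVec φ.ofLp := by
  rw [EuclideanSpace.inner_eq_star_dotProduct, dotProduct_comm]
  rfl

theorem inner_one_smul_add {κ : Type*} [Fintype κ] [DecidableEq κ] (M : Matrix κ κ ℂ) (c d : ℝ)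
    (φ : EuclideanSpace ℂ κ) :
    (⟪φ, Matrix.toEuclideanLin ((c : ℂ) • 1 + (d : ℂ) • M) φ⟫_ℂ).re =
      c * ‖φ‖ ^ 2 + d * (⟪φ, Matrix.toEuclideanLin M φ⟫_ℂ).re := by
  rw [map_add, map_smul, map_smul, Matrix.toLpLin_one]
  simp only [LinearMap.add_apply, LinearMap.smul_apply, LinearMap.id_apply, inner_add_right,
    inner_smul_right, Complex.add_re, Complex.re_ofReal_mul]
  rw [inner_self_eq_norm_sq_to_K]
  norm_cast

section Step

variable {ι : Type*} [Fintype ι] [DecidableEq ι] {m : ℕ}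

theorem IsReflection.kronecker_map_star {A : Matrix ι ι ℂ} (hA : IsReflection A) :
    IsReflection (A ⊗ₖ A.map star) := by
  constructor
  · rw [Matrix.IsHermitian, Matrix.conjTranspose_kronecker, hA.1.eq, hA.map_star.1.eq]
  · rw [← Matrix.mul_kronecker_mul, hA.2, hA.map_star.2, Matrix.one_kronecker_one]

theorem norm_reflection {A : Matrix ι ι ℂ} (hA : IsReflection A) (φ : EuclideanSpace ℂ ι) :
    ‖Matrix.toEuclideanLin A φ‖ = ‖φ‖ :=
  norm_toEuclideanLin_isometry (by rw [hA.1.eq, hA.2]) φ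

theorem norm_sum_reflections_le {κ : Type*} [Fintype κ] [DecidableEq κ] {B : Fin m → Matrix κ κ ℂ}
    (hB : ∀ i, IsReflection (B i)) (φ : EuclideanSpace ℂ κ) :
    ‖Matrix.toEuclideanLin (∑ i, B i) φ‖ ≤ m * ‖φ‖ := by
  rw [map_sum, LinearMap.sum_apply]
  refine (norm_sum_le _ _).trans ?_
  simp [norm_reflection (hB _)]

theorem stepAverage_isHermitian {A : Fin m → Matrix ι ι ℂ} (hA : ∀ i, IsReflection (A i))
    (ε : ℝ) : (stepAverage A ε).IsHermitian := by
  have hs : ∀ r : ℝ, star (r : ℂ) = r := fun r => Complex.conj_ofReal r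
  rw [stepAverage, Matrix.IsHermitian, Matrix.conjTranspose_add, Matrix.conjTranspose_smul,
    Matrix.conjTranspose_smul, Matrix.conjTranspose_one, Matrix.conjTranspose_sum, hs, hs]
  congr 2
  exact Finset.sum_congr rfl fun i _ => (hA i).kronecker_map_star.1.eq

theorem norm_stepAverage_le (hm : 0 < m) {A : Fin m → Matrix ι ι ℂ}
    (hA : ∀ i, IsReflection (A i)) (ε : ℝ) (φ : EuclideanSpace ℂ (ι × ι)) :
    ‖Matrix.toEuclideanLin (stepAverage A ε) φ‖ ≤ ‖φ‖ := by
  have hm' : (0 : ℝ) < m := by exact_mod_cast hm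
  rw [stepAverage, map_add, map_smul, map_smul, Matrix.toLpLin_one, LinearMap.add_apply,
    LinearMap.smul_apply, LinearMap.smul_apply, LinearMap.id_apply]
  refine (norm_add_le _ _).trans ?_
  rw [norm_smul, norm_smul, Complex.norm_real, Complex.norm_real,
    Real.norm_of_nonneg (by positivity), Real.norm_of_nonneg (by positivity)]
  have h := norm_sum_reflections_le (fun i => (hA i).kronecker_map_star) φ
  calc _ ≤ Real.cos ε ^ 2 * ‖φ‖ + Real.sin ε ^ 2 / m * (m * ‖φ‖) := by gcongr
    _ = (Real.sin ε ^ 2 + Real.cos ε ^ 2) * ‖φ‖ := by field_simp; ring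
    _ = ‖φ‖ := by rw [Real.sin_sq_add_cos_sq, one_mul]

/-- The average of the reflections A_i ⊗ conj A_i is at least −1. -/
theorem stepAverage_form_ge (hm : 0 < m) {A : Fin m → Matrix ι ι ℂ}
    (hA : ∀ i, IsReflection (A i)) (ε : ℝ) (φ : EuclideanSpace ℂ (ι × ι)) :
    (Real.cos ε ^ 2 - Real.sin ε ^ 2) * ‖φ‖ ^ 2 ≤
      (⟪φ, Matrix.toEuclideanLin (stepAverage A ε) φ⟫_ℂ).re := by
  have hm' : (0 : ℝ) < m := by exact_mod_cast hm
  rw [stepAverage, inner_one_smul_add]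
  have h1 : -(m * ‖φ‖ ^ 2) ≤
      (⟪φ, Matrix.toEuclideanLin (∑ i, A i ⊗ₖ (A i).map star) φ⟫_ℂ).re := by
    have h := norm_sum_reflections_le (fun i => (hA i).kronecker_map_star) φ
    have h2 := (Complex.abs_re_le_norm _).trans (norm_inner_le_norm (𝕜 := ℂ) φ
      (Matrix.toEuclideanLin (∑ i, A i ⊗ₖ (A i).map star) φ))
    have h3 := mul_le_mul_of_nonneg_left h (norm_nonneg φ)
    have := (abs_le.1 h2).1
    linarith
  have h2 := mul_le_mul_of_nonneg_left h1 (by positivity : 0 ≤ Real.sin ε ^ 2 / m)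
  have h3 : Real.sin ε ^ 2 / m * -(m * ‖φ‖ ^ 2) = -(Real.sin ε ^ 2 * ‖φ‖ ^ 2) := by field_simp
  rw [h3] at h2
  linarith

end Step

/-! ### Restriction to the energy window -/

/-- The inclusion of `ℂ^{W × W}` into `ℂ^{ι × ι}` along `e : W → ι`. -/
def windowInclusion {ι W : Type*} [DecidableEq ι] (e : W → ι) : Matrix (ι × ι) (W × W) ℂ :=
  Matrix.of fun p w => if p = (e w.1, e w.2) then 1 else 0

section Window

variable {ι W : Type*} [Fintype ι] [DecidableEq ι] [Fintype W] [DecidableEq W] {e : W → ι}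

theorem windowInclusion_compress (M : Matrix (ι × ι) (ι × ι) ℂ) :
    (windowInclusion e).conjTranspose * M * windowInclusion e =
      M.submatrix (Prod.map e e) (Prod.map e e) := by
  ext x y
  rw [Matrix.mul_apply, Finset.sum_eq_single (e y.1, e y.2)]
  · rw [Matrix.mul_apply, Finset.sum_eq_single (e x.1, e x.2)]
    · simp [windowInclusion, Prod.map]
    · intro p _ hp; simp [windowInclusion, hp]
    · simp
  · intro p _ hp; simp [windowInclusion, hp]
  · simp

theorem windowInclusion_isometry (he : Function.Injective e) :
    (windowInclusion e).conjTranspose * windowInclusion e = 1 := by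
  have h := windowInclusion_compress (e := e) 1
  rw [Matrix.mul_one] at h
  rw [h, Matrix.submatrix_one]
  exact he.prodMap he

theorem stepAverage_submatrix (he : Function.Injective e) {m : ℕ} (A : Fin m → Matrix ι ι ℂ)
    (ε : ℝ) :
    (windowInclusion e).conjTranspose * stepAverage A ε * windowInclusion e =
      stepAverage (fun i => (A i).submatrix e e) ε := by
  rw [windowInclusion_compress]
  ext x y
  simp only [stepAverage, Matrix.submatrix_apply, Matrix.add_apply, Matrix.smul_apply,
    Matrix.sum_apply, Matrix.kroneckerMap_apply, Matrix.map_apply, Prod.map_fst, Prod.map_snd]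
  congr 2
  rw [Matrix.one_apply, Matrix.one_apply]
  simp [(he.prodMap he).eq_iff]

theorem windowInclusion_apply (he : Function.Injective e) (φ : EuclideanSpace ℂ (W × W))
    (w : W × W) :
    Matrix.toEuclideanLin (windowInclusion e) φ (e w.1, e w.2) = φ w := by
  simp only [Matrix.toLpLin_apply, Matrix.mulVec, dotProduct, windowInclusion, Matrix.of_apply]
  rw [Finset.sum_eq_single w]
  · simp
  · intro y _ hy
    rw [if_neg, zero_mul]
    intro h
    apply hy
    rw [Prod.mk.injEq] at h
    exact Prod.ext (he h.1.symm) (he h.2.symm)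
  · simp

theorem windowInclusion_apply_of_notMem (φ : EuclideanSpace ℂ (W × W)) {p : ι × ι}
    (hp : p.1 ∉ Set.range e ∨ p.2 ∉ Set.range e) :
    Matrix.toEuclideanLin (windowInclusion e) φ p = 0 := by
  simp only [Matrix.toLpLin_apply, Matrix.mulVec, dotProduct, windowInclusion, Matrix.of_apply]
  refine Finset.sum_eq_zero fun w _ => ?_
  rw [if_neg, zero_mul]
  rintro rfl
  simp at hp

end Window

/-- On the window, the averaged operator `∑ a_i ⊗ conj a_i / m` is, up to `δ`, the scalar `μ₂` plus
the kernel `B` on the span of the vectors `|αα⟩`. -/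
def WindowForm {W : Type*} [Fintype W] [DecidableEq W] {m : ℕ} (a : Fin m → Matrix W W ℂ)
    (B : W → W → ℝ) (μ₂ δ : ℝ) : Prop :=
  ∀ φ : EuclideanSpace ℂ (W × W),
    |1 / (m : ℝ) * (⟪φ, Matrix.toEuclideanLin (∑ i, a i ⊗ₖ (a i).map star) φ⟫_ℂ).re -
      (μ₂ * ‖φ‖ ^ 2 + (∑ α, ∑ β, (B α β : ℂ) * (star (φ (α, α)) * φ (β, β))).re)| ≤ δ * ‖φ‖ ^ 2

theorem WindowForm.stepAverage {W : Type*} [Fintype W] [DecidableEq W] {m : ℕ}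
    {a : Fin m → Matrix W W ℂ} {B : W → W → ℝ} {μ₂ δ : ℝ} (h : WindowForm a B μ₂ δ) (ε : ℝ)
    (φ : EuclideanSpace ℂ (W × W)) :
    |(⟪φ, Matrix.toEuclideanLin (stepAverage a ε) φ⟫_ℂ).re - (Real.cos ε ^ 2 * ‖φ‖ ^ 2 +
      Real.sin ε ^ 2 * (μ₂ * ‖φ‖ ^ 2 +
        (∑ α, ∑ β, (B α β : ℂ) * (star (φ (α, α)) * φ (β, β))).re))| ≤
      Real.sin ε ^ 2 * (δ * ‖φ‖ ^ 2) := by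
  rw [EnergyTest.stepAverage, inner_one_smul_add]
  have h1 := mul_le_mul_of_nonneg_left (h φ) (sq_nonneg (Real.sin ε))
  refine le_trans (le_of_eq ?_) h1
  rw [← abs_of_nonneg (sq_nonneg (Real.sin ε)), ← abs_mul, abs_of_nonneg (sq_nonneg (Real.sin ε))]
  congr 1; ring

/-- The averaged step between two energy checks, in the energy eigenbasis. -/
def filteredStep {ι : Type*} [Fintype ι] [DecidableEq ι] {m : ℕ} (q : ι → ℝ)
    (A : Fin m → Matrix ι ι ℂ) (ε : ℝ) : Matrix (ι × ι) (ι × ι) ℂ :=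
  Matrix.diagonal (fun p => ((q p.1 * q p.2 : ℝ) : ℂ)) * stepAverage A ε *
    Matrix.diagonal (fun p => ((q p.1 * q p.2 : ℝ) : ℂ))

theorem conjTranspose_diagonal_ofReal {κ : Type*} [DecidableEq κ] (d : κ → ℝ) :
    (Matrix.diagonal fun p => (d p : ℂ)).conjTranspose = Matrix.diagonal fun p => (d p : ℂ) := by
  rw [Matrix.diagonal_conjTranspose]; congr 1; funext p; simp

theorem inner_filteredStep {ι : Type*} [Fintype ι] [DecidableEq ι] {m : ℕ} (q : ι → ℝ)
    (A : Fin m → Matrix ι ι ℂ) (ε : ℝ) (ψ : EuclideanSpace ℂ (ι × ι)) :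
    ⟪ψ, Matrix.toEuclideanLin (filteredStep q A ε) ψ⟫_ℂ =
      ⟪Matrix.toEuclideanLin (Matrix.diagonal fun p => ((q p.1 * q p.2 : ℝ) : ℂ)) ψ,
        Matrix.toEuclideanLin (stepAverage A ε)
          (Matrix.toEuclideanLin (Matrix.diagonal fun p => ((q p.1 * q p.2 : ℝ) : ℂ)) ψ)⟫_ℂ := by
  rw [filteredStep, Matrix.mul_assoc, toEuclideanLin_mul_apply, inner_toEuclideanLin,
    toEuclideanLin_mul_apply, conjTranspose_diagonal_ofReal]

theorem filteredStep_isHermitian {ι : Type*} [Fintype ι] [DecidableEq ι] {m : ℕ} (q : ι → ℝ)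
    {A : Fin m → Matrix ι ι ℂ} (hA : ∀ i, IsReflection (A i)) (ε : ℝ) :
    (filteredStep q A ε).IsHermitian := by
  rw [filteredStep, Matrix.IsHermitian, Matrix.conjTranspose_mul, Matrix.conjTranspose_mul,
    conjTranspose_diagonal_ofReal, (stepAverage_isHermitian hA ε).eq, Matrix.mul_assoc]

/-- Acceptance is ‖Xψ‖², which a negative eigenvalue of large modulus could raise although the form
of X is small. Positivity excludes this. -/
theorem filteredStep_form_nonneg {ι : Type*} [Fintype ι] [DecidableEq ι] {m : ℕ} (hm : 0 < m)
    (q : ι → ℝ) {A : Fin m → Matrix ι ι ℂ} (hA : ∀ i, IsReflection (A i)) {ε : ℝ}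
    (hε : Real.sin ε ^ 2 ≤ 1 / 2) (ψ : EuclideanSpace ℂ (ι × ι)) :
    0 ≤ (⟪ψ, Matrix.toEuclideanLin (filteredStep q A ε) ψ⟫_ℂ).re := by
  rw [inner_filteredStep]
  refine le_trans ?_ (stepAverage_form_ge hm hA ε _)
  have := Real.sin_sq_add_cos_sq ε
  exact mul_nonneg (by linarith) (sq_nonneg _)

theorem norm_diagonal_le {κ : Type*} [Fintype κ] [DecidableEq κ] {d : κ → ℝ} {r : ℝ} (hr : 0 ≤ r)
    (hd : ∀ p, |d p| ≤ r) (ψ : EuclideanSpace ℂ κ) :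
    ‖Matrix.toEuclideanLin (Matrix.diagonal fun p => (d p : ℂ)) ψ‖ ≤ r * ‖ψ‖ := by
  have h : ‖Matrix.toEuclideanLin (Matrix.diagonal fun p => (d p : ℂ)) ψ‖ ^ 2 ≤ (r * ‖ψ‖) ^ 2 := by
    rw [mul_pow, EuclideanSpace.norm_sq_eq, EuclideanSpace.norm_sq_eq, Finset.mul_sum]
    refine Finset.sum_le_sum fun p _ => ?_
    have : (Matrix.toEuclideanLin (Matrix.diagonal fun p => (d p : ℂ)) ψ) p = d p * ψ p := by
      simp [Matrix.mulVec_diagonal]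
    rw [this, norm_mul, mul_pow, Complex.norm_real, Real.norm_eq_abs]
    have := hd p
    gcongr
  exact (sq_le_sq₀ (norm_nonneg _) (by positivity)).1 h

open scoped InnerProductSpace

/-! ### The two largest eigenvalues of the filtered step -/

section TwoEigenvalues

variable {ι W : Type*} [Fintype ι] [DecidableEq ι] [Fintype W] [DecidableEq W]

theorem sum_norm_sq_diag_le (φ : EuclideanSpace ℂ (W × W)) :
    ∑ α, ‖φ (α, α)‖ ^ 2 ≤ ‖φ‖ ^ 2 := by
  rw [EuclideanSpace.norm_sq_eq, Fintype.sum_prod_type]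
  exact Finset.sum_le_sum fun α _ =>
    Finset.single_le_sum (f := fun β => ‖φ (α, β)‖ ^ 2) (fun β _ => sq_nonneg _) (Finset.mem_univ α)

theorem inner_windowInclusion_conjTranspose (e : W → ι) (x : EuclideanSpace ℂ (W × W))
    (y : EuclideanSpace ℂ (ι × ι)) :
    ⟪x, Matrix.toEuclideanLin (windowInclusion e).conjTranspose y⟫_ℂ =
      ⟪Matrix.toEuclideanLin (windowInclusion e) x, y⟫_ℂ := by
  rw [inner_toEuclideanLin, Matrix.conjTranspose_conjTranspose]

theorem norm_windowInclusion_conjTranspose_le {e : W → ι} (he : Function.Injective e)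
    (φ : EuclideanSpace ℂ (ι × ι)) :
    ‖Matrix.toEuclideanLin (windowInclusion e).conjTranspose φ‖ ≤ ‖φ‖ := by
  set x := Matrix.toEuclideanLin (windowInclusion e).conjTranspose φ with hx
  have h1 : ‖x‖ ^ 2 ≤ ‖x‖ * ‖φ‖ := by
    have h2 : (⟪x, x⟫_ℂ) = ⟪Matrix.toEuclideanLin (windowInclusion e) x, φ⟫_ℂ := by
      nth_rewrite 2 [hx]
      rw [inner_toEuclideanLin, Matrix.conjTranspose_conjTranspose]
    have h3 := norm_inner_le_norm (𝕜 := ℂ) (Matrix.toEuclideanLin (windowInclusion e) x) φ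
    rw [← h2, norm_toEuclideanLin_isometry (windowInclusion_isometry he),
      inner_self_eq_norm_sq_to_K] at h3
    simpa using h3
  rcases (norm_nonneg x).eq_or_lt with h | h
  · rw [← h]; exact norm_nonneg _
  · rw [sq] at h1; exact le_of_mul_le_mul_left h1 h

theorem windowInclusion_conjTranspose_apply {e : W → ι} (φ : EuclideanSpace ℂ (ι × ι)) (w : W × W) :
    Matrix.toEuclideanLin (windowInclusion e).conjTranspose φ w = φ (e w.1, e w.2) := by
  simp only [Matrix.toLpLin_apply, Matrix.mulVec, dotProduct, Matrix.conjTranspose_apply,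
    windowInclusion, Matrix.of_apply]
  rw [Finset.sum_eq_single (e w.1, e w.2)]
  · simp
  · intro p _ hp; simp [hp]
  · simp

/-- The filtered vector is split into its window part and a remainder of norm at most τ‖ψ‖, since
outside the window at least one of the two factors q is at most τ. The weights q² in the condition
on ψ make the diagonal of the filtered vector orthogonal to v, where the kernel has its gap. The two
cross terms cost 2τ. -/
theorem filteredStep_form_le {m : ℕ} (hm : 0 < m) {e : W → ι} (he : Function.Injective e)
    {q : ι → ℝ} (hq0 : ∀ x, 0 ≤ q x) (hq1 : ∀ x, q x ≤ 1) {τ : ℝ} (hτ0 : 0 ≤ τ)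
    (hout : ∀ x, x ∉ Set.range e → q x ≤ τ) {A : Fin m → Matrix ι ι ℂ}
    (hA : ∀ i, IsReflection (A i)) {B : W → W → ℝ} {μ₂ δ : ℝ} (hμ : 0 ≤ μ₂) (hδ : 0 ≤ δ)
    (hform : WindowForm (fun i => (A i).submatrix e e) B μ₂ δ) {v : W → ℝ} {k : ℝ} (hk : 0 ≤ k)
    (hgap : ∀ x : W → ℂ, ∑ α, (v α : ℂ) * x α = 0 →
      (∑ α, ∑ β, (B α β : ℂ) * (star (x α) * x β)).re ≤ k * ∑ α, ‖x α‖ ^ 2) (ε : ℝ)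
    {ψ : EuclideanSpace ℂ (ι × ι)}
    (hψ : ∑ α, (v α : ℂ) * (((q (e α) * q (e α) : ℝ) : ℂ) * ψ (e α, e α)) = 0) :
    (⟪ψ, Matrix.toEuclideanLin (filteredStep q A ε) ψ⟫_ℂ).re ≤
      (Real.cos ε ^ 2 + Real.sin ε ^ 2 * (μ₂ + k + δ) + 3 * τ) * ‖ψ‖ ^ 2 := by
  rw [inner_filteredStep]
  set φ := Matrix.toEuclideanLin (Matrix.diagonal fun p : ι × ι => ((q p.1 * q p.2 : ℝ) : ℂ)) ψ
    with hφ
  set T := Matrix.toEuclideanLin (stepAverage A ε) with hT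
  set φW := Matrix.toEuclideanLin (windowInclusion e).conjTranspose φ with hφW
  set φ₁ := Matrix.toEuclideanLin (windowInclusion e) φW with hφ₁
  set φ₂ := φ - φ₁ with hφ₂
  have hφp : ∀ p, φ p = ((q p.1 * q p.2 : ℝ) : ℂ) * ψ p := by
    intro p; simp [hφ, Matrix.mulVec_diagonal]
  have hφn : ‖φ‖ ≤ ‖ψ‖ := by
    have := norm_diagonal_le zero_le_one (d := fun p : ι × ι => q p.1 * q p.2) (by
      intro p
      rw [abs_of_nonneg (mul_nonneg (hq0 _) (hq0 _))]
      exact mul_le_one₀ (hq1 _) (hq0 _) (hq1 _)) ψ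
    rw [one_mul] at this; exact this
  have hφWn : ‖φW‖ ≤ ‖ψ‖ := (norm_windowInclusion_conjTranspose_le he φ).trans hφn
  have hφ₁n : ‖φ₁‖ = ‖φW‖ := norm_toEuclideanLin_isometry (windowInclusion_isometry he) φW
  have hφ₂n : ‖φ₂‖ ≤ τ * ‖ψ‖ := by
    classical
    set d : ι × ι → ℝ := fun p => if p.1 ∈ Set.range e ∧ p.2 ∈ Set.range e then 0
      else q p.1 * q p.2 with hd
    have : φ₂ = Matrix.toEuclideanLin (Matrix.diagonal fun p => (d p : ℂ)) ψ := by
      ext p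
      have h1 : (Matrix.toEuclideanLin (Matrix.diagonal fun p => (d p : ℂ)) ψ) p = d p * ψ p := by
        simp [Matrix.mulVec_diagonal]
      rw [h1, hφ₂, PiLp.sub_apply]
      by_cases hp : p.1 ∈ Set.range e ∧ p.2 ∈ Set.range e
      · obtain ⟨⟨α, hα⟩, ⟨β, hβ⟩⟩ := hp
        have hp' : p = (e (α, β).1, e (α, β).2) := Prod.ext hα.symm hβ.symm
        have h2 : d p = 0 := by rw [hd]; simp only; rw [if_pos ⟨⟨α, hα⟩, ⟨β, hβ⟩⟩]
        rw [h2, hφ₁, hp', windowInclusion_apply he, hφW, windowInclusion_conjTranspose_apply]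
        simp
      · have h2 : d p = q p.1 * q p.2 := by rw [hd]; simp only; rw [if_neg hp]
        rw [h2, hφ₁, windowInclusion_apply_of_notMem _ (by tauto), sub_zero, hφp]
    rw [this]
    refine norm_diagonal_le hτ0 (fun p => ?_) ψ
    rw [hd]
    simp only
    split_ifs with hp
    · simpa using hτ0
    · rw [abs_of_nonneg (mul_nonneg (hq0 _) (hq0 _))]
      rw [not_and_or] at hp
      rcases hp with h | h
      · calc q p.1 * q p.2 ≤ τ * 1 := mul_le_mul (hout _ h) (hq1 _) (hq0 _) hτ0
          _ = τ := mul_one τ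
      · calc q p.1 * q p.2 ≤ 1 * τ := mul_le_mul (hq1 _) (hout _ h) (hq0 _) zero_le_one
          _ = τ := one_mul τ
  have hTn : ∀ x y, (⟪x, T y⟫_ℂ).re ≤ ‖x‖ * ‖y‖ := by
    intro x y
    refine (Complex.re_le_norm _).trans ((norm_inner_le_norm _ _).trans ?_)
    exact mul_le_mul_of_nonneg_left (norm_stepAverage_le hm hA ε y) (norm_nonneg _)
  have hsplit : (⟪φ, T φ⟫_ℂ).re = (⟪φ₁, T φ₁⟫_ℂ).re + (⟪φ₁, T φ₂⟫_ℂ).re + (⟪φ₂, T φ⟫_ℂ).re := by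
    have h1 : φ = φ₁ + φ₂ := by rw [hφ₂]; abel
    have h2 : ⟪φ, T φ⟫_ℂ = ⟪φ₁, T φ⟫_ℂ + ⟪φ₂, T φ⟫_ℂ := by
      rw [← inner_add_left, ← h1]
    have h3 : ⟪φ₁, T φ⟫_ℂ = ⟪φ₁, T φ₁⟫_ℂ + ⟪φ₁, T φ₂⟫_ℂ := by
      rw [← inner_add_right, ← map_add, ← h1]
    rw [h2, h3, Complex.add_re, Complex.add_re]
  have hmain : (⟪φ₁, T φ₁⟫_ℂ).re ≤
      (Real.cos ε ^ 2 + Real.sin ε ^ 2 * (μ₂ + k + δ)) * ‖ψ‖ ^ 2 := by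
    have h1 : ⟪φ₁, T φ₁⟫_ℂ =
        ⟪φW, Matrix.toEuclideanLin (stepAverage (fun i => (A i).submatrix e e) ε) φW⟫_ℂ := by
      rw [← stepAverage_submatrix he, Matrix.mul_assoc, toEuclideanLin_mul_apply,
        toEuclideanLin_mul_apply, inner_windowInclusion_conjTranspose]
    rw [h1]
    have h2 := (abs_le.1 (hform.stepAverage ε φW)).2
    have h3 := hgap (fun α => φW (α, α)) (by
      rw [← hψ]
      refine Finset.sum_congr rfl fun α _ => ?_
      rw [hφW, windowInclusion_conjTranspose_apply, hφp])
    have h4 := sum_norm_sq_diag_le φW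
    have h5 : ‖φW‖ ^ 2 ≤ ‖ψ‖ ^ 2 := pow_le_pow_left₀ (norm_nonneg _) hφWn 2
    have h6 := mul_le_mul_of_nonneg_left h4 hk
    have h7 := mul_le_mul_of_nonneg_left (h3.trans h6) (sq_nonneg (Real.sin ε))
    have h8 : 0 ≤ Real.cos ε ^ 2 + Real.sin ε ^ 2 * (μ₂ + k + δ) := by positivity
    have h9 := mul_le_mul_of_nonneg_left h5 h8
    linarith
  have h1 := hTn φ₁ φ₂
  have h2 := hTn φ₂ φ
  have h3 : ‖φ₁‖ * ‖φ₂‖ ≤ ‖ψ‖ * (τ * ‖ψ‖) :=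
    mul_le_mul (hφ₁n.le.trans hφWn) hφ₂n (norm_nonneg _) (norm_nonneg _)
  have h4 : ‖φ₂‖ * ‖φ‖ ≤ τ * ‖ψ‖ * ‖ψ‖ :=
    mul_le_mul hφ₂n hφn (norm_nonneg _) (by positivity)
  have h5 : 0 ≤ τ * ‖ψ‖ ^ 2 := by positivity
  rw [hsplit]
  linarith

/-- The vector `∑ v_α |αα⟩`. -/
def diagVec (v : W → ℝ) : EuclideanSpace ℂ (W × W) :=
  WithLp.toLp 2 fun w => if w.1 = w.2 then (v w.1 : ℂ) else 0

theorem norm_sq_diagVec (v : W → ℝ) : ‖diagVec v‖ ^ 2 = ∑ α, v α ^ 2 := by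
  rw [EuclideanSpace.norm_sq_eq, Fintype.sum_prod_type]
  refine Finset.sum_congr rfl fun α _ => ?_
  rw [Finset.sum_eq_single α]
  · simp [diagVec]
  · intro β _ hβ; simp [diagVec, hβ.symm]
  · simp

/-- The trial vector is ∑ v_α |αα⟩. The filter multiplies v_α by q_α², which is nearly 1 except on
the bad set, where v has weight at most σ. Both the norm and the kernel form lose at most 4τ + 2σ,
and the coefficients cos²ε, μ₂ sin²ε and sin²ε add up to at most 7. -/
theorem filteredStep_form_ge {m : ℕ} {e : W → ι} (he : Function.Injective e)
    {q : ι → ℝ} (hq0 : ∀ x, 0 ≤ q x) (hq1 : ∀ x, q x ≤ 1) {τ σ : ℝ} (hτ0 : 0 ≤ τ) (hτ1 : 4 * τ ≤ 1)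
    {bad : Finset W} (hgood : ∀ α, α ∉ bad → 1 - τ ≤ q (e α)) {A : Fin m → Matrix ι ι ℂ}
    {B : W → W → ℝ} (hB0 : ∀ α β, 0 ≤ B α β) (hBs : ∀ α β, B α β = B β α)
    {μ₂ δ : ℝ} (hμ : 0 ≤ μ₂) (hμ' : μ₂ ≤ 6) (hδ : 0 ≤ δ)
    (hform : WindowForm (fun i => (A i).submatrix e e) B μ₂ δ) {v : W → ℝ} {l : ℝ}
    (hl0 : 0 ≤ l) (hl1 : l ≤ 1) (hv0 : ∀ α, 0 ≤ v α) (hv1 : ∑ α, v α ^ 2 = 1)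
    (hBv : ∀ α, ∑ β, B α β * v β = l * v α) (hbad : ∑ α ∈ bad, v α ^ 2 ≤ σ) (ε : ℝ) :
    Real.cos ε ^ 2 + Real.sin ε ^ 2 * (μ₂ + l) - (32 * τ + 14 * σ) - Real.sin ε ^ 2 * δ ≤
      (⟪Matrix.toEuclideanLin (windowInclusion e) (diagVec v),
        Matrix.toEuclideanLin (filteredStep q A ε)
          (Matrix.toEuclideanLin (windowInclusion e) (diagVec v))⟫_ℂ).re := by
  classical
  set w : W → ℝ := fun α => q (e α) ^ 2 with hw
  have hw0 : ∀ α, 0 ≤ w α := fun α => sq_nonneg _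
  have hw1 : ∀ α, w α ≤ 1 := fun α => pow_le_one₀ (hq0 _) (hq1 _)
  set b : W → ℝ := fun α => if α ∈ bad then 1 else 0 with hb
  have hb0 : ∀ α, 0 ≤ b α := fun α => by simp only [hb]; split_ifs <;> norm_num
  have hbv : ∑ α, b α * v α ^ 2 ≤ σ := by
    refine le_trans (le_of_eq ?_) hbad
    simp [hb, Finset.sum_ite_mem]
  -- This lower bound is linear in the indicator b of the bad set, so after weighting by B only row
  -- sums against v occur, and these are known from the eigenvector equation. Off the bad set it is
  -- (1 − τ)⁴ ≥ 1 − 4τ.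
  have hww : ∀ α β, (1 - 4 * τ) * (1 - b α - b β) ≤ w α * w β := by
    intro α β
    by_cases h : α ∈ bad ∨ β ∈ bad
    · have : 1 - b α - b β ≤ 0 := by
        rcases h with h | h
        · have : b α = 1 := by simp [hb, h]
          linarith [hb0 β]
        · have : b β = 1 := by simp [hb, h]
          linarith [hb0 α]
      have h2 : (1 - 4 * τ) * (1 - b α - b β) ≤ 0 :=
        mul_nonpos_of_nonneg_of_nonpos (by linarith) this
      exact h2.trans (mul_nonneg (hw0 α) (hw0 β))
    · rw [not_or] at h
      have h1 : b α = 0 := by simp [hb, h.1]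
      have h2 : b β = 0 := by simp [hb, h.2]
      rw [h1, h2, sub_zero, sub_zero, mul_one]
      have h3 : 1 - 2 * τ ≤ w α := by
        have := hgood α h.1
        have : (1 - τ) ^ 2 ≤ w α := pow_le_pow_left₀ (by linarith) this 2
        nlinarith [sq_nonneg τ]
      have h4 : 1 - 2 * τ ≤ w β := by
        have := hgood β h.2
        have : (1 - τ) ^ 2 ≤ w β := pow_le_pow_left₀ (by linarith) this 2
        nlinarith [sq_nonneg τ]
      calc 1 - 4 * τ ≤ (1 - 2 * τ) * (1 - 2 * τ) := by nlinarith [sq_nonneg τ]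
        _ ≤ w α * w β := mul_le_mul h3 h4 (by linarith) (hw0 α)
  rw [inner_filteredStep]
  set u : W → ℝ := fun α => w α * v α with hu
  have hK : Matrix.toEuclideanLin (Matrix.diagonal fun p : ι × ι => ((q p.1 * q p.2 : ℝ) : ℂ))
      (Matrix.toEuclideanLin (windowInclusion e) (diagVec v)) =
      Matrix.toEuclideanLin (windowInclusion e) (diagVec u) := by
    ext p
    have h1 : ∀ x : EuclideanSpace ℂ (ι × ι), (Matrix.toEuclideanLin
        (Matrix.diagonal fun p : ι × ι => ((q p.1 * q p.2 : ℝ) : ℂ)) x) p =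
        ((q p.1 * q p.2 : ℝ) : ℂ) * x p := by
      intro x; simp [Matrix.mulVec_diagonal]
    rw [h1]
    by_cases hp : p.1 ∈ Set.range e ∧ p.2 ∈ Set.range e
    · obtain ⟨⟨α, hα⟩, ⟨β, hβ⟩⟩ := hp
      have hp' : p = (e (α, β).1, e (α, β).2) := Prod.ext hα.symm hβ.symm
      rw [hp', windowInclusion_apply he, windowInclusion_apply he]
      by_cases h : α = β
      · subst h
        simp only [diagVec, if_true, hu, hw]
        push_cast; ring
      · simp [diagVec, h]
    · rw [windowInclusion_apply_of_notMem _ (by tauto),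
        windowInclusion_apply_of_notMem _ (by tauto), mul_zero]
  rw [hK]
  have h1 : ⟪Matrix.toEuclideanLin (windowInclusion e) (diagVec u),
      Matrix.toEuclideanLin (stepAverage A ε)
        (Matrix.toEuclideanLin (windowInclusion e) (diagVec u))⟫_ℂ =
      ⟪diagVec u, Matrix.toEuclideanLin (stepAverage (fun i => (A i).submatrix e e) ε)
        (diagVec u)⟫_ℂ := by
    rw [← stepAverage_submatrix he, Matrix.mul_assoc, toEuclideanLin_mul_apply,
      toEuclideanLin_mul_apply, inner_windowInclusion_conjTranspose]
  rw [h1]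
  have h2 := (abs_le.1 (hform.stepAverage ε (diagVec u))).1
  have hsum : (∑ α, ∑ β, (B α β : ℂ) * (star (diagVec u (α, α)) * diagVec u (β, β))).re =
      ∑ α, ∑ β, B α β * (u α * u β) := by
    rw [Complex.re_sum]
    refine Finset.sum_congr rfl fun α _ => ?_
    rw [Complex.re_sum]
    refine Finset.sum_congr rfl fun β _ => ?_
    have : (B α β : ℂ) * (star (diagVec u (α, α)) * diagVec u (β, β)) =
        ((B α β * (u α * u β) : ℝ) : ℂ) := by simp [diagVec]
    rw [this, Complex.ofReal_re]
  rw [hsum, norm_sq_diagVec] at h2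
  have hn1 : 1 - (4 * τ + 2 * σ) ≤ ∑ α, u α ^ 2 := by
    have h3 : ∀ α, (1 - 4 * τ) * (1 - b α - b α) * v α ^ 2 ≤ u α ^ 2 := by
      intro α
      calc _ ≤ w α * w α * v α ^ 2 := mul_le_mul_of_nonneg_right (hww α α) (sq_nonneg _)
        _ = _ := by rw [hu]; ring
    have h4 : ∑ α, (1 - 4 * τ) * (1 - b α - b α) * v α ^ 2 =
        (1 - 4 * τ) * (1 - 2 * ∑ α, b α * v α ^ 2) := by
      calc _ = (1 - 4 * τ) * (∑ α, v α ^ 2 - 2 * ∑ α, b α * v α ^ 2) := by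
            rw [Finset.mul_sum, ← Finset.sum_sub_distrib, Finset.mul_sum]
            exact Finset.sum_congr rfl fun α _ => by ring
        _ = _ := by rw [hv1]
    have h5 := Finset.sum_le_sum fun α (_ : α ∈ Finset.univ) => h3 α
    rw [h4] at h5
    have h6 : 0 ≤ ∑ α, b α * v α ^ 2 := Finset.sum_nonneg fun α _ =>
      mul_nonneg (hb0 α) (sq_nonneg _)
    nlinarith
  have hn2 : ∑ α, u α ^ 2 ≤ 1 := by
    rw [← hv1]
    refine Finset.sum_le_sum fun α _ => ?_
    rw [hu]; simp only; rw [mul_pow]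
    exact mul_le_of_le_one_left (sq_nonneg _) (pow_le_one₀ (hw0 α) (hw1 α))
  have hn3 : l - (4 * τ + 2 * σ) ≤ ∑ α, ∑ β, B α β * (u α * u β) := by
    have h3 : ∀ α β, (1 - 4 * τ) * (1 - b α - b β) * (B α β * (v α * v β)) ≤
        B α β * (u α * u β) := by
      intro α β
      calc _ ≤ w α * w β * (B α β * (v α * v β)) :=
            mul_le_mul_of_nonneg_right (hww α β)
              (mul_nonneg (hB0 α β) (mul_nonneg (hv0 α) (hv0 β)))
        _ = _ := by rw [hu]; ring
    have hrow : ∀ α, ∑ β, B α β * (v α * v β) = l * v α ^ 2 := by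
      intro α
      calc ∑ β, B α β * (v α * v β) = v α * ∑ β, B α β * v β := by
            rw [Finset.mul_sum]; exact Finset.sum_congr rfl fun β _ => by ring
        _ = _ := by rw [hBv]; ring
    have hcol : ∀ β, ∑ α, B α β * (v α * v β) = l * v β ^ 2 := by
      intro β
      rw [← hrow β]
      exact Finset.sum_congr rfl fun α _ => by rw [hBs α β]; ring
    have h4 : ∑ α, ∑ β, (1 - 4 * τ) * (1 - b α - b β) * (B α β * (v α * v β)) =
        (1 - 4 * τ) * (l - 2 * l * ∑ α, b α * v α ^ 2) := by
      have e1 : ∑ α, ∑ β, B α β * (v α * v β) = l := by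
        simp only [hrow, ← Finset.mul_sum, hv1, mul_one]
      have e2 : ∑ α, ∑ β, b α * (B α β * (v α * v β)) = l * ∑ α, b α * v α ^ 2 := by
        simp only [← Finset.mul_sum, hrow]
        rw [Finset.mul_sum]
        exact Finset.sum_congr rfl fun α _ => by ring
      have e3 : ∑ α, ∑ β, b β * (B α β * (v α * v β)) = l * ∑ α, b α * v α ^ 2 := by
        rw [Finset.sum_comm]
        simp only [← Finset.mul_sum, hcol]
        rw [Finset.mul_sum]
        exact Finset.sum_congr rfl fun α _ => by ring
      have e4 : ∀ α β, (1 - 4 * τ) * (1 - b α - b β) * (B α β * (v α * v β)) =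
          (1 - 4 * τ) * (B α β * (v α * v β) - b α * (B α β * (v α * v β)) -
            b β * (B α β * (v α * v β))) := fun α β => by ring
      simp only [e4, ← Finset.mul_sum, Finset.sum_sub_distrib]
      simp only [← Finset.mul_sum] at e2
      rw [e1, e2, e3]; ring
    have h5 := Finset.sum_le_sum fun α (_ : α ∈ Finset.univ) =>
      Finset.sum_le_sum fun β (_ : β ∈ Finset.univ) => h3 α β
    rw [h4] at h5
    have h6 : 0 ≤ ∑ α, b α * v α ^ 2 := Finset.sum_nonneg fun α _ =>
      mul_nonneg (hb0 α) (sq_nonneg _)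
    have h7 : l * ∑ α, b α * v α ^ 2 ≤ σ := by nlinarith
    have h8 : 0 ≤ l * ∑ α, b α * v α ^ 2 := mul_nonneg hl0 h6
    nlinarith
  have hs0 := sq_nonneg (Real.sin ε)
  have hc0 := sq_nonneg (Real.cos ε)
  have hcs := Real.sin_sq_add_cos_sq ε
  have hσ0 : 0 ≤ σ := le_trans (Finset.sum_nonneg fun α _ => sq_nonneg _) hbad
  have g1 := mul_le_mul_of_nonneg_left hn1 hc0
  have g2 := mul_le_mul_of_nonneg_left (mul_le_mul_of_nonneg_left hn1 hμ) hs0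
  have g3 := mul_le_mul_of_nonneg_left hn3 hs0
  have g4 := mul_le_mul_of_nonneg_left (mul_le_mul_of_nonneg_left hn2 hδ) hs0
  have g5 : Real.sin ε ^ 2 * (μ₂ * (4 * τ + 2 * σ)) ≤ Real.sin ε ^ 2 * (6 * (4 * τ + 2 * σ)) :=
    mul_le_mul_of_nonneg_left (mul_le_mul_of_nonneg_right hμ' (by positivity)) hs0
  have g6 : Real.sin ε ^ 2 ≤ 1 := by linarith
  have g7 : Real.sin ε ^ 2 * (4 * τ + 2 * σ) ≤ 4 * τ + 2 * σ :=
    mul_le_of_le_one_left (by positivity) g6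
  have g8 : Real.cos ε ^ 2 * (4 * τ + 2 * σ) = (4 * τ + 2 * σ) -
      Real.sin ε ^ 2 * (4 * τ + 2 * σ) := by
    rw [show Real.cos ε ^ 2 = 1 - Real.sin ε ^ 2 by linarith]; ring
  linarith

end TwoEigenvalues

open scoped InnerProductSpace

/-! ### The test in the energy eigenbasis -/

section Eigenbasis

variable {ι : Type*} [Fintype ι] [DecidableEq ι]

/-- The unitary whose columns are the vectors of the basis `ν`. -/
def basisMatrix (ν : OrthonormalBasis ι ℂ (EuclideanSpace ℂ ι)) : Matrix ι ι ℂ :=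
  Matrix.of fun i α => ν α i

theorem basisMatrix_conjTranspose_mul (ν : OrthonormalBasis ι ℂ (EuclideanSpace ℂ ι)) :
    (basisMatrix ν).conjTranspose * basisMatrix ν = 1 := by
  ext α β
  have h := orthonormal_iff_ite.1 ν.orthonormal α β
  rw [EuclideanSpace.inner_eq_star_dotProduct] at h
  rw [Matrix.one_apply, ← h, Matrix.mul_apply, dotProduct]
  refine Finset.sum_congr rfl fun i _ => ?_
  simp [basisMatrix, mul_comm]

theorem basisMatrix_mul_conjTranspose (ν : OrthonormalBasis ι ℂ (EuclideanSpace ℂ ι)) :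
    basisMatrix ν * (basisMatrix ν).conjTranspose = 1 :=
  mul_eq_one_comm.1 (basisMatrix_conjTranspose_mul ν)

/-- The matrix of `A` in the basis `ν`. -/
def inBasis (ν : OrthonormalBasis ι ℂ (EuclideanSpace ℂ ι)) (A : Matrix ι ι ℂ) : Matrix ι ι ℂ :=
  (basisMatrix ν).conjTranspose * A * basisMatrix ν

theorem inBasis_apply (ν : OrthonormalBasis ι ℂ (EuclideanSpace ℂ ι)) (A : Matrix ι ι ℂ)
    (α β : ι) : inBasis ν A α β = ⟪ν α, Matrix.toEuclideanLin A (ν β)⟫_ℂ := by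
  rw [EuclideanSpace.inner_eq_star_dotProduct, inBasis, Matrix.mul_assoc, Matrix.mul_apply,
    dotProduct]
  refine Finset.sum_congr rfl fun i _ => ?_
  rw [mul_comm]
  rfl

theorem IsReflection.inBasis (ν : OrthonormalBasis ι ℂ (EuclideanSpace ℂ ι)) {A : Matrix ι ι ℂ}
    (hA : IsReflection A) : IsReflection (inBasis ν A) := by
  constructor
  · rw [EnergyTest.inBasis, Matrix.IsHermitian, Matrix.conjTranspose_mul, Matrix.conjTranspose_mul,
      Matrix.conjTranspose_conjTranspose, hA.1.eq, Matrix.mul_assoc]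
  · calc _ = (basisMatrix ν).conjTranspose * A * (basisMatrix ν * (basisMatrix ν).conjTranspose) *
          A * basisMatrix ν := by simp only [EnergyTest.inBasis, Matrix.mul_assoc]
      _ = (basisMatrix ν).conjTranspose * (A * A) * basisMatrix ν := by
          rw [basisMatrix_mul_conjTranspose, Matrix.mul_one]; simp only [Matrix.mul_assoc]
      _ = 1 := by rw [hA.2, Matrix.mul_one, basisMatrix_conjTranspose_mul]

theorem eq_basisMatrix_mul_diagonal (ν : OrthonormalBasis ι ℂ (EuclideanSpace ℂ ι))
    {H : Matrix ι ι ℂ} {E : ι → ℝ} (hE : ∀ α, Matrix.toEuclideanLin H (ν α) = (E α : ℂ) • ν α) :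
    H = basisMatrix ν * Matrix.diagonal (fun α => (E α : ℂ)) * (basisMatrix ν).conjTranspose := by
  have h : H * basisMatrix ν = basisMatrix ν * Matrix.diagonal (fun α => (E α : ℂ)) := by
    ext i α
    have h1 := congrArg (fun x : EuclideanSpace ℂ ι => x i) (hE α)
    rw [Matrix.mul_diagonal]
    simp only [PiLp.smul_apply, smul_eq_mul] at h1
    rw [mul_comm, basisMatrix, Matrix.of_apply, ← h1]
    rfl
  rw [← h, Matrix.mul_assoc, basisMatrix_mul_conjTranspose, Matrix.mul_one]

theorem map_star_mul (X Y : Matrix ι ι ℂ) : (X * Y).map star = X.map star * Y.map star :=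
  Matrix.map_mul (f := starRingEnd ℂ)

theorem map_star_conjTranspose (X : Matrix ι ι ℂ) :
    X.conjTranspose.map star = (X.map star).conjTranspose := by
  ext i j; simp

theorem map_star_one : (1 : Matrix ι ι ℂ).map star = 1 := by
  ext i j; by_cases h : i = j <;> simp [h, Matrix.one_apply]

theorem map_star_diagonal_ofReal (d : ι → ℝ) :
    (Matrix.diagonal fun α => (d α : ℂ)).map star = Matrix.diagonal fun α => (d α : ℂ) := by
  ext i j; by_cases h : i = j <;> simp [h]

/-- The change to the eigenbasis on both registers. -/
def pairBasis (ν : OrthonormalBasis ι ℂ (EuclideanSpace ℂ ι)) : Matrix (ι × ι) (ι × ι) ℂ :=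
  basisMatrix ν ⊗ₖ (basisMatrix ν).map star

theorem pairBasis_conjTranspose_mul (ν : OrthonormalBasis ι ℂ (EuclideanSpace ℂ ι)) :
    (pairBasis ν).conjTranspose * pairBasis ν = 1 := by
  rw [pairBasis, Matrix.conjTranspose_kronecker, ← Matrix.mul_kronecker_mul,
    ← map_star_conjTranspose, ← map_star_mul, basisMatrix_conjTranspose_mul, map_star_one,
    Matrix.one_kronecker_one]

theorem pairBasis_mul_conjTranspose (ν : OrthonormalBasis ι ℂ (EuclideanSpace ℂ ι)) :
    pairBasis ν * (pairBasis ν).conjTranspose = 1 :=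
  mul_eq_one_comm.1 (pairBasis_conjTranspose_mul ν)

theorem pairBasis_conj_stepAverage (ν : OrthonormalBasis ι ℂ (EuclideanSpace ℂ ι)) {m : ℕ}
    (A : Fin m → Matrix ι ι ℂ) (ε : ℝ) :
    (pairBasis ν).conjTranspose * stepAverage A ε * pairBasis ν =
      stepAverage (fun i => inBasis ν (A i)) ε := by
  rw [stepAverage, Matrix.mul_add, Matrix.add_mul, Matrix.mul_smul, Matrix.smul_mul, Matrix.mul_one,
    pairBasis_conjTranspose_mul, Matrix.mul_smul, Matrix.smul_mul, Matrix.mul_sum, Matrix.sum_mul,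
    stepAverage]
  congr 2
  refine Finset.sum_congr rfl fun i _ => ?_
  rw [pairBasis, Matrix.conjTranspose_kronecker, ← Matrix.mul_kronecker_mul,
    ← Matrix.mul_kronecker_mul, ← map_star_conjTranspose, ← map_star_mul, ← map_star_mul]
  rfl

/-- The second register carries the conjugate eigenbasis, in which conj H has the same real energies
and conj A_i the conjugate matrix. Both filters are therefore the same function q, and the remaining
factors are isometries. -/
theorem acceptProb_eq {m L : ℕ} (hm : 0 < m) (hL : 0 < L)
    (ν : OrthonormalBasis ι ℂ (EuclideanSpace ℂ ι)) {H : Matrix ι ι ℂ} {E : ι → ℝ}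
    (hE : ∀ α, Matrix.toEuclideanLin H (ν α) = (E α : ℂ) • ν α) {A : Fin m → Matrix ι ι ℂ}
    (hA : ∀ i, IsReflection (A i)) (ε e₀ Δ : ℝ) (ψ : EuclideanSpace ℂ (ι × ι)) :
    acceptProb H A ε e₀ Δ L ψ =
      ‖Matrix.toEuclideanLin (filteredStep (fun α => gridWeight L e₀ (Δ - 1 / Real.sqrt L) (E α))
        (fun i => inBasis ν (A i)) ε)
          (Matrix.toEuclideanLin (pairBasis ν).conjTranspose ψ)‖ ^ 2 := by
  set q : ι → ℝ := fun α => gridWeight L e₀ (Δ - 1 / Real.sqrt L) (E α) with hq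
  have hU := basisMatrix_conjTranspose_mul ν
  have hU' := basisMatrix_mul_conjTranspose ν
  have hH := eq_basisMatrix_mul_diagonal ν hE
  have hH' : H.map star = (basisMatrix ν).map star * Matrix.diagonal (fun α => (E α : ℂ)) *
      ((basisMatrix ν).map star).conjTranspose := by
    conv_lhs => rw [hH]
    rw [map_star_mul, map_star_mul, map_star_conjTranspose, map_star_diagonal_ofReal]
  have hV : ((basisMatrix ν).map star).conjTranspose * (basisMatrix ν).map star = 1 := by
    rw [← map_star_conjTranspose, ← map_star_mul, hU, map_star_one]
  have hV' : (basisMatrix ν).map star * ((basisMatrix ν).map star).conjTranspose = 1 :=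
    mul_eq_one_comm.1 hV
  have hQ := compress_projSP hU hU' E hH L e₀ (Δ - 1 / Real.sqrt L)
  have hQ' := compress_projSP hV hV' E hH' L e₀ (Δ - 1 / Real.sqrt L)
  have hQQ : (basisMatrix ν * Matrix.diagonal (fun α => (q α : ℂ)) *
      (basisMatrix ν).conjTranspose) ⊗ₖ ((basisMatrix ν).map star *
        Matrix.diagonal (fun α => (q α : ℂ)) * ((basisMatrix ν).map star).conjTranspose) =
      pairBasis ν * Matrix.diagonal (fun p : ι × ι => ((q p.1 * q p.2 : ℝ) : ℂ)) *
        (pairBasis ν).conjTranspose := by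
    rw [Matrix.mul_kronecker_mul, Matrix.mul_kronecker_mul, Matrix.diagonal_kronecker_diagonal,
      pairBasis, Matrix.conjTranspose_kronecker]
    congr 3
    funext p; push_cast; rfl
  have hB : acceptBranch H A ε e₀ Δ L = prepare ι L m * pairBasis ν *
      (filteredStep q (fun i => inBasis ν (A i)) ε * (pairBasis ν).conjTranspose) := by
    rw [acceptBranch_eq hm H hA ε e₀ Δ hQ hQ', hQQ, filteredStep, ← pairBasis_conj_stepAverage]
    simp only [Matrix.mul_assoc]
  have hJ : (prepare ι L m * pairBasis ν).conjTranspose * (prepare ι L m * pairBasis ν) = 1 := by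
    rw [Matrix.conjTranspose_mul, Matrix.mul_assoc, ← Matrix.mul_assoc (prepare ι L m).conjTranspose,
      prepare_conjTranspose_mul hL hm, Matrix.one_mul, pairBasis_conjTranspose_mul]
  rw [acceptProb, hB, toEuclideanLin_mul_apply, norm_toEuclideanLin_isometry hJ,
    toEuclideanLin_mul_apply]

theorem norm_filteredStep_le {m : ℕ} (hm : 0 < m) {q : ι → ℝ} (hq0 : ∀ x, 0 ≤ q x)
    (hq1 : ∀ x, q x ≤ 1) {A : Fin m → Matrix ι ι ℂ} (hA : ∀ i, IsReflection (A i)) (ε : ℝ)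
    (ψ : EuclideanSpace ℂ (ι × ι)) : ‖Matrix.toEuclideanLin (filteredStep q A ε) ψ‖ ≤ ‖ψ‖ := by
  have hd : ∀ x, ‖Matrix.toEuclideanLin (Matrix.diagonal fun p : ι × ι =>
      ((q p.1 * q p.2 : ℝ) : ℂ)) x‖ ≤ ‖x‖ := by
    intro x
    have := norm_diagonal_le zero_le_one (d := fun p : ι × ι => q p.1 * q p.2) (by
      intro p
      rw [abs_of_nonneg (mul_nonneg (hq0 _) (hq0 _))]
      exact mul_le_one₀ (hq1 _) (hq0 _) (hq1 _)) x
    rw [one_mul] at this; exact this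
  rw [filteredStep, Matrix.mul_assoc, toEuclideanLin_mul_apply, toEuclideanLin_mul_apply]
  exact (hd _).trans ((norm_stepAverage_le hm hA ε _).trans (hd _))

end Eigenbasis

open scoped InnerProductSpace

/-! ### The margin of the test for operators that follow the ansatz -/

/-- Here s = sin²ε, x = 1/√L, and l₀, r are the bounds for the two largest eigenvalues. Their
difference is s f⁶, of order f²⁰, minus errors of order f²¹, t and x. Squaring multiplies it by l₀ +
r, which lies between 1/2 and 40. The lower end serves when l₀ ≥ r; the upper end serves otherwise
and produces the constant 8400 = 40 · 210. -/
theorem margin_bounds {a b f s l t x μ₂ : ℝ} (hf : 0 < f) (hf1 : f ≤ 1)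
    (hs1 : a ^ 2 / 4 * f ^ 14 ≤ s) (hs2 : s ≤ b ^ 2 * f ^ 14) (hs3 : s ≤ 1 / 2)
    (hfa : (22 * b ^ 2 + 14) * f ≤ a ^ 2 / 8) (hfb : (17 * b ^ 2 + 206) * f ^ 14 ≤ 1 / 2)
    (ht0 : 0 ≤ t) (ht1 : t ≤ 1) (hx0 : 0 ≤ x) (hx : x ≤ f ^ 14) (hl : f ^ 2 ≤ l) (hl1 : l ≤ 1)
    (hμ : 0 ≤ μ₂) (hμ' : μ₂ ≤ 6) {l₀ r : ℝ}
    (hl₀ : l₀ = 1 - s + s * (μ₂ + l) - (32 * (6 * x) + 14 * f ^ 21) - s * (5 * t + 11 * f ^ 7))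
    (hr : r = 1 - s + s * (μ₂ + (l - f ^ 6) + (5 * t + 11 * f ^ 7)) + 3 * (6 * x)) :
    1 / 2 ≤ l₀ ∧ 1 - 2 * (17 * b ^ 2 + 206) * f ^ 14 ≤ l₀ ^ 2 ∧
      a ^ 2 / 16 * f ^ 20 - 8400 * (t + x) ≤ l₀ ^ 2 - r ^ 2 := by
  have p7 : f ^ 7 ≤ 1 := pow_le_one₀ hf.le hf1
  have p6 : f ^ 6 ≤ f ^ 2 := pow_le_pow_of_le_one hf.le hf1 (by norm_num)
  have p14 : f ^ 14 ≤ 1 := pow_le_one₀ hf.le hf1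
  have p21 : f ^ 21 ≤ f ^ 14 := pow_le_pow_of_le_one hf.le hf1 (by norm_num)
  have q14 : 0 < f ^ 14 := by positivity
  have q6 : 0 < f ^ 6 := by positivity
  have q7 : 0 < f ^ 7 := by positivity
  have q21 : 0 < f ^ 21 := by positivity
  have hs0 : 0 ≤ s := le_trans (by positivity) hs1
  have k1 : 0 ≤ s * (μ₂ + l) := mul_nonneg hs0 (by nlinarith)
  have k2 : s * (5 * t + 11 * f ^ 7) ≤ s * 16 := mul_le_mul_of_nonneg_left (by linarith) hs0
  have A1 : 1 - (17 * b ^ 2 + 206) * f ^ 14 ≤ l₀ := by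
    rw [hl₀]; linarith
  have A2 : 1 / 2 ≤ l₀ := by linarith
  have hdiff : l₀ - r = s * f ^ 6 - 2 * (s * (5 * t + 11 * f ^ 7)) - 210 * x - 14 * f ^ 21 := by
    rw [hl₀, hr]; ring
  have B1 : a ^ 2 / 4 * f ^ 20 ≤ s * f ^ 6 := by
    calc a ^ 2 / 4 * f ^ 20 = a ^ 2 / 4 * f ^ 14 * f ^ 6 := by ring
      _ ≤ s * f ^ 6 := mul_le_mul_of_nonneg_right hs1 q6.le
  have B2 : s * t ≤ 1 / 2 * t := mul_le_mul_of_nonneg_right hs3 ht0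
  have B3 : s * f ^ 7 ≤ b ^ 2 * f ^ 21 := by
    calc s * f ^ 7 ≤ b ^ 2 * f ^ 14 * f ^ 7 := mul_le_mul_of_nonneg_right hs2 q7.le
      _ = _ := by ring
  have B4 : (22 * b ^ 2 + 14) * f ^ 21 ≤ a ^ 2 / 8 * f ^ 20 := by
    calc (22 * b ^ 2 + 14) * f ^ 21 = (22 * b ^ 2 + 14) * f * f ^ 20 := by ring
      _ ≤ _ := mul_le_mul_of_nonneg_right hfa (by positivity)
  have G : a ^ 2 / 8 * f ^ 20 - 5 * t - 210 * x ≤ l₀ - r := by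
    rw [hdiff]; linarith
  have R0 : 0 ≤ r := by
    rw [hr]
    have : 0 ≤ s * (μ₂ + (l - f ^ 6) + (5 * t + 11 * f ^ 7)) :=
      mul_nonneg hs0 (by linarith)
    linarith
  have R1 : r ≤ 31 := by
    rw [hr]
    have : s * (μ₂ + (l - f ^ 6) + (5 * t + 11 * f ^ 7)) ≤ s * 24 :=
      mul_le_mul_of_nonneg_left (by linarith) hs0
    linarith
  have L1 : l₀ ≤ 9 := by
    rw [hl₀]
    have : s * (μ₂ + l) ≤ s * 7 := mul_le_mul_of_nonneg_left (by linarith) hs0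
    have : 0 ≤ s * (5 * t + 11 * f ^ 7) := by positivity
    linarith
  refine ⟨A2, ?_, ?_⟩
  · nlinarith [sq_nonneg (l₀ - 1)]
  · have e1 : l₀ ^ 2 - r ^ 2 = (l₀ - r) * (l₀ + r) := by ring
    rw [e1]
    have q20 : 0 ≤ a ^ 2 * f ^ 20 := by positivity
    rcases le_total 0 (l₀ - r) with h | h
    · have : (l₀ - r) * (1 / 2) ≤ (l₀ - r) * (l₀ + r) := mul_le_mul_of_nonneg_left (by linarith) h
      linarith
    · have h40 : (l₀ - r) * 40 ≤ (l₀ - r) * (l₀ + r) := mul_le_mul_of_nonpos_left (by linarith) h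
      linarith

theorem one_div_sqrt_le {f : ℝ} (hf : 0 < f) {L : ℕ} (hL : 1 ≤ f ^ 28 * (L : ℝ)) :
    1 / Real.sqrt L ≤ f ^ 14 := by
  have hL0 : (0 : ℝ) < L := by
    by_contra h
    have : f ^ 28 * (L : ℝ) ≤ 0 := mul_nonpos_of_nonneg_of_nonpos (by positivity) (not_lt.1 h)
    linarith
  have hs : 0 < Real.sqrt L := Real.sqrt_pos.2 hL0
  rw [div_le_iff₀ hs]
  have h1 : 1 ≤ (f ^ 14 * Real.sqrt L) ^ 2 := by
    rw [mul_pow, Real.sq_sqrt hL0.le]; calc _ ≤ _ := hL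
      _ = _ := by ring
  exact (one_le_sq_iff₀ (by positivity)).1 h1

section Margin

variable {ι : Type*} [Fintype ι] [DecidableEq ι]

/-- An empty window would make the quotient 0 by the convention for division by zero, against ρ < 1.
-/
theorem card_filter_not_window {E : ι → ℝ} {e₀ Δ η ρ : ℝ} [Fintype (Window E e₀ Δ)]
    (hη : 0 ≤ η) (hρ : ρ < 1)
    (h : 1 - ρ ≤ (windowDim E e₀ (Δ - η) : ℝ) / (windowDim E e₀ Δ : ℝ))
    [DecidablePred fun α : Window E e₀ Δ => E α ∉ Set.Icc (e₀ - (Δ - η) / 2) (e₀ + (Δ - η) / 2)] :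
    0 < windowDim E e₀ Δ ∧
      ((Finset.univ.filter fun α : Window E e₀ Δ =>
        E α ∉ Set.Icc (e₀ - (Δ - η) / 2) (e₀ + (Δ - η) / 2)).card : ℝ) ≤
          ρ * windowDim E e₀ Δ := by
  classical
  have hD : 0 < windowDim E e₀ Δ := by
    rcases Nat.eq_zero_or_pos (windowDim E e₀ Δ) with h0 | h0
    · rw [h0] at h; simp at h; linarith
    · exact h0
  refine ⟨hD, ?_⟩
  have hD' : (0 : ℝ) < windowDim E e₀ Δ := by exact_mod_cast hD
  rw [le_div_iff₀ hD'] at h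
  have h1 : (Finset.univ.filter fun α : Window E e₀ Δ =>
      E α ∈ Set.Icc (e₀ - (Δ - η) / 2) (e₀ + (Δ - η) / 2)).card = windowDim E e₀ (Δ - η) := by
    rw [windowDim, Nat.card_eq_fintype_card, Fintype.card_subtype, ← Finset.card_map
      (Function.Embedding.subtype _)]
    congr 1
    ext α
    simp only [Finset.mem_map, Finset.mem_filter, Finset.mem_univ, true_and,
      Function.Embedding.subtype_apply]
    constructor
    · rintro ⟨β, hβ, rfl⟩; exact hβ
    · intro hα
      exact ⟨⟨α, by linarith [hα.1], by linarith [hα.2]⟩, hα, rfl⟩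
  have h2 := Finset.card_filter_add_card_filter_not (s := (Finset.univ : Finset (Window E e₀ Δ)))
    (fun α : Window E e₀ Δ => E α ∈ Set.Icc (e₀ - (Δ - η) / 2) (e₀ + (Δ - η) / 2))
  rw [h1, Finset.card_univ, ← Nat.card_eq_fintype_card] at h2
  have h3 : (windowDim E e₀ (Δ - η) : ℝ) + ((Finset.univ.filter fun α : Window E e₀ Δ =>
        E α ∉ Set.Icc (e₀ - (Δ - η) / 2) (e₀ + (Δ - η) / 2)).card : ℝ) = windowDim E e₀ Δ := by
    exact_mod_cast h2
  linarith

theorem inner_diagVec {W : Type*} [Fintype W] [DecidableEq W] (u : W → ℝ)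
    (φ : EuclideanSpace ℂ (W × W)) : ⟪diagVec u, φ⟫_ℂ = ∑ α, (u α : ℂ) * φ (α, α) := by
  rw [EuclideanSpace.inner_eq_star_dotProduct, dotProduct, Fintype.sum_prod_type]
  refine Finset.sum_congr rfl fun α _ => ?_
  rw [Finset.sum_eq_single α]
  · simp [diagVec, mul_comm]
  · intro β _ hβ; simp [diagVec, hβ.symm]
  · simp

set_option maxHeartbeats 1000000 in
/-- If the window blocks of `A'` are close to the ansatz and the test does not tell `A` from `A'`,
then the test with `A` singles out a state. -/
theorem exists_singlesOut [Nonempty ι] {m L : ℕ} (hm : 0 < m)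
    (ν : OrthonormalBasis ι ℂ (EuclideanSpace ℂ ι)) {H : Matrix ι ι ℂ} {E : ι → ℝ}
    (hE : ∀ α, Matrix.toEuclideanLin H (ν α) = (E α : ℂ) • ν α)
    (hE01 : ∀ α, E α ∈ Set.Icc (0 : ℝ) 1) {a b f ε e₀ Δ η : ℝ} (ha : 0 < a) (hab : a ≤ b)
    (hf : 0 < f) (hf1 : f ≤ 1 / 2) (hfa : (22 * b ^ 2 + 14) * f ≤ a ^ 2 / 8)
    (hfb : (17 * b ^ 2 + 206) * f ^ 14 ≤ 1 / 2)
    (hε1 : a * f ^ 7 ≤ ε) (hε2 : ε ≤ b * f ^ 7) (h0 : 0 ≤ e₀ - Δ / 2) (h1 : e₀ + Δ / 2 ≤ 1)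
    (hdim : 1 - f ^ 25 ≤ (windowDim E e₀ (Δ - η) : ℝ) / (windowDim E e₀ Δ : ℝ))
    (hη : 3 / Real.sqrt L ≤ η) (hL : 1 ≤ f ^ 28 * (L : ℝ)) [Fintype (Window E e₀ Δ)]
    {F : Window E e₀ Δ → Window E e₀ Δ → ℝ} (hFs : ∀ α β, F α β = F β α)
    (hF : ∀ α β, f ≤ F α β ∧ F α β ≤ 1) {A' A : Fin m → Matrix ι ι ℂ}
    (hA' : ∀ i, IsReflection (A' i)) (hA : ∀ i, IsReflection (A i)) {μ₂ t : ℝ} (hμ : 0 ≤ μ₂)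
    (hμ' : μ₂ ≤ 6) (ht0 : 0 ≤ t) (ht1 : t ≤ 1)
    (hform : WindowForm (fun i => (inBasis ν (A' i)).submatrix (Subtype.val : Window E e₀ Δ → ι)
      Subtype.val) (fun α β => F α β ^ 2 / windowDim E e₀ Δ) μ₂ (5 * t + 11 * f ^ 7))
    {e : ℝ} (he : 0 ≤ e)
    (hdiam : diamondNorm (testChannel H A ε e₀ Δ L - testChannel H A' ε e₀ Δ L) ≤
      ENNReal.ofReal e) :
    ∃ p : ℝ, 1 - 2 * (17 * b ^ 2 + 206) * f ^ 14 - e ≤ p ∧ p ≤ 1 ∧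
      SinglesOut (acceptProb H A ε e₀ Δ L) p
        (a ^ 2 / 16 * f ^ 20 - e - 8400 * (t + 1 / Real.sqrt L)) := by
  classical
  have hf1' : f ≤ 1 := by linarith
  have hx := one_div_sqrt_le hf hL
  have hx0 : 0 ≤ 1 / Real.sqrt L := by positivity
  have hL4 : 4 ≤ L := by
    have h2 : f ^ 28 ≤ (1 / 2) ^ 28 := pow_le_pow_left₀ hf.le hf1 28
    have h3 : (1 : ℝ) ≤ (1 / 2) ^ 28 * (L : ℝ) :=
      hL.trans (mul_le_mul_of_nonneg_right h2 (Nat.cast_nonneg L))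
    have : (4 : ℝ) ≤ L := by norm_num at h3; linarith
    exact_mod_cast this
  have hL0 : 0 < L := by omega
  have h6 : 6 / Real.sqrt L = 6 * (1 / Real.sqrt L) := by ring
  have hf14 : f ^ 14 ≤ (1 / 2) ^ 14 := pow_le_pow_left₀ hf.le hf1 14
  set τ := 6 * (1 / Real.sqrt L) with hτ
  have hτ0 : 0 ≤ τ := by positivity
  have hτ1 : 4 * τ ≤ 1 := by norm_num at hf14; linarith
  have hη0 : 0 ≤ η := le_trans (by positivity) hη
  have hf25 : f ^ 25 < 1 := pow_lt_one₀ hf.le (by linarith) (by norm_num)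
  obtain ⟨hD, hbad⟩ := card_filter_not_window hη0 hf25 hdim
  have hD' : (0 : ℝ) < windowDim E e₀ Δ := by exact_mod_cast hD
  have hcard : windowDim E e₀ Δ = Fintype.card (Window E e₀ Δ) := Nat.card_eq_fintype_card
  have : Nonempty (Window E e₀ Δ) := Fintype.card_pos_iff.1 (hcard ▸ hD)
  set bad := Finset.univ.filter fun α : Window E e₀ Δ =>
    E α ∉ Set.Icc (e₀ - (Δ - η) / 2) (e₀ + (Δ - η) / 2) with hbaddef
  set B : Window E e₀ Δ → Window E e₀ Δ → ℝ := fun α β => F α β ^ 2 / windowDim E e₀ Δ with hB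
  have hB0 : ∀ α β, 0 ≤ B α β := fun α β => by positivity
  have hBs : ∀ α β, B α β = B β α := fun α β => by simp only [hB]; rw [hFs]
  obtain ⟨v, l, hv0, hv1, hBv, hl, hl1, hvD, hgap⟩ := exists_perron hf hBs
    (fun α β => by
      rw [hB, ← hcard]; simp only; gcongr; exact (hF α β).1)
    (fun α β => by
      rw [hB, ← hcard]; simp only; gcongr
      exact pow_le_one₀ (hf.le.trans (hF α β).1) (hF α β).2)
  -- At most f²⁵ D energies lie near the edge, and each carries at most 1/(f⁴D) of the Perron
  -- vector.
  have hbadv : ∑ α ∈ bad, v α ^ 2 ≤ f ^ 21 := by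
    calc ∑ α ∈ bad, v α ^ 2 ≤ ∑ _α ∈ bad, 1 / (f ^ 4 * Fintype.card (Window E e₀ Δ)) :=
          Finset.sum_le_sum fun α _ => hvD α
      _ = bad.card * (1 / (f ^ 4 * windowDim E e₀ Δ)) := by
          rw [Finset.sum_const, nsmul_eq_mul, hcard]
      _ ≤ f ^ 25 * windowDim E e₀ Δ * (1 / (f ^ 4 * windowDim E e₀ Δ)) :=
          mul_le_mul_of_nonneg_right hbad (by positivity)
      _ = f ^ 21 := by field_simp
  set q : ι → ℝ := fun α => gridWeight L e₀ (Δ - 1 / Real.sqrt L) (E α) with hq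
  have hq0 : ∀ x, 0 ≤ q x := fun x => gridWeight_nonneg _ _ _ _
  have hq1 : ∀ x, q x ≤ 1 := fun x => gridWeight_le_one hL0 _ _ _
  have hgood : ∀ α : Window E e₀ Δ, α ∉ bad → 1 - τ ≤ q α := by
    intro α hα
    rw [hbaddef, Finset.mem_filter, not_and, not_not] at hα
    have h2 := hα (Finset.mem_univ _)
    rw [← h6]
    exact gridWeight_ge hL4 h0 h1 ⟨by linarith [h2.1], by linarith [h2.2]⟩
  have hout : ∀ x, x ∉ Set.range (Subtype.val : Window E e₀ Δ → ι) → q x ≤ τ := by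
    intro x hx
    rw [← h6]
    refine gridWeight_le hL4 h0 h1 (hE01 x) fun hx' => hx ⟨⟨x, hx'⟩, rfl⟩
  have hinj : Function.Injective (Subtype.val : Window E e₀ Δ → ι) := Subtype.val_injective
  set Â : Fin m → Matrix ι ι ℂ := fun i => inBasis ν (A' i) with hÂ
  have hÂr : ∀ i, IsReflection (Â i) := fun i => (hA' i).inBasis ν
  set δ := 5 * t + 11 * f ^ 7 with hδ
  have hδ0 : 0 ≤ δ := by positivity
  have hf6 : f ^ 6 ≤ f ^ 2 := pow_le_pow_of_le_one hf.le hf1' (by norm_num)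
  -- the step size
  have hb : 0 < b := ha.trans_le hab
  have hf7 : 0 < f ^ 7 := by positivity
  have hε0 : 0 < ε := lt_of_lt_of_le (by positivity) hε1
  have hε3 : ε ^ 2 ≤ b ^ 2 * f ^ 14 := by
    calc ε ^ 2 ≤ (b * f ^ 7) ^ 2 := pow_le_pow_left₀ hε0.le hε2 2
      _ = _ := by ring
  have hε4 : ε ^ 2 ≤ 1 / 2 := by nlinarith [show 0 < f ^ 14 by positivity, sq_nonneg b]
  have hε5 : ε ≤ 1 := by nlinarith
  have hsin1 : ε / 2 ≤ Real.sin ε := by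
    have := Real.sin_gt_sub_cube hε0
    nlinarith
  have hsin2 : Real.sin ε ≤ ε := (Real.sin_lt hε0).le
  have hs2 : Real.sin ε ^ 2 ≤ ε ^ 2 := pow_le_pow_left₀ (by linarith) hsin2 2
  have hs1 : a ^ 2 / 4 * f ^ 14 ≤ Real.sin ε ^ 2 := by
    calc a ^ 2 / 4 * f ^ 14 = (a * f ^ 7 / 2) ^ 2 := by ring
      _ ≤ Real.sin ε ^ 2 := pow_le_pow_left₀ (by positivity) (by linarith) 2
  have hcos : Real.cos ε ^ 2 = 1 - Real.sin ε ^ 2 := by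
    linarith [Real.sin_sq_add_cos_sq ε]
  obtain ⟨l₀, hl₀⟩ : ∃ l₀, l₀ = 1 - Real.sin ε ^ 2 + Real.sin ε ^ 2 * (μ₂ + l) -
    (32 * τ + 14 * f ^ 21) - Real.sin ε ^ 2 * δ := ⟨_, rfl⟩
  obtain ⟨r, hr⟩ : ∃ r, r = 1 - Real.sin ε ^ 2 + Real.sin ε ^ 2 * (μ₂ + (l - f ^ 6) + δ) + 3 * τ :=
    ⟨_, rfl⟩
  obtain ⟨M1, M2, M3⟩ := margin_bounds hf hf1' hs1 (hs2.trans hε3) (hs2.trans hε4) hfa hfb ht0 ht1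
    hx0 hx hl hl1 hμ hμ' hl₀ hr
  have hlow := filteredStep_form_ge hinj hq0 hq1 hτ0 hτ1 hgood hB0 hBs hμ hμ' hδ0 hform
    (le_trans (by positivity) hl) hl1 (fun α => (hv0 α).le) hv1 hBv hbadv ε
  rw [hcos, ← hl₀] at hlow
  set X := Matrix.toEuclideanLin (filteredStep q Â ε) with hX
  set x₁ := Matrix.toEuclideanLin (windowInclusion (Subtype.val : Window E e₀ Δ → ι)) (diagVec v) with hx₁
  have hx₁n : ‖x₁‖ = 1 := by
    rw [hx₁, norm_toEuclideanLin_isometry (windowInclusion_isometry hinj)]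
    have := norm_sq_diagVec v
    rw [hv1] at this
    exact (sq_eq_sq₀ (norm_nonneg _) zero_le_one).1 (by rw [this, one_pow])
  have hXs : X.IsSymmetric := by
    intro x y
    rw [hX, inner_toEuclideanLin, (filteredStep_isHermitian q hÂr ε).eq]
  have hXx₁ : l₀ ^ 2 ≤ ‖X x₁‖ ^ 2 := by
    have h2 := (Complex.re_le_norm _).trans (norm_inner_le_norm (𝕜 := ℂ) x₁ (X x₁))
    rw [hx₁n, one_mul] at h2
    exact pow_le_pow_left₀ (by linarith) (hlow.trans h2) 2
  -- The form of X is bounded on the hyperplane orthogonal to the doubly filtered Perron vector;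
  -- positivity turns this into a norm bound on some other hyperplane.
  obtain ⟨z, hz⟩ := exists_norm_sq_le_on_orthogonal (T := X) hXs
    (fun y => by
      rw [hXs]
      exact filteredStep_form_nonneg hm q hÂr (hs2.trans hε4) y)
    (v := Matrix.toEuclideanLin (windowInclusion (Subtype.val : Window E e₀ Δ → ι))
      (diagVec fun α => v α * (q α * q α))) (r := r) (fun y hy => by
      rw [hXs, hr, ← hcos]
      refine filteredStep_form_le hm hinj hq0 hq1 hτ0 hout hÂr hμ hδ0 hform
        (v := v) (k := l - f ^ 6) (by linarith) hgap ε ?_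
      rw [← hy, ← inner_windowInclusion_conjTranspose, inner_diagVec]
      refine Finset.sum_congr rfl fun α _ => ?_
      rw [windowInclusion_conjTranspose_apply]
      push_cast; ring)
  have hP := pairBasis_conjTranspose_mul ν
  have hP' : ((pairBasis ν).conjTranspose).conjTranspose * (pairBasis ν).conjTranspose = 1 := by
    rw [Matrix.conjTranspose_conjTranspose]; exact pairBasis_mul_conjTranspose ν
  have hPx : Matrix.toEuclideanLin (pairBasis ν).conjTranspose
      (Matrix.toEuclideanLin (pairBasis ν) x₁) = x₁ := by
    rw [← toEuclideanLin_mul_apply, hP, Matrix.toLpLin_one, LinearMap.id_apply]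
  have hacc' := acceptProb_eq hm hL0 ν hE hA' ε e₀ Δ
  set N := acceptBranch H A ε e₀ Δ L with hN
  obtain ⟨p, hp1, hp2⟩ := singlesOut_of_close
    (M := Matrix.toEuclideanLin (N.conjTranspose * N)) (acc := acceptProb H A ε e₀ Δ L)
    (acc' := acceptProb H A' ε e₀ Δ L) (e := e)
    (v := Matrix.toEuclideanLin (pairBasis ν) z) (x₀ := Matrix.toEuclideanLin (pairBasis ν) x₁)
    (r := r ^ 2) (p₀ := l₀ ^ 2) (δ := a ^ 2 / 16 * f ^ 20 - e - 8400 * (t + 1 / Real.sqrt L))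
    (by
      intro x y
      rw [inner_toEuclideanLin, Matrix.conjTranspose_mul, Matrix.conjTranspose_conjTranspose])
    (by
      intro y
      rw [toEuclideanLin_mul_apply, ← inner_conj_symm, inner_toEuclideanLin,
        Matrix.conjTranspose_conjTranspose, inner_self_eq_norm_sq_to_K, acceptProb]
      norm_cast)
    (abs_acceptProb_sub_le H A A' ε e₀ Δ L he hdiam)
    (by
      intro y hy1 hy
      rw [hacc']
      have h2 := hz (Matrix.toEuclideanLin (pairBasis ν).conjTranspose y) (by
        rw [inner_toEuclideanLin, Matrix.conjTranspose_conjTranspose, hy])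
      rw [norm_toEuclideanLin_isometry hP', hy1, one_pow, mul_one] at h2
      exact h2)
    (by rw [norm_toEuclideanLin_isometry hP, hx₁n])
    (by
      rw [hacc', hPx]
      exact hXx₁)
    (by linarith)
  refine ⟨p, by linarith, ?_, hp2⟩
  obtain ⟨Ψ, hΨ, hΨp, -⟩ := hp2
  rw [← hΨp, acceptProb_eq hm hL0 ν hE hA ε e₀ Δ]
  have h2 := norm_filteredStep_le hm hq0 hq1 (fun i => (hA i).inBasis ν) ε
    (Matrix.toEuclideanLin (pairBasis ν).conjTranspose Ψ)
  rw [norm_toEuclideanLin_isometry hP', hΨ] at h2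
  exact pow_le_one₀ (norm_nonneg _) h2

end Margin

open scoped InnerProductSpace

/-! ### From entrywise averages to the form on the window -/

section Entries

variable {W : Type*} [Fintype W] [DecidableEq W]

/-- The average of a matrix on `ℂ^W ⊗ ℂ^W` over conjugation by `u ⊗ conj u` with `u` diagonal
and unitary. -/
def phaseMean (X : Matrix (W × W) (W × W) ℂ) : Matrix (W × W) (W × W) ℂ :=
  Matrix.of fun x y => if (x = y) ∨ (x.1 = x.2 ∧ y.1 = y.2) then X x y else 0

theorem inner_toEuclideanLin_eq_sum {κ : Type*} [Fintype κ] [DecidableEq κ] (M : Matrix κ κ ℂ)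
    (φ : EuclideanSpace ℂ κ) :
    ⟪φ, Matrix.toEuclideanLin M φ⟫_ℂ = ∑ x, ∑ y, M x y * (star (φ x) * φ y) := by
  rw [inner_toEuclideanLin_eq_dotProduct, dotProduct]
  refine Finset.sum_congr rfl fun x _ => ?_
  rw [Matrix.mulVec, dotProduct, Finset.mul_sum]
  exact Finset.sum_congr rfl fun y _ => by rw [Pi.star_apply]; ring

theorem sq_sum_norm_diag_le (φ : EuclideanSpace ℂ (W × W)) :
    (∑ α, ‖φ (α, α)‖) ^ 2 ≤ Fintype.card W * ‖φ‖ ^ 2 :=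
  (sq_sum_le_card_mul_sum_sq (s := Finset.univ) (f := fun α => ‖φ (α, α)‖)).trans
    (mul_le_mul_of_nonneg_left (sum_norm_sq_diag_le φ) (Nat.cast_nonneg _))

theorem sum_diag_kernel {R : Type*} [CommSemiring R] (B : W → W → R) (c : W × W → W × W → R) :
    ∑ x : W × W, ∑ y : W × W, (if x.1 = x.2 ∧ y.1 = y.2 then B x.1 y.1 else 0) * c x y =
      ∑ α, ∑ β, B α β * c (α, α) (β, β) := by
  rw [Fintype.sum_prod_type]
  refine Finset.sum_congr rfl fun α _ => ?_
  rw [Finset.sum_eq_single α]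
  · rw [Fintype.sum_prod_type]
    refine Finset.sum_congr rfl fun β _ => ?_
    rw [Finset.sum_eq_single β]
    · simp
    · intro γ _ hγ; simp [hγ.symm]
    · simp
  · intro γ _ hγ; simp [hγ.symm]
  · simp

theorem abs_re_kernel_le {D : ℝ} (hD : 0 ≤ D) {B : W → W → ℂ} (hB : ∀ α β, ‖B α β‖ ≤ D / Fintype.card W)
    (φ : EuclideanSpace ℂ (W × W)) :
    |(∑ α, ∑ β, B α β * (star (φ (α, α)) * φ (β, β))).re| ≤ D * ‖φ‖ ^ 2 := by
  rcases isEmpty_or_nonempty W with h | h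
  · simp only [Finset.univ_eq_empty, Finset.sum_empty, Complex.zero_re, abs_zero]; positivity
  have hc : (0 : ℝ) < Fintype.card W := by exact_mod_cast Fintype.card_pos
  refine (Complex.abs_re_le_norm _).trans ?_
  calc _ ≤ ∑ α, ∑ β, D / Fintype.card W * (‖φ (α, α)‖ * ‖φ (β, β)‖) := by
        refine (norm_sum_le _ _).trans (Finset.sum_le_sum fun α _ => ?_)
        refine (norm_sum_le _ _).trans (Finset.sum_le_sum fun β _ => ?_)
        rw [norm_mul, norm_mul, norm_star]
        exact mul_le_mul_of_nonneg_right (hB α β) (by positivity)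
    _ = D / Fintype.card W * (∑ α, ‖φ (α, α)‖) ^ 2 := by
        simp only [← Finset.mul_sum, sq, Finset.sum_mul]
    _ ≤ D / Fintype.card W * (Fintype.card W * ‖φ‖ ^ 2) :=
        mul_le_mul_of_nonneg_left (sq_sum_norm_diag_le φ) (by positivity)
    _ = D * ‖φ‖ ^ 2 := by field_simp

/-- The phase average keeps two kinds of entries. Those at ((α,γ), (α,γ)) are averages of a_αα conj
a_γγ, close to μ₂. Those at ((α,α), (β,β)) with α ≠ β are averages of |a_αβ|², close to F²/D. Errors
of the first kind sit on the diagonal and cost 3t + 7ρ; those of the second are at most t/D each on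
a D × D block and cost t; the discarded part costs a further t. -/
theorem windowForm_of_entries [Nonempty W] {m : ℕ} (hm : 0 < m) {μ : Fin m → W → ℝ}
    {F : W → W → ℝ} {ρ t : ℝ} (hμ : ∀ i α β, |μ i α - μ i β| ≤ ρ)
    (hF : ∀ α β, 0 ≤ F α β ∧ F α β ≤ 1) {G : Fin m → W → W → ℂ}
    (hGd : ∀ i α, (G i α α).im = 0) {a : Fin m → Matrix W W ℂ}
    (ha : ∀ i α β, a i α β = (if α = β then (μ i α : ℂ) else 0) +
      (F α β : ℂ) / (Real.sqrt (Fintype.card W) : ℂ) * G i α β)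
    (hμ6 : ∀ α, 1 / (m : ℝ) * ∑ i, μ i α ^ 2 ≤ 6)
    (h1 : ∀ α β, |1 / (m : ℝ) * ∑ i, ‖G i α β‖ ^ 2 - 1| ≤ t)
    (h2 : ∀ α γ, α ≠ γ → |1 / (m : ℝ) * ∑ i, (G i α α).re * (G i γ γ).re| ≤ t)
    (h3 : ∀ α γ, |1 / (m : ℝ) * ∑ i, μ i α * (G i γ γ).re| ≤ t)
    (h4 : ∀ φ : EuclideanSpace ℂ (W × W), |1 / (m : ℝ) *
      ((⟪φ, Matrix.toEuclideanLin (∑ i, a i ⊗ₖ (a i).map star) φ⟫_ℂ).re -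
        (⟪φ, Matrix.toEuclideanLin (phaseMean (∑ i, a i ⊗ₖ (a i).map star)) φ⟫_ℂ).re)| ≤
          t * ‖φ‖ ^ 2) :
    ∃ μ₂, 0 ≤ μ₂ ∧ μ₂ ≤ 6 ∧ WindowForm a (fun α β => F α β ^ 2 / Fintype.card W) μ₂
      (5 * t + 7 * ρ) := by
  obtain ⟨α₀⟩ := ‹Nonempty W›
  have hm' : (0 : ℝ) < m := by exact_mod_cast hm
  have ht0 : 0 ≤ t := (abs_nonneg _).trans (h1 α₀ α₀)
  have hρ0 : 0 ≤ ρ := (abs_nonneg _).trans (hμ ⟨0, hm⟩ α₀ α₀)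
  have hc : (1 : ℝ) ≤ Fintype.card W := by exact_mod_cast Fintype.card_pos_iff.2 ⟨α₀⟩
  set D : ℝ := (Fintype.card W : ℝ) with hD
  have hsD : Real.sqrt D * Real.sqrt D = D := Real.mul_self_sqrt (by linarith)
  have hsD1 : 1 ≤ Real.sqrt D := Real.one_le_sqrt.2 hc
  set μ₂ : ℝ := 1 / (m : ℝ) * ∑ i, μ i α₀ ^ 2 with hμ₂
  set R : Matrix (W × W) (W × W) ℂ := ∑ i, a i ⊗ₖ (a i).map star with hR
  have hRe : ∀ x y, R x y = ∑ i, a i x.1 y.1 * star (a i x.2 y.2) := by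
    intro x y
    rw [hR, Matrix.sum_apply]; rfl
  set N : W × W → W × W → ℂ := fun x y => (1 / m : ℝ) * phaseMean R x y -
    (if x = y then (μ₂ : ℂ) else 0) -
      (if x.1 = x.2 ∧ y.1 = y.2 then ((F x.1 y.1 ^ 2 / D : ℝ) : ℂ) else 0) with hN
  -- the entries on the diagonal of the window blocks
  set c : W → ℝ := fun α => F α α / Real.sqrt D with hcdef
  set x : Fin m → W → ℝ := fun i α => (G i α α).re with hx
  have hc0 : ∀ α, 0 ≤ c α := fun α => div_nonneg (hF α α).1 (Real.sqrt_nonneg _)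
  have hc1 : ∀ α, c α ≤ 1 := fun α => by
    rw [hcdef]; simp only
    rw [div_le_one (by linarith)]
    exact (hF α α).2.trans hsD1
  have hcc : ∀ α, c α * c α = F α α ^ 2 / D := fun α => by
    rw [hcdef]; simp only
    rw [div_mul_div_comm, hsD, sq]
  have hadiag : ∀ i α, a i α α = ((μ i α + c α * x i α : ℝ) : ℂ) := by
    intro i α
    rw [ha, if_pos rfl]
    have : G i α α = ((x i α : ℝ) : ℂ) := Complex.ext (by simp [hx]) (by simp [hGd])
    rw [this, hcdef]
    push_cast; ring
  -- The constant 7 is 1 + (6 + 6)/2: each product differs from the reference square by ρ(|μ_α| +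
  -- |μ_α₀|), and the mean squares are at most 6.
  have hμμ : ∀ α γ, |1 / (m : ℝ) * ∑ i, μ i α * μ i γ - μ₂| ≤ 7 * ρ := by
    intro α γ
    have e1 : 1 / (m : ℝ) * ∑ i, μ i α * μ i γ - μ₂ =
        1 / (m : ℝ) * ∑ i, (μ i α * μ i γ - μ i α₀ ^ 2) := by
      rw [hμ₂, Finset.sum_sub_distrib]; ring
    rw [e1, abs_mul, abs_of_pos (by positivity : (0 : ℝ) < 1 / m)]
    have e2 : ∀ i, |μ i α * μ i γ - μ i α₀ ^ 2| ≤ ρ * (1 + 1 / 2 * (μ i α ^ 2 + μ i α₀ ^ 2)) := by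
      intro i
      have e3 : μ i α * μ i γ - μ i α₀ ^ 2 =
          μ i α * (μ i γ - μ i α₀) + μ i α₀ * (μ i α - μ i α₀) := by ring
      rw [e3]
      refine (abs_add_le _ _).trans ?_
      rw [abs_mul, abs_mul]
      have k1 := mul_le_mul_of_nonneg_left (hμ i γ α₀) (abs_nonneg (μ i α))
      have k2 := mul_le_mul_of_nonneg_left (hμ i α α₀) (abs_nonneg (μ i α₀))
      have k3 : |μ i α| + |μ i α₀| ≤ 1 + 1 / 2 * (μ i α ^ 2 + μ i α₀ ^ 2) := by
        rw [← sq_abs (μ i α), ← sq_abs (μ i α₀)]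
        nlinarith [sq_nonneg (|μ i α| - 1), sq_nonneg (|μ i α₀| - 1)]
      have k4 := mul_le_mul_of_nonneg_left k3 hρ0
      linarith
    calc 1 / (m : ℝ) * |∑ i, (μ i α * μ i γ - μ i α₀ ^ 2)|
        ≤ 1 / (m : ℝ) * ∑ i, ρ * (1 + 1 / 2 * (μ i α ^ 2 + μ i α₀ ^ 2)) := by
          refine mul_le_mul_of_nonneg_left ?_ (by positivity)
          exact (Finset.abs_sum_le_sum_abs _ _).trans (Finset.sum_le_sum fun i _ => e2 i)
      _ = ρ * (1 + 1 / 2 * (1 / (m : ℝ) * ∑ i, μ i α ^ 2 + μ₂)) := by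
          rw [← Finset.mul_sum, Finset.sum_add_distrib, ← Finset.mul_sum, Finset.sum_add_distrib,
            hμ₂, Finset.sum_const, Finset.card_univ, Fintype.card_fin, nsmul_eq_mul]
          field_simp
      _ ≤ ρ * (1 + 1 / 2 * (6 + 6)) := by
          have := hμ6 α; have := hμ6 α₀; gcongr
      _ = 7 * ρ := by ring
  have hdiag : ∀ α γ, |1 / (m : ℝ) * ∑ i, (μ i α + c α * x i α) * (μ i γ + c γ * x i γ) - μ₂ -
      (if α = γ then F α α ^ 2 / D else 0)| ≤ 7 * ρ + 3 * t := by
    intro α γ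
    have e1 : 1 / (m : ℝ) * ∑ i, (μ i α + c α * x i α) * (μ i γ + c γ * x i γ) - μ₂ -
        (if α = γ then F α α ^ 2 / D else 0) =
        (1 / (m : ℝ) * ∑ i, μ i α * μ i γ - μ₂) + c γ * (1 / (m : ℝ) * ∑ i, μ i α * x i γ) +
          c α * (1 / (m : ℝ) * ∑ i, μ i γ * x i α) +
          c α * c γ * (1 / (m : ℝ) * ∑ i, x i α * x i γ - (if α = γ then 1 else 0)) := by
      have e2 : (if α = γ then F α α ^ 2 / D else 0) =
          c α * c γ * (if α = γ then 1 else 0) := by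
        split_ifs with h
        · rw [← h, hcc, mul_one]
        · rw [mul_zero]
      rw [e2]
      have e3 : ∑ i, (μ i α + c α * x i α) * (μ i γ + c γ * x i γ) =
          ∑ i, μ i α * μ i γ + c γ * ∑ i, μ i α * x i γ + c α * ∑ i, μ i γ * x i α +
            c α * c γ * ∑ i, x i α * x i γ := by
        rw [Finset.mul_sum, Finset.mul_sum, Finset.mul_sum, ← Finset.sum_add_distrib,
          ← Finset.sum_add_distrib, ← Finset.sum_add_distrib]
        exact Finset.sum_congr rfl fun i _ => by ring
      rw [e3]; ring
    rw [e1]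
    have k1 : |1 / (m : ℝ) * ∑ i, x i α * x i γ - (if α = γ then 1 else 0)| ≤ t := by
      split_ifs with h
      · subst h
        have := h1 α α
        have e4 : ∀ i, ‖G i α α‖ ^ 2 = x i α * x i α := by
          intro i
          rw [Complex.sq_norm, Complex.normSq_apply, hGd, mul_zero, add_zero]
        simpa only [e4] using this
      · rw [sub_zero]; exact h2 α γ h
    have k2 := h3 α γ
    have k3 := h3 γ α
    have hmul : ∀ {r s : ℝ}, 0 ≤ r → r ≤ 1 → |s| ≤ t → |r * s| ≤ t := by
      intro r s hr0 hr1 hs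
      rw [abs_mul, abs_of_nonneg hr0]
      exact (mul_le_of_le_one_left (abs_nonneg _) hr1).trans hs
    have j1 := hmul (mul_nonneg (hc0 α) (hc0 γ)) (mul_le_one₀ (hc1 α) (hc0 γ) (hc1 γ)) k1
    have j2 := hmul (hc0 γ) (hc1 γ) k2
    have j3 := hmul (hc0 α) (hc1 α) k3
    have j4 := hμμ α γ
    refine (abs_add_le _ _).trans ?_
    have := abs_add_le (1 / (m : ℝ) * ∑ i, μ i α * μ i γ - μ₂ +
      c γ * (1 / (m : ℝ) * ∑ i, μ i α * x i γ)) (c α * (1 / (m : ℝ) * ∑ i, μ i γ * x i α))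
    have := abs_add_le (1 / (m : ℝ) * ∑ i, μ i α * μ i γ - μ₂)
      (c γ * (1 / (m : ℝ) * ∑ i, μ i α * x i γ))
    linarith
  have hNle : ∀ x y, ‖N x y‖ ≤ (if x = y then 7 * ρ + 3 * t else 0) +
      (if x.1 = x.2 ∧ y.1 = y.2 then t / D else 0) := by
    rintro ⟨α, γ⟩ ⟨β, δ⟩
    have htD : 0 ≤ t / D := by positivity
    by_cases hxy : ((α, γ) : W × W) = (β, δ)
    · rw [Prod.mk.injEq] at hxy
      obtain ⟨rfl, rfl⟩ := hxy
      have e1 : N (α, γ) (α, γ) = ((1 / (m : ℝ) * ∑ i, (μ i α + c α * x i α) *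
          (μ i γ + c γ * x i γ) - μ₂ - (if α = γ then F α α ^ 2 / D else 0) : ℝ) : ℂ) := by
        simp only [hN, phaseMean, Matrix.of_apply, true_or, if_true, hRe, hadiag, Complex.star_def,
          Complex.conj_ofReal]
        push_cast
        congr 1
        by_cases h : α = γ <;> simp [h]
      rw [e1, Complex.norm_real, Real.norm_eq_abs, if_pos rfl]
      refine (hdiag α γ).trans ?_
      have : 0 ≤ if (α, γ).1 = (α, γ).2 ∧ (α, γ).1 = (α, γ).2 then t / D else 0 := by
        split_ifs <;> [exact htD; exact le_rfl]
      linarith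
    · rw [if_neg hxy, zero_add]
      by_cases hd : α = γ ∧ β = δ
      · obtain ⟨rfl, rfl⟩ := hd
        have hαβ : α ≠ β := fun h => hxy (by rw [h])
        have e1 : N (α, α) (β, β) =
            ((F α β ^ 2 / D * (1 / (m : ℝ) * ∑ i, ‖G i α β‖ ^ 2 - 1) : ℝ) : ℂ) := by
          have e2 : ∀ i, a i α β * star (a i α β) =
              ((F α β ^ 2 / D * ‖G i α β‖ ^ 2 : ℝ) : ℂ) := by
            intro i
            rw [ha, if_neg hαβ, zero_add, Complex.star_def, Complex.mul_conj,
              Complex.normSq_eq_norm_sq, norm_mul, norm_div, Complex.norm_real, Complex.norm_real,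
              mul_pow, div_pow, Real.norm_eq_abs, Real.norm_eq_abs, sq_abs, sq_abs,
              Real.sq_sqrt (by linarith)]
          simp only [hN, phaseMean, Matrix.of_apply, hxy, false_or, and_self, if_true, hRe, e2,
            if_false, sub_zero]
          push_cast
          rw [← Finset.mul_sum]; ring
        rw [e1, Complex.norm_real, Real.norm_eq_abs, if_pos ⟨rfl, rfl⟩, abs_mul,
          abs_of_nonneg (by positivity)]
        calc F α β ^ 2 / D * _ ≤ 1 / D * t := by
              have : F α β ^ 2 ≤ 1 := pow_le_one₀ (hF α β).1 (hF α β).2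
              exact mul_le_mul (by gcongr) (h1 α β) (abs_nonneg _) (by positivity)
          _ = t / D := by ring
      · rw [if_neg hd]
        simp [hN, phaseMean, hxy, hd]
  refine ⟨μ₂, by positivity, hμ6 α₀, fun φ => ?_⟩
  have hsplit : 1 / (m : ℝ) * (⟪φ, Matrix.toEuclideanLin R φ⟫_ℂ).re - (μ₂ * ‖φ‖ ^ 2 +
      (∑ α, ∑ β, ((F α β ^ 2 / D : ℝ) : ℂ) * (star (φ (α, α)) * φ (β, β))).re) =
      1 / (m : ℝ) * ((⟪φ, Matrix.toEuclideanLin R φ⟫_ℂ).re -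
        (⟪φ, Matrix.toEuclideanLin (phaseMean R) φ⟫_ℂ).re) +
      (∑ x, ∑ y, N x y * (star (φ x) * φ y)).re := by
    have e1 : ∑ x, ∑ y, N x y * (star (φ x) * φ y) =
        ((1 / m : ℝ) : ℂ) * ⟪φ, Matrix.toEuclideanLin (phaseMean R) φ⟫_ℂ -
          ((μ₂ * ‖φ‖ ^ 2 : ℝ) : ℂ) -
          ∑ α, ∑ β, ((F α β ^ 2 / D : ℝ) : ℂ) * (star (φ (α, α)) * φ (β, β)) := by
      rw [inner_toEuclideanLin_eq_sum, ← sum_diag_kernel (fun α β => ((F α β ^ 2 / D : ℝ) : ℂ))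
        (fun x y => star (φ x) * φ y), EuclideanSpace.norm_sq_eq]
      have e2 : ((μ₂ * ∑ x, ‖φ x‖ ^ 2 : ℝ) : ℂ) =
          ∑ x, ∑ y, (if x = y then (μ₂ : ℂ) else 0) * (star (φ x) * φ y) := by
        push_cast
        rw [Finset.mul_sum]
        refine Finset.sum_congr rfl fun x _ => ?_
        rw [Finset.sum_eq_single x]
        · rw [if_pos rfl, Complex.star_def, Complex.conj_mul']
        · intro y _ hy; rw [if_neg hy.symm, zero_mul]
        · simp
      rw [e2, Finset.mul_sum, ← Finset.sum_sub_distrib, ← Finset.sum_sub_distrib]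
      refine Finset.sum_congr rfl fun x _ => ?_
      rw [Finset.mul_sum, ← Finset.sum_sub_distrib, ← Finset.sum_sub_distrib]
      exact Finset.sum_congr rfl fun y _ => by rw [hN]; ring
    rw [e1, Complex.sub_re, Complex.sub_re, Complex.re_ofReal_mul, Complex.ofReal_re]
    ring
  have hNsum : |(∑ x, ∑ y, N x y * (star (φ x) * φ y)).re| ≤ (7 * ρ + 3 * t + t) * ‖φ‖ ^ 2 := by
    refine (Complex.abs_re_le_norm _).trans ?_
    calc _ ≤ ∑ x, ∑ y, ((if x = y then 7 * ρ + 3 * t else 0) +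
          (if x.1 = x.2 ∧ y.1 = y.2 then t / D else 0)) * (‖φ x‖ * ‖φ y‖) := by
          refine (norm_sum_le _ _).trans (Finset.sum_le_sum fun x _ => ?_)
          refine (norm_sum_le _ _).trans (Finset.sum_le_sum fun y _ => ?_)
          rw [norm_mul, norm_mul, norm_star]
          exact mul_le_mul_of_nonneg_right (hNle x y) (by positivity)
      _ = (7 * ρ + 3 * t) * ‖φ‖ ^ 2 + t / D * (∑ α, ‖φ (α, α)‖) ^ 2 := by
          simp only [add_mul, Finset.sum_add_distrib]
          rw [sum_diag_kernel (fun _ _ => t / D) (fun x y => ‖φ x‖ * ‖φ y‖),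
            EuclideanSpace.norm_sq_eq]
          have e4 : ∀ x : W × W, ∑ y, (if x = y then 7 * ρ + 3 * t else 0) * (‖φ x‖ * ‖φ y‖) =
              (7 * ρ + 3 * t) * ‖φ x‖ ^ 2 := by
            intro x
            simp [sq]
          have e3 : ∑ α, ∑ β, t / D * (‖φ (α, α)‖ * ‖φ (β, β)‖) =
              t / D * (∑ α, ‖φ (α, α)‖) ^ 2 := by
            simp only [← Finset.mul_sum, sq, Finset.sum_mul]
          rw [e3]
          simp only [e4, ← Finset.mul_sum]
          ring
      _ ≤ (7 * ρ + 3 * t) * ‖φ‖ ^ 2 + t / D * (D * ‖φ‖ ^ 2) := by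
          have := sq_sum_norm_diag_le φ
          gcongr
      _ = (7 * ρ + 3 * t + t) * ‖φ‖ ^ 2 := by field_simp
  change |1 / (m : ℝ) * (⟪φ, Matrix.toEuclideanLin R φ⟫_ℂ).re - (μ₂ * ‖φ‖ ^ 2 +
      (∑ α, ∑ β, ((F α β ^ 2 / D : ℝ) : ℂ) * (star (φ (α, α)) * φ (β, β))).re)| ≤ _
  rw [hsplit]
  refine (abs_add_le _ _).trans ?_
  have := h4 φ
  linarith

/-- Window blocks of reflections satisfy the window form trivially with error `2`. -/
theorem windowForm_two {ι : Type*} [Fintype ι] [DecidableEq ι] {m : ℕ} (hm : 0 < m) {e : W → ι}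
    (he : Function.Injective e) {A : Fin m → Matrix ι ι ℂ} (hA : ∀ i, IsReflection (A i))
    {B : W → W → ℝ} (hB : ∀ α β, |B α β| ≤ 1 / Fintype.card W) :
    WindowForm (fun i => (A i).submatrix e e) B 0 2 := by
  intro φ
  have hm' : (0 : ℝ) < m := by exact_mod_cast hm
  have h1 := abs_re_kernel_le zero_le_one (B := fun α β => (B α β : ℂ))
    (fun α β => by rw [Complex.norm_real]; exact hB α β) φ
  set y := Matrix.toEuclideanLin (windowInclusion e) φ with hy
  have hyn : ‖y‖ = ‖φ‖ := norm_toEuclideanLin_isometry (windowInclusion_isometry he) φ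
  have h2 : ⟪φ, Matrix.toEuclideanLin (∑ i, (A i).submatrix e e ⊗ₖ ((A i).submatrix e e).map star)
      φ⟫_ℂ = ⟪y, Matrix.toEuclideanLin (∑ i, A i ⊗ₖ (A i).map star) y⟫_ℂ := by
    have h3 : ∑ i, (A i).submatrix e e ⊗ₖ ((A i).submatrix e e).map star =
        (windowInclusion e).conjTranspose * (∑ i, A i ⊗ₖ (A i).map star) * windowInclusion e := by
      rw [windowInclusion_compress]
      ext x y
      simp [Matrix.sum_apply, Matrix.kroneckerMap_apply]
    rw [h3, Matrix.mul_assoc, toEuclideanLin_mul_apply, toEuclideanLin_mul_apply,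
      inner_windowInclusion_conjTranspose]
  have h3 : |1 / (m : ℝ) * (⟪y, Matrix.toEuclideanLin (∑ i, A i ⊗ₖ (A i).map star) y⟫_ℂ).re| ≤
      ‖φ‖ ^ 2 := by
    rw [abs_mul, abs_of_pos (by positivity : (0 : ℝ) < 1 / m)]
    have h4 := norm_sum_reflections_le (fun i => (hA i).kronecker_map_star) y
    have h5 := (Complex.abs_re_le_norm _).trans (norm_inner_le_norm (𝕜 := ℂ) y
      (Matrix.toEuclideanLin (∑ i, A i ⊗ₖ (A i).map star) y))
    have h6 := h5.trans (mul_le_mul_of_nonneg_left h4 (norm_nonneg y))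
    calc _ ≤ 1 / (m : ℝ) * (‖y‖ * (m * ‖y‖)) := mul_le_mul_of_nonneg_left h6 (by positivity)
      _ = ‖φ‖ ^ 2 := by rw [hyn]; field_simp
  rw [h2, zero_mul, zero_add]
  refine (abs_sub _ _).trans ?_
  linarith

end Entries

open scoped InnerProductSpace

/-! ### Averaging over diagonal phases -/

/-- The fourth roots of unity. -/
def phase (k : Fin 4) : ℂ := Complex.I ^ (k : ℕ)

theorem phase_add_one (k : Fin 4) : phase (k + 1) = Complex.I * phase k := by
  fin_cases k
  · simp [phase]
  · simp [phase]
  · simp [phase]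
  · simp [phase]

theorem phase_mul_star (k : Fin 4) : phase k * star (phase k) = 1 := by
  rw [phase, star_pow, ← mul_pow, Complex.star_def, Complex.conj_I]
  simp

section Phases

variable {W : Type*} [Fintype W] [DecidableEq W]

/-- Conjugation of a matrix by a diagonal matrix of phases. -/
def rotate (u : W → Fin 4) (a : Matrix W W ℂ) : Matrix W W ℂ :=
  Matrix.of fun α β => phase (u α) * a α β * star (phase (u β))

theorem rotate_isHermitian (u : W → Fin 4) {a : Matrix W W ℂ} (ha : a.IsHermitian) :
    (rotate u a).IsHermitian := by
  ext α β
  rw [Matrix.conjTranspose_apply, rotate, Matrix.of_apply, Matrix.of_apply, star_mul, star_mul,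
    star_star, ← ha.apply α β]
  ring

theorem rotate_kronecker_apply (u : W → Fin 4) (a : Matrix W W ℂ) (x y : W × W) :
    (rotate u a ⊗ₖ (rotate u a).map star) x y =
      phase (u x.1) * star (phase (u x.2)) * (star (phase (u y.1)) * phase (u y.2)) *
        (a ⊗ₖ a.map star) x y := by
  simp only [Matrix.kroneckerMap_apply, Matrix.map_apply, rotate, Matrix.of_apply, star_mul',
    star_star]
  ring

/-- Advancing the phase at one index w by a quarter turn permutes the summands and multiplies each
by a constant; the sum vanishes if that constant is not 1 for some w. Signs would not suffice: the
entry at ((α,γ), (γ,α)) carries the square of a phase difference. -/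
theorem sum_phase_eq_zero {x y : W × W} (h : ¬((x = y) ∨ (x.1 = x.2 ∧ y.1 = y.2))) :
    ∑ u : W → Fin 4, phase (u x.1) * star (phase (u x.2)) *
      (star (phase (u y.1)) * phase (u y.2)) = 0 := by
  obtain ⟨α, γ⟩ := x
  obtain ⟨β, δ⟩ := y
  set f : (W → Fin 4) → ℂ := fun u => phase (u α) * star (phase (u γ)) *
      (star (phase (u β)) * phase (u δ)) with hf
  set κ : W → W → ℂ := fun w v => if v = w then Complex.I else 1 with hκ
  have hshift : ∀ (w : W) (u : W → Fin 4) (v : W), phase ((u + Pi.single w 1 : W → Fin 4) v) = κ w v * phase (u v) := by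
    intro w u v
    by_cases hv : v = w
    · subst hv
      simp [hκ, phase_add_one]
    · simp [hκ, hv]
  have hsum : ∀ w, ∑ u, f u = κ w α * star (κ w γ) * (star (κ w β) * κ w δ) * ∑ u, f u := by
    intro w
    rw [← Equiv.sum_comp (Equiv.addRight (Pi.single w 1 : W → Fin 4)) f]
    conv_rhs => rw [Equiv.sum_comp (Equiv.addRight (Pi.single w 1 : W → Fin 4)) f]
    rw [Finset.mul_sum]
    refine Finset.sum_congr rfl fun u _ => ?_
    simp only [hf, Equiv.coe_addRight, hshift, star_mul']
    ring
  have key : ∀ w, κ w α * star (κ w γ) * (star (κ w β) * κ w δ) ≠ 1 → ∑ u, f u = 0 := by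
    intro w hw
    have h1 := hsum w
    by_contra h0
    exact hw (mul_right_cancel₀ h0 (by rw [one_mul]; exact h1.symm))
  simp only [Prod.mk.injEq, not_or, not_and] at h
  have hI : Complex.I ≠ 1 := fun h => by simpa using congrArg Complex.im h
  have hI' : -Complex.I ≠ 1 := fun h => by simpa using congrArg Complex.im h
  have hI2 : Complex.I * Complex.I ≠ 1 := by rw [Complex.I_mul_I]; norm_num
  by_cases h1 : α = β
  · have h2 : γ ≠ δ := h.1 h1
    subst h1
    apply key γ
    by_cases h3 : α = γ
    · simp [hκ, h3, h2.symm, hI']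
    · simp [hκ, h3, h2.symm, hI']
  · by_cases h2 : α = γ
    · have h3 : β ≠ δ := h.2 h2
      subst h2
      apply key β
      simp [hκ, h1, h3.symm, hI']
    · apply key α
      -- If δ = α, the phase at α occurs squared and the constant is i² = −1.
      by_cases h3 : δ = α
      · simp [hκ, h3, Ne.symm h1, Ne.symm h2]; norm_num
      · simp [hκ, h3, Ne.symm h1, Ne.symm h2, hI]

theorem sum_phase_eq_one {x y : W × W} (h : (x = y) ∨ (x.1 = x.2 ∧ y.1 = y.2)) (u : W → Fin 4) :
    phase (u x.1) * star (phase (u x.2)) * (star (phase (u y.1)) * phase (u y.2)) = 1 := by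
  rcases h with rfl | ⟨h1, h2⟩
  · calc _ = (phase (u x.1) * star (phase (u x.1))) * (phase (u x.2) * star (phase (u x.2))) := by
          ring
      _ = 1 := by rw [phase_mul_star, phase_mul_star, one_mul]
  · rw [h1, h2]
    calc _ = (phase (u x.2) * star (phase (u x.2))) * (phase (u y.2) * star (phase (u y.2))) := by
          ring
      _ = 1 := by rw [phase_mul_star, phase_mul_star, one_mul]

theorem phaseMean_isHermitian {X : Matrix (W × W) (W × W) ℂ} (hX : X.IsHermitian) :
    (phaseMean X).IsHermitian := by
  ext x y
  rw [Matrix.conjTranspose_apply, phaseMean, Matrix.of_apply, Matrix.of_apply]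
  by_cases h : (x = y) ∨ (x.1 = x.2 ∧ y.1 = y.2)
  · rw [if_pos h, if_pos (by tauto), hX.apply]
  · rw [if_neg h, if_neg (by tauto), star_zero]

theorem phaseMean_sum {m : ℕ} (X : Fin m → Matrix (W × W) (W × W) ℂ) :
    phaseMean (∑ i, X i) = ∑ i, phaseMean (X i) := by
  ext x y
  rw [Matrix.sum_apply, phaseMean, Matrix.of_apply]
  simp only [phaseMean, Matrix.of_apply, Matrix.sum_apply]
  split_ifs <;> simp

theorem phaseMean_rotate (u : W → Fin 4) (a : Matrix W W ℂ) :
    phaseMean (rotate u a ⊗ₖ (rotate u a).map star) = phaseMean (a ⊗ₖ a.map star) := by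
  ext x y
  simp only [phaseMean, Matrix.of_apply]
  split_ifs with h
  · rw [rotate_kronecker_apply, sum_phase_eq_one h, one_mul]
  · rfl

theorem sum_rotate (a : Matrix W W ℂ) :
    ∑ u : W → Fin 4, (rotate u a ⊗ₖ (rotate u a).map star - phaseMean (a ⊗ₖ a.map star)) = 0 := by
  ext x y
  rw [Matrix.sum_apply]
  simp only [Matrix.sub_apply, rotate_kronecker_apply, phaseMean, Matrix.of_apply,
    Finset.sum_sub_distrib, ← Finset.sum_mul, Matrix.zero_apply]
  split_ifs with h
  · simp only [sum_phase_eq_one h]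
    simp
  · rw [sum_phase_eq_zero h]; simp

/-- `a ⊗ conj a` does not increase the norm. -/
def PairContraction (a : Matrix W W ℂ) : Prop :=
  ∀ φ : EuclideanSpace ℂ (W × W), ‖Matrix.toEuclideanLin (a ⊗ₖ a.map star) φ‖ ≤ ‖φ‖

theorem PairContraction.rotate {a : Matrix W W ℂ} (ha : PairContraction a) (u : W → Fin 4) :
    PairContraction (rotate u a) := by
  intro φ
  set V : Matrix (W × W) (W × W) ℂ :=
    Matrix.diagonal fun x => phase (u x.1) * star (phase (u x.2)) with hV
  have hVV : V.conjTranspose * V = 1 ∧ V * V.conjTranspose = 1 := by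
    have h1 : ∀ x : W × W, phase (u x.1) * star (phase (u x.2)) *
        star (phase (u x.1) * star (phase (u x.2))) = 1 := fun x => by
      rw [star_mul', star_star]
      exact sum_phase_eq_one (Or.inl rfl) u
    have h2 : V * V.conjTranspose = 1 := by
      rw [hV, Matrix.diagonal_conjTranspose, Matrix.diagonal_mul_diagonal, ← Matrix.diagonal_one]
      congr 1; funext x; exact h1 x
    exact ⟨mul_eq_one_comm.1 h2, h2⟩
  have h : EnergyTest.rotate u a ⊗ₖ (EnergyTest.rotate u a).map star =
      V * (a ⊗ₖ a.map star * V.conjTranspose) := by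
    ext x y
    rw [rotate_kronecker_apply, hV, Matrix.diagonal_mul, Matrix.diagonal_conjTranspose,
      Matrix.mul_diagonal, Pi.star_apply, star_mul', star_star]
    ring
  rw [h, toEuclideanLin_mul_apply, norm_toEuclideanLin_isometry hVV.1, toEuclideanLin_mul_apply]
  refine (ha _).trans (le_of_eq ?_)
  exact norm_toEuclideanLin_isometry (by rw [Matrix.conjTranspose_conjTranspose, hVV.2]) φ

theorem kronecker_map_star_isHermitian {a : Matrix W W ℂ} (ha : a.IsHermitian) :
    (a ⊗ₖ a.map star).IsHermitian := by
  ext x y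
  rw [Matrix.conjTranspose_apply, Matrix.kroneckerMap_apply, Matrix.kroneckerMap_apply,
    Matrix.map_apply, Matrix.map_apply, star_mul', star_star, ha.apply, ← ha.apply x.2 y.2,
    star_star]

/-- The part of `∑ a_i ⊗ conj a_i` that averages to zero over diagonal phases. -/
def phaseDeviation {m : ℕ} (a : Fin m → Matrix W W ℂ) : Matrix (W × W) (W × W) ℂ :=
  ∑ i, a i ⊗ₖ (a i).map star - phaseMean (∑ i, a i ⊗ₖ (a i).map star)

theorem phaseDeviation_isHermitian {m : ℕ} {a : Fin m → Matrix W W ℂ}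
    (ha : ∀ i, (a i).IsHermitian) : (phaseDeviation a).IsHermitian := by
  have h : (∑ i, a i ⊗ₖ (a i).map star).IsHermitian := by
    rw [Matrix.IsHermitian, Matrix.conjTranspose_sum]
    exact Finset.sum_congr rfl fun i _ => kronecker_map_star_isHermitian (ha i)
  exact h.sub (phaseMean_isHermitian h)

theorem sum_norm_sq_mulVec_eq {κ : Type*} [Fintype κ] [DecidableEq κ] (M : Matrix κ κ ℂ)
    (x : κ → ℂ) :
    ∑ k, ‖(M.mulVec x) k‖ ^ 2 = ‖Matrix.toEuclideanLin M (WithLp.toLp 2 x)‖ ^ 2 := by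
  rw [EuclideanSpace.norm_sq_eq]; rfl

/-- Rotation preserves both the contraction property and the phase mean, so the summands are centred
and independent in the phases, and two values of one summand differ by norm at most 2. Hence r = 4.
-/
theorem sum_trace_phaseDeviation_le {m : ℕ} {a : Fin m → Matrix W W ℂ}
    (ha : ∀ i, (a i).IsHermitian) (hc : ∀ i, PairContraction (a i)) (p : ℕ) :
    ∑ u : Fin m → W → Fin 4, ((phaseDeviation fun i => rotate (u i) (a i)) ^ (2 * p)).trace.re ≤
      Fintype.card (Fin m → W → Fin 4) * (Fintype.card W) ^ 2 * (8 * p * m) ^ p := by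
  have h := sum_trace_pow_le (I := Fin m) (Γ := W → Fin 4) (κ := W × W)
    (fun i v => rotate v (a i) ⊗ₖ (rotate v (a i)).map star - phaseMean (a i ⊗ₖ (a i).map star))
    (fun i v => (kronecker_map_star_isHermitian (rotate_isHermitian v (ha i))).sub
      (phaseMean_isHermitian (kronecker_map_star_isHermitian (ha i))))
    (fun i => sum_rotate (a i)) (r := 4) (by norm_num)
    (fun i v v' x => by
      rw [sum_norm_sq_mulVec_eq]
      have hx : ∑ k, ‖x k‖ ^ 2 = ‖(WithLp.toLp 2 x : EuclideanSpace ℂ (W × W))‖ ^ 2 := by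
        rw [EuclideanSpace.norm_sq_eq]
      rw [hx, sub_sub_sub_cancel_right, map_sub, LinearMap.sub_apply]
      set z : EuclideanSpace ℂ (W × W) := WithLp.toLp 2 x
      have h1 := norm_sub_le (Matrix.toEuclideanLin (rotate v (a i) ⊗ₖ (rotate v (a i)).map star) z)
        (Matrix.toEuclideanLin (rotate v' (a i) ⊗ₖ (rotate v' (a i)).map star) z)
      have h2 := (hc i).rotate v z
      have h3 := (hc i).rotate v' z
      calc _ ≤ (2 * ‖z‖) ^ 2 := pow_le_pow_left₀ (norm_nonneg _) (by linarith) 2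
        _ = 4 * ‖z‖ ^ 2 := by ring) p
  have e1 : ∀ u : Fin m → W → Fin 4, phaseDeviation (fun i => rotate (u i) (a i)) =
      ∑ i, (rotate (u i) (a i) ⊗ₖ (rotate (u i) (a i)).map star -
        phaseMean (a i ⊗ₖ (a i).map star)) := by
    intro u
    rw [phaseDeviation, phaseMean_sum, Finset.sum_sub_distrib]
    congr 1
    exact Finset.sum_congr rfl fun i _ => phaseMean_rotate _ _
  simp only [e1]
  refine h.trans (le_of_eq ?_)
  rw [Fintype.card_prod, Fintype.card_fin]
  push_cast
  ring

theorem abs_form_le_of_trace {κ : Type*} [Fintype κ] [DecidableEq κ] {M : Matrix κ κ ℂ}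
    (hM : M.IsHermitian) {p : ℕ} (hp : p ≠ 0) {s : ℝ} (hs : 0 ≤ s)
    (h : (M ^ (2 * p)).trace.re ≤ s ^ (2 * p)) (φ : EuclideanSpace ℂ κ) :
    |(⟪φ, Matrix.toEuclideanLin M φ⟫_ℂ).re| ≤ s * ‖φ‖ ^ 2 := by
  by_cases hφ : φ = 0
  · simp [hφ]
  have hn : 0 < ‖φ‖ := norm_pos_iff.2 hφ
  set z : EuclideanSpace ℂ κ := ((‖φ‖⁻¹ : ℝ) : ℂ) • φ with hz
  have hz1 : ∑ i, ‖z i‖ ^ 2 = 1 := by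
    rw [← EuclideanSpace.norm_sq_eq, hz, norm_smul, Complex.norm_real, norm_inv, norm_norm,
      inv_mul_cancel₀ hn.ne', one_pow]
  have h1 := (re_quadratic_pow_le_trace hM p z.ofLp hz1).trans h
  rw [← inner_toEuclideanLin_eq_dotProduct] at h1
  have h2 : (⟪z, Matrix.toEuclideanLin M z⟫_ℂ).re =
      (⟪φ, Matrix.toEuclideanLin M φ⟫_ℂ).re / ‖φ‖ ^ 2 := by
    rw [hz, map_smul, inner_smul_left, inner_smul_right, Complex.conj_ofReal, ← mul_assoc,
      ← Complex.ofReal_mul, Complex.re_ofReal_mul]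
    field_simp
  rw [h2] at h1
  have h4 : |(⟪φ, Matrix.toEuclideanLin M φ⟫_ℂ).re / ‖φ‖ ^ 2| ≤ s := by
    rw [← (even_two_mul p).pow_abs] at h1
    exact (pow_le_pow_iff_left₀ (abs_nonneg _) hs (by omega)).1 h1
  rw [abs_div, abs_of_nonneg (sq_nonneg ‖φ‖), div_le_iff₀ (by positivity)] at h4
  exact h4

theorem trace_even_pow_nonneg {κ : Type*} [Fintype κ] [DecidableEq κ] {M : Matrix κ κ ℂ}
    (hM : M.IsHermitian) (p : ℕ) : 0 ≤ (M ^ (2 * p)).trace.re := by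
  rcases isEmpty_or_nonempty κ with h | ⟨⟨k⟩⟩
  · simp [Matrix.trace]
  · refine le_trans ?_ (re_quadratic_pow_le_trace hM p (Pi.single k 1) ?_)
    · exact (even_two_mul p).pow_nonneg _
    · rw [Finset.sum_eq_single k]
      · simp
      · intro i _ hi; simp [hi]
      · simp

end Phases

/-! ### Exponential moments of Gaussians -/

theorem lintegral_exp_sq_gaussianReal {v : NNReal} (hv : v ≠ 0) {s : ℝ} (hs : 2 * s * v < 1) :
    ∫⁻ x, ENNReal.ofReal (Real.exp (s * x ^ 2)) ∂(gaussianReal 0 v) =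
      ENNReal.ofReal (Real.sqrt (1 - 2 * s * v))⁻¹ := by
  have hv' : (0 : ℝ) < v := by positivity
  set b : ℝ := (1 - 2 * s * v) / (2 * v) with hb
  have hb0 : 0 < b := div_pos (by linarith) (by positivity)
  rw [gaussianReal_of_var_ne_zero _ hv, lintegral_withDensity_eq_lintegral_mul _
    (measurable_gaussianPDF 0 v) (by fun_prop)]
  have h1 : ∀ x : ℝ, (gaussianPDF 0 v * fun x => ENNReal.ofReal (Real.exp (s * x ^ 2))) x =
      ENNReal.ofReal ((Real.sqrt (2 * Real.pi * v))⁻¹ * Real.exp (-b * x ^ 2)) := by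
    intro x
    rw [Pi.mul_apply, gaussianPDF, ← ENNReal.ofReal_mul (gaussianPDFReal_nonneg _ _ _),
      gaussianPDFReal, mul_assoc, ← Real.exp_add]
    congr 3
    rw [hb]; field_simp; ring
  simp only [h1]
  rw [← ofReal_integral_eq_lintegral_ofReal ((integrable_exp_neg_mul_sq hb0).const_mul _)
    (Filter.Eventually.of_forall fun x => by positivity), integral_const_mul, integral_gaussian]
  congr 1
  rw [← Real.sqrt_inv, ← Real.sqrt_inv, ← Real.sqrt_mul (by positivity)]
  congr 1
  rw [hb]
  have : 1 - 2 * s * v ≠ 0 := by linarith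
  field_simp

theorem lintegral_exp_mul_gaussianReal (v : NNReal) (s : ℝ) :
    ∫⁻ x, ENNReal.ofReal (Real.exp (s * x)) ∂(gaussianReal 0 v) =
      ENNReal.ofReal (Real.exp (v * s ^ 2 / 2)) := by
  rw [← ofReal_integral_eq_lintegral_ofReal (integrable_exp_mul_gaussianReal s)
    (Filter.Eventually.of_forall fun x => by positivity)]
  have h := congrFun (mgf_id_gaussianReal (μ := 0) (v := v)) s
  rw [mgf] at h
  simp only [id, zero_mul, zero_add] at h
  rw [h]

/-- It follows from 1/(1 − x) ≤ exp(x/(1 − x)) and x/(1 − x) ≤ x + 2x². Negative x is included,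
since the two-sided tail bounds need exponents of both signs. -/
theorem inv_sqrt_one_sub_le {x : ℝ} (hx : x ≤ 1 / 2) :
    (Real.sqrt (1 - x))⁻¹ ≤ Real.exp (x / 2 + x ^ 2) := by
  have h0 : 0 < 1 - x := by linarith
  have h1 : 1 / (1 - x) ≤ Real.exp (x + 2 * x ^ 2) := by
    calc 1 / (1 - x) = x / (1 - x) + 1 := by field_simp; ring
      _ ≤ Real.exp (x / (1 - x)) := Real.add_one_le_exp _
      _ ≤ Real.exp (x + 2 * x ^ 2) := by
          apply Real.exp_le_exp.2
          rw [div_le_iff₀ h0]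
          nlinarith [mul_nonneg (sq_nonneg x) (by linarith : 0 ≤ 1 / 2 - x)]
  have h2 : ((Real.sqrt (1 - x))⁻¹) ^ 2 ≤ Real.exp (x / 2 + x ^ 2) ^ 2 := by
    rw [inv_pow, Real.sq_sqrt h0.le, ← Real.exp_nat_mul, ← one_div]
    refine h1.trans (le_of_eq ?_)
    congr 1; push_cast; ring
  exact (sq_le_sq₀ (by positivity) (by positivity)).1 h2

theorem lintegral_exp_norm_sq_real_le {s : ℝ} (hs : s ≤ 1 / 4) :
    ∫⁻ z, ENNReal.ofReal (Real.exp (s * (‖z‖ ^ 2 - 1))) ∂((gaussianReal 0 1).map Complex.ofReal) ≤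
      ENNReal.ofReal (Real.exp (4 * s ^ 2)) := by
  rw [lintegral_map (by fun_prop) (by fun_prop)]
  have h1 : ∀ x : ℝ, ENNReal.ofReal (Real.exp (s * (‖(x : ℂ)‖ ^ 2 - 1))) =
      ENNReal.ofReal (Real.exp (-s)) * ENNReal.ofReal (Real.exp (s * x ^ 2)) := by
    intro x
    rw [← ENNReal.ofReal_mul (by positivity), ← Real.exp_add, Complex.norm_real, Real.norm_eq_abs,
      sq_abs]
    congr 2; ring
  simp only [h1]
  rw [lintegral_const_mul _ (by fun_prop), lintegral_exp_sq_gaussianReal one_ne_zero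
    (by push_cast; linarith), ← ENNReal.ofReal_mul (by positivity)]
  apply ENNReal.ofReal_le_ofReal
  push_cast
  rw [mul_one]
  calc Real.exp (-s) * (Real.sqrt (1 - 2 * s))⁻¹ ≤
        Real.exp (-s) * Real.exp (2 * s / 2 + (2 * s) ^ 2) :=
        mul_le_mul_of_nonneg_left (inv_sqrt_one_sub_le (by linarith)) (by positivity)
    _ = Real.exp (4 * s ^ 2) := by rw [← Real.exp_add]; congr 1; ring

theorem measurable_re_add_im : Measurable fun x : ℝ × ℝ => (x.1 : ℂ) + (x.2 : ℂ) * Complex.I := by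
  fun_prop

theorem lintegral_exp_norm_sq_complex_le {s : ℝ} (hs : s ≤ 1 / 4) :
    ∫⁻ z, ENNReal.ofReal (Real.exp (s * (‖z‖ ^ 2 - 1))) ∂stdComplexGaussian ≤
      ENNReal.ofReal (Real.exp (4 * s ^ 2)) := by
  rw [stdComplexGaussian, lintegral_map (by fun_prop) measurable_re_add_im]
  have h1 : ∀ x : ℝ × ℝ, ENNReal.ofReal (Real.exp (s * (‖(x.1 : ℂ) + x.2 * Complex.I‖ ^ 2 - 1))) =
      ENNReal.ofReal (Real.exp (-s)) * (ENNReal.ofReal (Real.exp (s * x.1 ^ 2)) *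
        ENNReal.ofReal (Real.exp (s * x.2 ^ 2))) := by
    intro x
    rw [← ENNReal.ofReal_mul (by positivity), ← ENNReal.ofReal_mul (by positivity), ← Real.exp_add,
      ← Real.exp_add, Complex.sq_norm, Complex.normSq_add_mul_I]
    congr 2; ring
  have hv : ((1 / 2 : NNReal) : ℝ) = 1 / 2 := by norm_num
  have h2 : ∫⁻ x, ENNReal.ofReal (Real.exp (s * x ^ 2)) ∂(gaussianReal 0 (1 / 2)) =
      ENNReal.ofReal (Real.sqrt (1 - s))⁻¹ := by
    rw [lintegral_exp_sq_gaussianReal (by simp) (by rw [hv]; linarith), hv]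
    congr 4; ring
  simp only [h1]
  rw [lintegral_const_mul _ (by fun_prop), lintegral_prod_mul
    (f := fun x => ENNReal.ofReal (Real.exp (s * x ^ 2)))
    (g := fun x => ENNReal.ofReal (Real.exp (s * x ^ 2))) (by fun_prop) (by fun_prop), h2,
    ← ENNReal.ofReal_mul (by positivity), ← ENNReal.ofReal_mul (by positivity)]
  apply ENNReal.ofReal_le_ofReal
  have h3 := inv_sqrt_one_sub_le (x := s) (by linarith)
  calc Real.exp (-s) * ((Real.sqrt (1 - s))⁻¹ * (Real.sqrt (1 - s))⁻¹) ≤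
        Real.exp (-s) * (Real.exp (s / 2 + s ^ 2) * Real.exp (s / 2 + s ^ 2)) := by gcongr
    _ = Real.exp (2 * s ^ 2) := by rw [← Real.exp_add, ← Real.exp_add]; congr 1; ring
    _ ≤ Real.exp (4 * s ^ 2) := Real.exp_le_exp.2 (by nlinarith [sq_nonneg s])

theorem lintegral_exp_re_le (s : ℝ) :
    ∫⁻ z, ENNReal.ofReal (Real.exp (s * z.re)) ∂((gaussianReal 0 1).map Complex.ofReal) ≤
      ENNReal.ofReal (Real.exp (s ^ 2 / 2)) := by
  rw [lintegral_map (by fun_prop) (by fun_prop)]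
  simp only [Complex.ofReal_re]
  rw [lintegral_exp_mul_gaussianReal]
  simp

/-- Integrating out the second Gaussian leaves exp(s²x²/2), a Gaussian integral of the first. -/
theorem lintegral_exp_re_mul_re_le {s : ℝ} (hs : |s| ≤ 1 / 2) :
    ∫⁻ z, ENNReal.ofReal (Real.exp (s * (z.1.re * z.2.re)))
      ∂(((gaussianReal 0 1).map Complex.ofReal).prod ((gaussianReal 0 1).map Complex.ofReal)) ≤
      ENNReal.ofReal (Real.exp (4 * s ^ 2)) := by
  have hs2 : s ^ 2 ≤ 1 / 4 := by
    rw [← sq_abs]; nlinarith [abs_nonneg s]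
  rw [lintegral_prod _ (by fun_prop), lintegral_map (Measurable.lintegral_prod_right'
    (f := fun z : ℂ × ℂ => ENNReal.ofReal (Real.exp (s * (z.1.re * z.2.re)))) (by fun_prop))
    (by fun_prop)]
  have h1 : ∀ x : ℝ, ∫⁻ w, ENNReal.ofReal (Real.exp (s * ((x : ℂ).re * w.re)))
      ∂((gaussianReal 0 1).map Complex.ofReal) =
      ENNReal.ofReal (Real.exp (s ^ 2 / 2 * x ^ 2)) := by
    intro x
    rw [lintegral_map (by fun_prop) (by fun_prop)]
    simp only [Complex.ofReal_re, ← mul_assoc]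
    rw [lintegral_exp_mul_gaussianReal]
    congr 2; push_cast; ring
  simp only [h1]
  rw [lintegral_exp_sq_gaussianReal one_ne_zero (by push_cast; linarith)]
  apply ENNReal.ofReal_le_ofReal
  push_cast
  have h2 := inv_sqrt_one_sub_le (x := s ^ 2) (by linarith)
  calc (Real.sqrt (1 - 2 * (s ^ 2 / 2) * 1))⁻¹ = (Real.sqrt (1 - s ^ 2))⁻¹ := by congr 3; ring
    _ ≤ Real.exp (s ^ 2 / 2 + (s ^ 2) ^ 2) := h2
    _ ≤ Real.exp (4 * s ^ 2) := Real.exp_le_exp.2 (by nlinarith [sq_nonneg s])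

/-- A quarter turn is (x, y) ↦ (−y, x), and the two parts are independent, symmetric and of equal
variance. -/
theorem measurePreserving_mul_I_stdComplexGaussian :
    MeasurePreserving (fun z : ℂ => Complex.I * z) stdComplexGaussian stdComplexGaussian := by
  refine ⟨by fun_prop, ?_⟩
  rw [stdComplexGaussian, Measure.map_map (by fun_prop) measurable_re_add_im]
  have hneg : MeasurePreserving (fun x : ℝ => -x) (gaussianReal 0 (1 / 2))
      (gaussianReal 0 (1 / 2)) := ⟨by fun_prop, by rw [gaussianReal_map_neg, neg_zero]⟩
  have h1 : MeasurePreserving (fun x : ℝ × ℝ => (-x.2, x.1))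
      ((gaussianReal 0 (1 / 2)).prod (gaussianReal 0 (1 / 2)))
      ((gaussianReal 0 (1 / 2)).prod (gaussianReal 0 (1 / 2))) :=
    (hneg.prod (MeasurePreserving.id _)).comp Measure.measurePreserving_swap
  conv_rhs => rw [← h1.map_eq, Measure.map_map measurable_re_add_im h1.measurable]
  congr 1
  funext x
  apply Complex.ext <;> simp

theorem measurePreserving_phase_stdComplexGaussian (k l : Fin 4) :
    MeasurePreserving (fun z : ℂ => phase k * z * star (phase l)) stdComplexGaussian
      stdComplexGaussian := by
  have h : ∀ j : ℕ, MeasurePreserving (fun z : ℂ => Complex.I ^ j * z) stdComplexGaussian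
      stdComplexGaussian := by
    intro j
    induction j with
    | zero => simp only [pow_zero, one_mul]; exact MeasurePreserving.id _
    | succ j ih =>
      have := measurePreserving_mul_I_stdComplexGaussian.comp ih
      refine (by convert this using 1; funext z; simp [pow_succ]; ring)
  have hstar : star (phase l) = Complex.I ^ (3 * (l : ℕ)) := by
    rw [phase, star_pow, pow_mul, Complex.star_def, Complex.conj_I]
    congr 1
    rw [show (3 : ℕ) = 2 + 1 from rfl, pow_succ, Complex.I_sq]; ring
  have := h ((k : ℕ) + 3 * (l : ℕ))
  convert this using 1
  funext z
  rw [hstar, phase, pow_add]; ring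

instance : IsProbabilityMeasure stdComplexGaussian :=
  Measure.isProbabilityMeasure_map measurable_re_add_im.aemeasurable

instance : IsProbabilityMeasure ((gaussianReal 0 1).map Complex.ofReal) :=
  Measure.isProbabilityMeasure_map (by fun_prop)

/-! ### The law of the Gaussian arrays -/

section Arrays

variable (W : Type*) [LinearOrder W]

/-- The positions on and above the diagonal. -/
abbrev UpperPair : Type _ := {p : W × W // p.1 ≤ p.2}

variable {W}

/-- The law of one entry of a Hermitian Gaussian array. -/
def entryLaw (p : UpperPair W) : Measure ℂ :=
  if p.1.1 = p.1.2 then (gaussianReal 0 1).map Complex.ofReal else stdComplexGaussian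

instance (p : UpperPair W) : IsProbabilityMeasure (entryLaw p) := by
  rw [entryLaw]; split_ifs <;> infer_instance

/-- The Hermitian array with given entries on and above the diagonal. -/
def hermArray (y : UpperPair W → ℂ) (α β : W) : ℂ :=
  if h : α < β then y ⟨(α, β), h.le⟩
  else if h' : β < α then star (y ⟨(β, α), h'.le⟩) else ((y ⟨(α, α), le_rfl⟩).re : ℂ)

theorem hermArray_of_lt (y : UpperPair W → ℂ) {α β : W} (h : α < β) :
    hermArray y α β = y ⟨(α, β), h.le⟩ := by rw [hermArray, dif_pos h]

theorem hermArray_of_gt (y : UpperPair W → ℂ) {α β : W} (h : β < α) :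
    hermArray y α β = star (y ⟨(β, α), h.le⟩) := by
  rw [hermArray, dif_neg h.not_gt, dif_pos h]

theorem hermArray_self (y : UpperPair W → ℂ) (α : W) :
    hermArray y α α = ((y ⟨(α, α), le_rfl⟩).re : ℂ) := by
  rw [hermArray, dif_neg (lt_irrefl α), dif_neg (lt_irrefl α)]

theorem star_hermArray (y : UpperPair W → ℂ) (α β : W) :
    star (hermArray y α β) = hermArray y β α := by
  rcases lt_trichotomy α β with h | rfl | h
  · rw [hermArray_of_lt y h, hermArray_of_gt y h]
  · rw [hermArray_self]; exact Complex.conj_ofReal _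
  · rw [hermArray_of_gt y h, hermArray_of_lt y h, star_star]

theorem hermArray_eq (g : W → W → ℂ) (hg : ∀ α β, g α β = star (g β α)) (α β : W) :
    hermArray (fun p => g p.1.1 p.1.2) α β = g α β := by
  rcases lt_trichotomy α β with h | rfl | h
  · rw [hermArray_of_lt _ h]
  · rw [hermArray_self]
    exact Complex.conj_eq_iff_re.1 (hg α α).symm
  · rw [hermArray_of_gt _ h, ← hg]

theorem continuous_hermArray (α β : W) : Continuous fun y : UpperPair W → ℂ => hermArray y α β := by
  rcases lt_trichotomy α β with h | rfl | h
  · simp only [hermArray_of_lt _ h]; fun_prop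
  · simp only [hermArray_self]; fun_prop
  · simp only [hermArray_of_gt _ h]; fun_prop

variable [Fintype W]

variable (W) in
/-- The law of a Hermitian Gaussian array. -/
def rowLaw : Measure (UpperPair W → ℂ) := Measure.pi entryLaw

instance : IsProbabilityMeasure (rowLaw W) := by rw [rowLaw]; infer_instance

variable (W) in
/-- The law of `m` independent Hermitian Gaussian arrays. -/
def arrayLaw (m : ℕ) : Measure (Fin m → UpperPair W → ℂ) := Measure.pi fun _ => rowLaw W

instance (m : ℕ) : IsProbabilityMeasure (arrayLaw W m) := by rw [arrayLaw]; infer_instance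

theorem pi_prod_eq_map_uncurry {I J : Type*} [Fintype I] [Fintype J] (ρ : J → Measure ℂ)
    [∀ j, IsProbabilityMeasure (ρ j)] :
    (Measure.pi fun k : I × J => ρ k.2) =
      (Measure.pi fun _ : I => Measure.pi ρ).map Function.uncurry := by
  have hmeas : Measurable (Function.uncurry : (I → J → ℂ) → I × J → ℂ) := measurable_uncurry
  refine Measure.pi_eq fun s hs => ?_
  rw [Measure.map_apply hmeas (MeasurableSet.univ_pi hs)]
  have h : Function.uncurry ⁻¹' Set.univ.pi s =
      Set.univ.pi fun i : I => Set.univ.pi fun j : J => s (i, j) := by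
    ext y
    simp only [Set.mem_preimage, Set.mem_univ_pi, Function.uncurry]
    exact ⟨fun h i j => h (i, j), fun h k => h k.1 k.2⟩
  rw [h, Measure.pi_pi, Fintype.prod_prod_type]
  exact Finset.prod_congr rfl fun i _ => by rw [Measure.pi_pi]

/-- All probabilities are computed under the explicit product law, where independent factors can be
rotated and integrated separately. -/
theorem IsHermitianGaussian.hasLaw {Ω : Type*} [MeasurableSpace Ω] {P : Measure Ω}
    [IsProbabilityMeasure P] {m : ℕ} {g : Fin m → W → W → Ω → ℂ} (hg : IsHermitianGaussian P g) :
    HasLaw (fun ω i (p : UpperPair W) => g i p.1.1 p.1.2 ω) (arrayLaw W m) P := by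
  have h1 : ∀ k : Fin m × UpperPair W, HasLaw (g k.1 k.2.1.1 k.2.1.2) (entryLaw k.2) P := by
    rintro ⟨i, ⟨⟨α, β⟩, h⟩⟩
    rw [entryLaw]
    split_ifs with he
    · change α = β at he
      subst he
      exact hg.law_diag i α
    · exact hg.law_offDiag i α β (lt_of_le_of_ne h he)
  have h2 := hg.indep.hasLaw_pi h1
  have hcurry : Measurable (Function.curry : (Fin m × UpperPair W → ℂ) → Fin m → UpperPair W → ℂ) :=
    measurable_curry
  have huncurry : Measurable
      (Function.uncurry : (Fin m → UpperPair W → ℂ) → Fin m × UpperPair W → ℂ) :=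
    measurable_uncurry
  refine ⟨hcurry.comp_aemeasurable h2.aemeasurable, ?_⟩
  have h3 := AEMeasurable.map_map_of_aemeasurable (hcurry.aemeasurable) h2.aemeasurable
  have h4 : (fun ω i (p : UpperPair W) => g i p.1.1 p.1.2 ω) =
      Function.curry ∘ fun ω (k : Fin m × UpperPair W) => g k.1 k.2.1.1 k.2.1.2 ω := rfl
  rw [h4, ← h3, h2.map_eq, pi_prod_eq_map_uncurry, Measure.map_map hcurry huncurry]
  exact Measure.map_id

/-! ### Rotating the arrays by phases -/

/-- The action of diagonal phases on the entries above the diagonal. -/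
def rotateEntries {m : ℕ} (u : Fin m → W → Fin 4) (y : Fin m → UpperPair W → ℂ) :
    Fin m → UpperPair W → ℂ :=
  fun i p => phase (u i p.1.1) * y i p * star (phase (u i p.1.2))

/-- Above the diagonal the law is invariant under quarter turns; on the diagonal the two phases
cancel. -/
theorem measurePreserving_rotateEntries {m : ℕ} (u : Fin m → W → Fin 4) :
    MeasurePreserving (rotateEntries u) (arrayLaw W m) (arrayLaw W m) := by
  refine measurePreserving_pi (fun _ => rowLaw W) (fun _ => rowLaw W)
    (f := fun i (y : UpperPair W → ℂ) p => phase (u i p.1.1) * y p * star (phase (u i p.1.2)))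
    fun i => ?_
  refine measurePreserving_pi entryLaw entryLaw
    (f := fun p (z : ℂ) => phase (u i p.1.1) * z * star (phase (u i p.1.2))) fun p => ?_
  rw [entryLaw]
  split_ifs with h
  · rw [h]
    have : (fun z : ℂ => phase (u i p.1.2) * z * star (phase (u i p.1.2))) = id := by
      funext z
      calc _ = z * (phase (u i p.1.2) * star (phase (u i p.1.2))) := by ring
        _ = z := by rw [phase_mul_star, mul_one]
    rw [this]
    exact MeasurePreserving.id _
  · exact measurePreserving_phase_stdComplexGaussian _ _

theorem hermArray_rotateEntries {m : ℕ} (u : Fin m → W → Fin 4) (y : Fin m → UpperPair W → ℂ)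
    (i : Fin m) (α β : W) :
    hermArray (rotateEntries u y i) α β =
      phase (u i α) * hermArray (y i) α β * star (phase (u i β)) := by
  rcases lt_trichotomy α β with h | rfl | h
  · rw [hermArray_of_lt _ h, hermArray_of_lt _ h]; rfl
  · rw [hermArray_self, hermArray_self]
    have : ∀ z : ℂ, phase (u i α) * z * star (phase (u i α)) = z := fun z => by
      calc _ = z * (phase (u i α) * star (phase (u i α))) := by ring
        _ = z := by rw [phase_mul_star, mul_one]
    rw [this, rotateEntries, this]
  · rw [hermArray_of_gt _ h, hermArray_of_gt _ h, rotateEntries, star_mul', star_mul', star_star]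
    ring

/-- The block of the ansatz in the energy window. -/
def ansatz (μ : W → ℝ) (F : W → W → ℝ) (y : UpperPair W → ℂ) : Matrix W W ℂ :=
  Matrix.of fun α β => (if α = β then (μ α : ℂ) else 0) +
    (F α β : ℂ) / (Real.sqrt (Fintype.card W) : ℂ) * hermArray y α β

theorem ansatz_isHermitian (μ : W → ℝ) {F : W → W → ℝ} (hF : ∀ α β, F α β = F β α)
    (y : UpperPair W → ℂ) : (ansatz μ F y).IsHermitian := by
  ext α β
  rw [Matrix.conjTranspose_apply, ansatz, Matrix.of_apply, Matrix.of_apply, star_add, star_mul',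
    star_hermArray, hF β α, star_div₀]
  simp only [Complex.star_def, Complex.conj_ofReal]
  congr 1
  by_cases h : α = β
  · subst h; simp
  · simp [h, Ne.symm h]

theorem ansatz_rotateEntries {m : ℕ} (μ : W → ℝ) (F : W → W → ℝ) (u : Fin m → W → Fin 4)
    (y : Fin m → UpperPair W → ℂ) (i : Fin m) :
    ansatz μ F (rotateEntries u y i) = rotate (u i) (ansatz μ F (y i)) := by
  ext α β
  rw [ansatz, rotate, Matrix.of_apply, Matrix.of_apply, ansatz, Matrix.of_apply,
    hermArray_rotateEntries]
  by_cases h : α = β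
  · subst h
    have : phase (u i α) * (μ α : ℂ) * star (phase (u i α)) = μ α := by
      calc _ = μ α * (phase (u i α) * star (phase (u i α))) := by ring
        _ = μ α := by rw [phase_mul_star, mul_one]
    rw [if_pos rfl, mul_add, add_mul, this]; ring
  · rw [if_neg h]; ring

theorem continuous_ansatz (μ : W → ℝ) (F : W → W → ℝ) : Continuous (ansatz μ F) := by
  refine continuous_matrix fun α β => ?_
  simp only [ansatz, Matrix.of_apply]
  exact continuous_const.add (continuous_const.mul (continuous_hermArray α β))

end Arrays

/-! ### A Chernoff bound -/

theorem pi_measure_sum_ge_le {X : Type*} [MeasurableSpace X] (ρ : Measure X)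
    [IsProbabilityMeasure ρ] {m : ℕ} {ξ : Fin m → X → ℝ} (hξ : ∀ i, Measurable (ξ i)) {s T : ℝ}
    {c : Fin m → ℝ}
    (h : ∀ i, ∫⁻ x, ENNReal.ofReal (Real.exp (s * ξ i x)) ∂ρ ≤ ENNReal.ofReal (Real.exp (c i))) :
    (Measure.pi fun _ : Fin m => ρ) {y | T ≤ s * ∑ i, ξ i (y i)} ≤
      ENNReal.ofReal (Real.exp (∑ i, c i - T)) := by
  set ν := Measure.pi fun _ : Fin m => ρ
  have hind : iIndepFun (fun i (y : Fin m → X) => ENNReal.ofReal (Real.exp (s * ξ i (y i)))) ν :=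
    iIndepFun_pi (X := fun i x => ENNReal.ofReal (Real.exp (s * ξ i x)))
      fun i => by have := hξ i; fun_prop
  have hprod := lintegral_prod_eq_prod_lintegral_of_indepFun Finset.univ _ hind
    (fun i => by have := hξ i; fun_prop)
  have hcoord : ∀ i, ∫⁻ y, ENNReal.ofReal (Real.exp (s * ξ i (y i))) ∂ν =
      ∫⁻ x, ENNReal.ofReal (Real.exp (s * ξ i x)) ∂ρ := fun i =>
    (measurePreserving_eval (fun _ : Fin m => ρ) i).lintegral_comp
      (f := fun x => ENNReal.ofReal (Real.exp (s * ξ i x))) (by have := hξ i; fun_prop)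
  have hbound : ∫⁻ y, ENNReal.ofReal (Real.exp (s * ∑ i, ξ i (y i))) ∂ν ≤
      ENNReal.ofReal (Real.exp (∑ i, c i)) := by
    have e1 : ∀ y : Fin m → X, ENNReal.ofReal (Real.exp (s * ∑ i, ξ i (y i))) =
        ∏ i, ENNReal.ofReal (Real.exp (s * ξ i (y i))) := by
      intro y
      rw [Finset.mul_sum, Real.exp_sum, ENNReal.ofReal_prod_of_nonneg fun i _ => by positivity]
    simp only [e1]
    rw [hprod, Real.exp_sum, ENNReal.ofReal_prod_of_nonneg fun i _ => by positivity]
    exact Finset.prod_le_prod' fun i _ => (hcoord i).le.trans (h i)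
  have hset : {y : Fin m → X | T ≤ s * ∑ i, ξ i (y i)} =
      {y | ENNReal.ofReal (Real.exp T) ≤ ENNReal.ofReal (Real.exp (s * ∑ i, ξ i (y i)))} := by
    ext y
    rw [Set.mem_ofPred_eq, Set.mem_ofPred_eq, ENNReal.ofReal_le_ofReal_iff (by positivity),
      Real.exp_le_exp]
  rw [hset]
  have hm : Measurable fun y : Fin m → X => ENNReal.ofReal (Real.exp (s * ∑ i, ξ i (y i))) := by
    have : Measurable fun y : Fin m → X => ∑ i, ξ i (y i) :=
      Finset.measurable_sum _ fun i _ => (hξ i).comp (measurable_pi_apply i)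
    fun_prop
  refine (meas_ge_le_lintegral_div hm.aemeasurable (by simp [Real.exp_pos]) (by simp)).trans ?_
  rw [Real.exp_sub, ENNReal.ofReal_div_of_pos (by positivity)]
  exact ENNReal.div_le_div_right hbound _

theorem pi_measure_abs_sum_gt_le {X : Type*} [MeasurableSpace X] (ρ : Measure X)
    [IsProbabilityMeasure ρ] {m : ℕ} {ξ : Fin m → X → ℝ} (hξ : ∀ i, Measurable (ξ i)) {s T : ℝ}
    (hs : 0 < s) {c : Fin m → ℝ}
    (h : ∀ i s', |s'| = s →
      ∫⁻ x, ENNReal.ofReal (Real.exp (s' * ξ i x)) ∂ρ ≤ ENNReal.ofReal (Real.exp (c i))) :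
    (Measure.pi fun _ : Fin m => ρ) {y | T < |∑ i, ξ i (y i)|} ≤
      ENNReal.ofReal (2 * Real.exp (∑ i, c i - s * T)) := by
  have h1 := pi_measure_sum_ge_le ρ hξ (T := s * T) fun i => h i s (abs_of_pos hs)
  have h2 := pi_measure_sum_ge_le ρ hξ (T := s * T) fun i => h i (-s)
    (by rw [abs_neg, abs_of_pos hs])
  have hsub : {y : Fin m → X | T < |∑ i, ξ i (y i)|} ⊆
      {y | s * T ≤ s * ∑ i, ξ i (y i)} ∪ {y | s * T ≤ -s * ∑ i, ξ i (y i)} := by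
    intro y hy
    rcases lt_abs.1 (by simpa only [Set.mem_ofPred_eq] using hy : T < |∑ i, ξ i (y i)|) with hy | hy
    · exact Or.inl (mul_le_mul_of_nonneg_left hy.le hs.le)
    · refine Or.inr ?_
      have := mul_le_mul_of_nonneg_left hy.le hs.le
      rw [Set.mem_ofPred_eq]
      linarith
  refine (measure_mono hsub).trans ((measure_union_le _ _).trans ((add_le_add h1 h2).trans ?_))
  rw [← ENNReal.ofReal_add (by positivity) (by positivity), two_mul]

open scoped InnerProductSpace

/-! ### The exceptional events -/

section Events

variable {W : Type*} [LinearOrder W] [Fintype W]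

theorem lintegral_rowLaw_entry (p : UpperPair W) {h : ℂ → ℝ≥0∞} (hh : Measurable h) :
    ∫⁻ y, h (y p) ∂(rowLaw W) = ∫⁻ z, h z ∂(entryLaw p) :=
  (measurePreserving_eval entryLaw p).lintegral_comp hh

theorem lintegral_exp_hermArray_le {s : ℝ} (hs : s ≤ 1 / 4) (α β : W) :
    ∫⁻ y, ENNReal.ofReal (Real.exp (s * (‖hermArray y α β‖ ^ 2 - 1))) ∂(rowLaw W) ≤
      ENNReal.ofReal (Real.exp (4 * s ^ 2)) := by
  have hlt : ∀ {α β : W} (h : α < β), ∫⁻ y : UpperPair W → ℂ, ENNReal.ofReal (Real.exp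
      (s * (‖y ⟨(α, β), h.le⟩‖ ^ 2 - 1))) ∂(rowLaw W) ≤ ENNReal.ofReal (Real.exp (4 * s ^ 2)) := by
    intro α β h
    rw [lintegral_rowLaw_entry ⟨(α, β), h.le⟩
      (h := fun z => ENNReal.ofReal (Real.exp (s * (‖z‖ ^ 2 - 1)))) (by fun_prop), entryLaw,
      if_neg h.ne]
    exact lintegral_exp_norm_sq_complex_le hs
  rcases lt_trichotomy α β with h | rfl | h
  · simp only [hermArray_of_lt _ h]; exact hlt h
  · simp only [hermArray_self]
    rw [lintegral_rowLaw_entry ⟨(α, α), le_rfl⟩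
      (h := fun z => ENNReal.ofReal (Real.exp (s * (‖(z.re : ℂ)‖ ^ 2 - 1)))) (by fun_prop), entryLaw,
      if_pos rfl]
    refine le_trans (le_of_eq ?_) (lintegral_exp_norm_sq_real_le hs)
    rw [lintegral_map (by fun_prop) (by fun_prop), lintegral_map (by fun_prop) (by fun_prop)]
    rfl
  · simp only [hermArray_of_gt _ h, norm_star]; exact hlt h

theorem lintegral_exp_re_hermArray_le (s : ℝ) (α : W) :
    ∫⁻ y, ENNReal.ofReal (Real.exp (s * (hermArray y α α).re)) ∂(rowLaw W) ≤
      ENNReal.ofReal (Real.exp (s ^ 2 / 2)) := by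
  simp only [hermArray_self, Complex.ofReal_re]
  rw [lintegral_rowLaw_entry ⟨(α, α), le_rfl⟩
    (h := fun z => ENNReal.ofReal (Real.exp (s * z.re))) (by fun_prop), entryLaw, if_pos rfl]
  exact lintegral_exp_re_le s

theorem lintegral_exp_re_mul_re_hermArray_le {s : ℝ} (hs : |s| ≤ 1 / 2) {α γ : W} (hαγ : α ≠ γ) :
    ∫⁻ y, ENNReal.ofReal (Real.exp (s * ((hermArray y α α).re * (hermArray y γ γ).re)))
      ∂(rowLaw W) ≤ ENNReal.ofReal (Real.exp (4 * s ^ 2)) := by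
  simp only [hermArray_self, Complex.ofReal_re]
  set p : UpperPair W := ⟨(α, α), le_rfl⟩ with hp
  set q : UpperPair W := ⟨(γ, γ), le_rfl⟩ with hq
  have hpq : p ≠ q := fun h => hαγ (congrArg (fun r : UpperPair W => r.1.1) h)
  have hind : iIndepFun (fun (r : UpperPair W) (y : UpperPair W → ℂ) => y r) (rowLaw W) :=
    iIndepFun_pi (X := fun _ (z : ℂ) => z) fun r => by fun_prop
  have hlaw := IndepFun.hasLaw_prod (μ := entryLaw p) (ν := entryLaw q)
    (measurePreserving_eval entryLaw p).hasLaw (measurePreserving_eval entryLaw q).hasLaw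
    (hind.indepFun hpq)
  have h := hlaw.lintegral_comp
    (f := fun z : ℂ × ℂ => ENNReal.ofReal (Real.exp (s * (z.1.re * z.2.re)))) (by fun_prop)
  have hep : entryLaw p = (gaussianReal 0 1).map Complex.ofReal := if_pos rfl
  have heq : entryLaw q = (gaussianReal 0 1).map Complex.ofReal := if_pos rfl
  refine (le_of_eq h).trans ?_
  rw [hep, heq]
  exact lintegral_exp_re_mul_re_le hs

theorem measurable_hermArray (α β : W) : Measurable fun y : UpperPair W → ℂ => hermArray y α β :=
  (continuous_hermArray α β).measurable

theorem arrayLaw_norm_sq_le {m : ℕ} {s : ℝ} (hs : 0 < s) (hs' : s ≤ 1 / 4) (T : ℝ) (α β : W) :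
    arrayLaw W m {y | T < |∑ i, (‖hermArray (y i) α β‖ ^ 2 - 1)|} ≤
      ENNReal.ofReal (2 * Real.exp (4 * m * s ^ 2 - s * T)) := by
  have h := pi_measure_abs_sum_gt_le (rowLaw W) (m := m) (T := T)
    (ξ := fun _ y => ‖hermArray y α β‖ ^ 2 - 1)
    (fun _ => by have := measurable_hermArray α β; fun_prop) hs (c := fun _ => 4 * s ^ 2)
    (fun _ s' hs2 => by
      rw [← sq_abs s, abs_of_pos hs, ← hs2, sq_abs]
      exact lintegral_exp_hermArray_le ((le_abs_self s').trans (hs2.le.trans hs')) α β)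
  refine h.trans (le_of_eq ?_)
  rw [Finset.sum_const, Finset.card_univ, Fintype.card_fin, nsmul_eq_mul]
  congr 4; ring

theorem arrayLaw_re_mul_re_le {m : ℕ} {s : ℝ} (hs : 0 < s) (hs' : s ≤ 1 / 4) (T : ℝ) {α γ : W}
    (hαγ : α ≠ γ) :
    arrayLaw W m {y | T < |∑ i, (hermArray (y i) α α).re * (hermArray (y i) γ γ).re|} ≤
      ENNReal.ofReal (2 * Real.exp (4 * m * s ^ 2 - s * T)) := by
  have h := pi_measure_abs_sum_gt_le (rowLaw W) (m := m) (T := T)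
    (ξ := fun _ y => (hermArray y α α).re * (hermArray y γ γ).re)
    (fun _ => by
      have := measurable_hermArray (W := W) α α
      have := measurable_hermArray (W := W) γ γ
      fun_prop) hs (c := fun _ => 4 * s ^ 2)
    (fun _ s' hs2 => by
      rw [← sq_abs s, abs_of_pos hs, ← hs2, sq_abs]
      exact lintegral_exp_re_mul_re_hermArray_le (by rw [hs2]; linarith) hαγ)
  refine h.trans (le_of_eq ?_)
  rw [Finset.sum_const, Finset.card_univ, Fintype.card_fin, nsmul_eq_mul]
  congr 4; ring

theorem arrayLaw_mul_re_le {m : ℕ} {s : ℝ} (hs : 0 < s) (T : ℝ) (γ : W) {b : Fin m → ℝ}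
    (hb : ∑ i, b i ^ 2 ≤ 6 * m) :
    arrayLaw W m {y | T < |∑ i, b i * (hermArray (y i) γ γ).re|} ≤
      ENNReal.ofReal (2 * Real.exp (4 * m * s ^ 2 - s * T)) := by
  have h := pi_measure_abs_sum_gt_le (rowLaw W) (m := m) (T := T)
    (ξ := fun i y => b i * (hermArray y γ γ).re)
    (fun _ => by have := measurable_hermArray (W := W) γ γ; fun_prop) hs
    (c := fun i => (s * b i) ^ 2 / 2)
    (fun i s' hs2 => by
      have := lintegral_exp_re_hermArray_le (s' * b i) γ
      simp only [← mul_assoc]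
      refine this.trans (le_of_eq ?_)
      rw [mul_pow, mul_pow, ← sq_abs s', hs2])
  refine h.trans (ENNReal.ofReal_le_ofReal ?_)
  gcongr
  have e : ∑ i, (s * b i) ^ 2 / 2 = s ^ 2 / 2 * ∑ i, b i ^ 2 := by
    rw [Finset.mul_sum]; exact Finset.sum_congr rfl fun i _ => by ring
  rw [e]
  have h1 := mul_le_mul_of_nonneg_left hb (by positivity : 0 ≤ s ^ 2 / 2)
  have h2 : 0 ≤ s ^ 2 * m := by positivity
  linarith

theorem continuous_kronecker_map_star : Continuous fun a : Matrix W W ℂ => a ⊗ₖ a.map star := by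
  refine continuous_matrix fun x y => ?_
  simp only [Matrix.kroneckerMap_apply, Matrix.map_apply]
  fun_prop

/-- Closedness gives measurability of the event that the ansatz blocks are contractions, although
the condition quantifies over all vectors. -/
theorem isClosed_pairContraction : IsClosed {a : Matrix W W ℂ | PairContraction a} := by
  simp only [PairContraction, Set.ofPred_forall]
  refine isClosed_iInter fun φ => isClosed_le ?_ continuous_const
  have hK := continuous_kronecker_map_star (W := W)
  have : Continuous fun a : Matrix W W ℂ => (a ⊗ₖ a.map star).mulVec φ.ofLp :=
    hK.matrix_mulVec continuous_const
  have h2 : Continuous fun a : Matrix W W ℂ =>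
      Matrix.toEuclideanLin (a ⊗ₖ a.map star) φ := by
    have h3 := (PiLp.continuous_toLp 2 (fun _ : W × W => ℂ)).comp this
    exact h3
  exact h2.norm

theorem continuous_phaseDeviation {m : ℕ} :
    Continuous fun a : Fin m → Matrix W W ℂ => phaseDeviation a := by
  have h : Continuous fun a : Fin m → Matrix W W ℂ => ∑ i, a i ⊗ₖ (a i).map star :=
    continuous_finsetSum _ fun i _ => continuous_kronecker_map_star.comp (continuous_apply i)
  refine h.sub (continuous_matrix fun x y => ?_)
  simp only [phaseMean, Matrix.of_apply]
  split_ifs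
  · exact h.matrix_elem x y
  · exact continuous_const

theorem rotate_neg_rotate (u : W → Fin 4) (a : Matrix W W ℂ) : rotate (-u) (rotate u a) = a := by
  have h : ∀ k : Fin 4, phase (-k) = star (phase k) := by
    intro k
    have e2 : ((-2 : Fin 4) : ℕ) = 2 := by decide
    have e3 : ((-3 : Fin 4) : ℕ) = 1 := by decide
    fin_cases k <;> simp [phase, pow_succ, e2, e3]
  have h' : ∀ k : Fin 4, star (phase k) * phase k = 1 := fun k => by
    rw [mul_comm, phase_mul_star]
  ext α β
  simp only [rotate, Matrix.of_apply, Pi.neg_apply, h, star_star]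
  calc _ = (star (phase (u α)) * phase (u α)) * a α β * (star (phase (u β)) * phase (u β)) := by
        ring
    _ = a α β := by rw [h', h', one_mul, mul_one]

theorem pairContraction_rotate_iff (u : W → Fin 4) (a : Matrix W W ℂ) :
    PairContraction (rotate u a) ↔ PairContraction a :=
  ⟨fun h => by have := h.rotate (-u); rwa [rotate_neg_rotate] at this, fun h => h.rotate u⟩

/-- Randomization by phases: the contraction event is invariant under rotations and the law of the
arrays is too, so the expected trace moment on the event equals its average over phases. That
average is bounded for every fixed array, and Markov's inequality gives the tail. -/
theorem arrayLaw_phaseDeviation_le {m : ℕ} (μ : Fin m → W → ℝ) {F : W → W → ℝ}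
    (hF : ∀ α β, F α β = F β α) (p : ℕ) {T : ℝ} (hT : 0 < T) :
    MeasurableSet {y : Fin m → UpperPair W → ℂ | (∀ i, PairContraction (ansatz (μ i) F (y i))) ∧
        T ≤ ((phaseDeviation fun i => ansatz (μ i) F (y i)) ^ (2 * p)).trace.re} ∧
      arrayLaw W m {y | (∀ i, PairContraction (ansatz (μ i) F (y i))) ∧
        T ≤ ((phaseDeviation fun i => ansatz (μ i) F (y i)) ^ (2 * p)).trace.re} ≤
      ENNReal.ofReal ((Fintype.card W) ^ 2 * (8 * p * m) ^ p / T) := by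
  set C : Set (Fin m → UpperPair W → ℂ) := {y | ∀ i, PairContraction (ansatz (μ i) F (y i))} with hC
  set τ : (Fin m → UpperPair W → ℂ) → ℝ := fun y =>
    ((phaseDeviation fun i => ansatz (μ i) F (y i)) ^ (2 * p)).trace.re with hτ
  have hans : ∀ i, Continuous fun y : Fin m → UpperPair W → ℂ => ansatz (μ i) F (y i) := fun i =>
    (continuous_ansatz (μ i) F).comp (continuous_apply i)
  have hCm : MeasurableSet C := by
    rw [hC, Set.ofPred_forall]
    exact MeasurableSet.iInter fun i =>
      (isClosed_pairContraction.preimage (hans i)).measurableSet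
  have hτc : Continuous τ := by
    have h1 : Continuous fun y : Fin m → UpperPair W → ℂ =>
        phaseDeviation fun i => ansatz (μ i) F (y i) :=
      continuous_phaseDeviation.comp (continuous_pi hans)
    exact Complex.continuous_re.comp ((h1.pow _).matrix_trace)
  have hset : {y : Fin m → UpperPair W → ℂ | (∀ i, PairContraction (ansatz (μ i) F (y i))) ∧
        T ≤ ((phaseDeviation fun i => ansatz (μ i) F (y i)) ^ (2 * p)).trace.re} =
      C ∩ {y | T ≤ τ y} := rfl
  rw [hset]
  refine ⟨hCm.inter (measurableSet_le measurable_const hτc.measurable), ?_⟩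
  -- Truncation to the contraction event is harmless, because arrays outside it belong to no
  -- realization.
  set Z : (Fin m → UpperPair W → ℂ) → ℝ≥0∞ := C.indicator fun y => ENNReal.ofReal (τ y) with hZ
  have hZm : Measurable Z := (hτc.measurable.ennreal_ofReal).indicator hCm
  set N : ℕ := Fintype.card (Fin m → W → Fin 4) with hN
  have hN0 : (0 : ℝ) < N := by exact_mod_cast Fintype.card_pos
  set Q : ℝ := (Fintype.card W) ^ 2 * (8 * p * m) ^ p with hQ
  have hτ0 : ∀ y, 0 ≤ τ y := fun y =>
    trace_even_pow_nonneg (phaseDeviation_isHermitian fun i => ansatz_isHermitian (μ i) hF (y i)) p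
  have hsum : ∀ y, ∑ u : Fin m → W → Fin 4, Z (rotateEntries u y) ≤ ENNReal.ofReal (N * Q) := by
    intro y
    by_cases hy : y ∈ C
    · have h1 : ∀ u : Fin m → W → Fin 4, Z (rotateEntries u y) = ENNReal.ofReal
          (((phaseDeviation fun i => rotate (u i) (ansatz (μ i) F (y i))) ^ (2 * p)).trace.re) := by
        intro u
        rw [hZ, Set.indicator_of_mem]
        · rw [hτ]; simp only [ansatz_rotateEntries]
        · intro i
          rw [ansatz_rotateEntries, pairContraction_rotate_iff]
          exact hy i
      simp only [h1]
      rw [← ENNReal.ofReal_sum_of_nonneg fun u _ => trace_even_pow_nonneg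
        (phaseDeviation_isHermitian fun i => rotate_isHermitian _ (ansatz_isHermitian (μ i) hF (y i))) p]
      refine ENNReal.ofReal_le_ofReal ((sum_trace_phaseDeviation_le
        (fun i => ansatz_isHermitian (μ i) hF (y i)) hy p).trans (le_of_eq ?_))
      rw [hQ, hN]; ring
    · have h1 : ∀ u : Fin m → W → Fin 4, Z (rotateEntries u y) = 0 := by
        intro u
        rw [hZ, Set.indicator_of_notMem]
        intro h
        apply hy
        intro i
        have := h i
        rwa [ansatz_rotateEntries, pairContraction_rotate_iff] at this
      simp only [h1, Finset.sum_const_zero]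
      exact bot_le
  have hint : (N : ℝ≥0∞) * ∫⁻ y, Z y ∂(arrayLaw W m) ≤ ENNReal.ofReal (N * Q) := by
    calc (N : ℝ≥0∞) * ∫⁻ y, Z y ∂(arrayLaw W m)
        = ∑ u : Fin m → W → Fin 4, ∫⁻ y, Z (rotateEntries u y) ∂(arrayLaw W m) := by
          simp only [fun u => (measurePreserving_rotateEntries (W := W) (m := m) u).lintegral_comp hZm]
          rw [Finset.sum_const, Finset.card_univ, nsmul_eq_mul]
      _ = ∫⁻ y, ∑ u : Fin m → W → Fin 4, Z (rotateEntries u y) ∂(arrayLaw W m) := by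
          rw [lintegral_finsetSum]
          exact fun u _ => hZm.comp (measurePreserving_rotateEntries u).measurable
      _ ≤ ∫⁻ _, ENNReal.ofReal (N * Q) ∂(arrayLaw W m) := lintegral_mono hsum
      _ = ENNReal.ofReal (N * Q) := by rw [lintegral_const, measure_univ, mul_one]
  have hint' : ∫⁻ y, Z y ∂(arrayLaw W m) ≤ ENNReal.ofReal Q := by
    rw [ENNReal.ofReal_mul hN0.le, ENNReal.ofReal_natCast] at hint
    exact (ENNReal.mul_le_mul_iff_right (by exact_mod_cast hN0.ne') (ENNReal.natCast_ne_top N)).1 hint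
  have hsub : C ∩ {y | T ≤ τ y} ⊆ {y | ENNReal.ofReal T ≤ Z y} := by
    rintro y ⟨hy1, hy2⟩
    rw [Set.mem_ofPred_eq, hZ, Set.indicator_of_mem hy1]
    exact ENNReal.ofReal_le_ofReal hy2
  refine (measure_mono hsub).trans ((meas_ge_le_lintegral_div hZm.aemeasurable
    (by simpa using hT) ENNReal.ofReal_ne_top).trans ?_)
  rw [ENNReal.ofReal_div_of_pos hT]
  exact ENNReal.div_le_div_right hint' _

end Events

open scoped InnerProductSpace

/-! ### The good event -/

section Good

variable {W : Type*} [LinearOrder W] [Fintype W]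

/-- The averages over `i` that enter the form on the window are within `t` of their means. -/
structure IsTypical {m : ℕ} (μ : Fin m → W → ℝ) (F : W → W → ℝ) (t : ℝ)
    (y : Fin m → UpperPair W → ℂ) : Prop where
  norm_sq : ∀ α β, |1 / (m : ℝ) * ∑ i, ‖hermArray (y i) α β‖ ^ 2 - 1| ≤ t
  re_mul_re : ∀ α γ, α ≠ γ →
    |1 / (m : ℝ) * ∑ i, (hermArray (y i) α α).re * (hermArray (y i) γ γ).re| ≤ t
  mul_re : ∀ α γ, ∑ i, μ i α ^ 2 ≤ 6 * m →
    |1 / (m : ℝ) * ∑ i, μ i α * (hermArray (y i) γ γ).re| ≤ t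
  deviation : (∀ i, PairContraction (ansatz (μ i) F (y i))) → ∀ φ : EuclideanSpace ℂ (W × W),
    |(⟪φ, Matrix.toEuclideanLin (phaseDeviation fun i => ansatz (μ i) F (y i)) φ⟫_ℂ).re| ≤
      m * t * ‖φ‖ ^ 2

/-- A union bound: three families of scalar averages, each with D² members of probability at most 2
exp(4ms² − smt), and one trace-moment event. -/
theorem exists_typical {m : ℕ} (hm : 0 < m) (μ : Fin m → W → ℝ) {F : W → W → ℝ}
    (hF : ∀ α β, F α β = F β α) {s t : ℝ} (hs : 0 < s) (hs' : s ≤ 1 / 4) (ht : 0 < t) {p : ℕ}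
    (hp : p ≠ 0) :
    ∃ 𝒢 : Set (Fin m → UpperPair W → ℂ), MeasurableSet 𝒢 ∧
      arrayLaw W m 𝒢ᶜ ≤ ENNReal.ofReal (6 * (Fintype.card W) ^ 2 *
        Real.exp (4 * m * s ^ 2 - s * (m * t)) +
          (Fintype.card W) ^ 2 * (8 * p * m) ^ p / (m * t) ^ (2 * p)) ∧
      ∀ y ∈ 𝒢, IsTypical μ F t y := by
  have hm' : (0 : ℝ) < m := by exact_mod_cast hm
  set T : ℝ := m * t with hT
  have hT0 : 0 < T := mul_pos hm' ht
  set x : ℝ := Real.exp (4 * m * s ^ 2 - s * T) with hx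
  have hx0 : 0 < x := Real.exp_pos _
  have hherm : ∀ (i : Fin m) (α β : W),
      Measurable fun y : Fin m → UpperPair W → ℂ => hermArray (y i) α β := fun i α β =>
    (measurable_hermArray α β).comp (measurable_pi_apply i)
  set B₁ : W × W → Set (Fin m → UpperPair W → ℂ) := fun q =>
    {y | T < |∑ i, (‖hermArray (y i) q.1 q.2‖ ^ 2 - 1)|} with hB₁
  set B₂ : W × W → Set (Fin m → UpperPair W → ℂ) := fun q =>
    if q.1 ≠ q.2 then
      {y | T < |∑ i, (hermArray (y i) q.1 q.1).re * (hermArray (y i) q.2 q.2).re|} else ∅ with hB₂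
  -- The tail bound needs the variance ∑ μ² to be at most 6m. This is not assumed of μ but is
  -- deduced later from the boundedness of the realization, so the event is left empty when it
  -- fails.
  set B₃ : W × W → Set (Fin m → UpperPair W → ℂ) := fun q =>
    if ∑ i, μ i q.1 ^ 2 ≤ 6 * m then
      {y | T < |∑ i, μ i q.1 * (hermArray (y i) q.2 q.2).re|} else ∅ with hB₃
  set B₄ : Set (Fin m → UpperPair W → ℂ) := {y | (∀ i, PairContraction (ansatz (μ i) F (y i))) ∧
    T ^ (2 * p) ≤ ((phaseDeviation fun i => ansatz (μ i) F (y i)) ^ (2 * p)).trace.re} with hB₄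
  obtain ⟨hB₄m, hB₄le⟩ := arrayLaw_phaseDeviation_le μ hF p (pow_pos hT0 (2 * p))
  have hmeas : ∀ {h : (Fin m → UpperPair W → ℂ) → ℝ}, Measurable h →
      MeasurableSet {y | T < |h y|} := fun hh =>
    measurableSet_lt measurable_const (by fun_prop)
  have hB₁m : ∀ q, MeasurableSet (B₁ q) := fun q => hmeas <|
    Finset.measurable_sum _ fun i _ => by have := hherm i q.1 q.2; fun_prop
  have hB₂m : ∀ q, MeasurableSet (B₂ q) := fun q => by
    simp only [hB₂]
    split_ifs
    · exact hmeas <| Finset.measurable_sum _ fun i _ => by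
        have := hherm i q.1 q.1
        have := hherm i q.2 q.2
        fun_prop
    · exact MeasurableSet.empty
  have hB₃m : ∀ q, MeasurableSet (B₃ q) := fun q => by
    simp only [hB₃]
    split_ifs
    · exact hmeas <| Finset.measurable_sum _ fun i _ => by
        have := hherm i q.2 q.2
        fun_prop
    · exact MeasurableSet.empty
  have hB₁le : ∀ q, arrayLaw W m (B₁ q) ≤ ENNReal.ofReal (2 * x) := fun q =>
    arrayLaw_norm_sq_le hs hs' T q.1 q.2
  have hB₂le : ∀ q, arrayLaw W m (B₂ q) ≤ ENNReal.ofReal (2 * x) := fun q => by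
    simp only [hB₂]
    split_ifs with h
    · exact arrayLaw_re_mul_re_le hs hs' T h
    · rw [measure_empty]; exact bot_le
  have hB₃le : ∀ q, arrayLaw W m (B₃ q) ≤ ENNReal.ofReal (2 * x) := fun q => by
    simp only [hB₃]
    split_ifs with h
    · exact arrayLaw_mul_re_le hs T q.2 h
    · rw [measure_empty]; exact bot_le
  have hunion : ∀ {B : W × W → Set (Fin m → UpperPair W → ℂ)},
      (∀ q, arrayLaw W m (B q) ≤ ENNReal.ofReal (2 * x)) →
      arrayLaw W m (⋃ q, B q) ≤ ENNReal.ofReal ((Fintype.card W) ^ 2 * (2 * x)) := by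
    intro B hB
    refine (measure_iUnion_fintype_le _ _).trans ((Finset.sum_le_sum fun q _ => hB q).trans ?_)
    rw [Finset.sum_const, Finset.card_univ, Fintype.card_prod, nsmul_eq_mul,
      ← ENNReal.ofReal_natCast, ← ENNReal.ofReal_mul (by positivity)]
    push_cast
    rw [sq]
  refine ⟨((⋃ q, B₁ q) ∪ (⋃ q, B₂ q) ∪ (⋃ q, B₃ q) ∪ B₄)ᶜ,
    ((((MeasurableSet.iUnion hB₁m).union (MeasurableSet.iUnion hB₂m)).union
      (MeasurableSet.iUnion hB₃m)).union hB₄m).compl, ?_, ?_⟩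
  · rw [compl_compl]
    refine (measure_union_le _ _).trans ((add_le_add ((measure_union_le _ _).trans
      (add_le_add ((measure_union_le _ _).trans (add_le_add (hunion hB₁le) (hunion hB₂le)))
        (hunion hB₃le))) hB₄le).trans ?_)
    rw [← ENNReal.ofReal_add (by positivity) (by positivity),
      ← ENNReal.ofReal_add (by positivity) (by positivity),
      ← ENNReal.ofReal_add (by positivity) (by positivity)]
    apply ENNReal.ofReal_le_ofReal
    apply le_of_eq
    ring
  · intro y hy
    simp only [Set.mem_compl_iff, Set.mem_union, Set.mem_iUnion, not_or, not_exists] at hy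
    obtain ⟨⟨⟨h1, h2⟩, h3⟩, h4⟩ := hy
    have hav : ∀ {z : ℝ}, |z| ≤ T → |1 / (m : ℝ) * z| ≤ t := by
      intro z hz
      rw [abs_mul, abs_of_pos (by positivity : (0 : ℝ) < 1 / m), one_div, inv_mul_le_iff₀ hm']
      exact hz
    refine ⟨fun α β => ?_, fun α γ hαγ => ?_, fun α γ hα => ?_, fun hc φ => ?_⟩
    · have h := h1 (α, β)
      simp only [hB₁, Set.mem_ofPred_eq, not_lt] at h
      have e : 1 / (m : ℝ) * ∑ i, ‖hermArray (y i) α β‖ ^ 2 - 1 =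
          1 / (m : ℝ) * ∑ i, (‖hermArray (y i) α β‖ ^ 2 - 1) := by
        rw [Finset.sum_sub_distrib, Finset.sum_const, Finset.card_univ, Fintype.card_fin,
          nsmul_eq_mul]
        field_simp
      rw [e]
      exact hav h
    · have h := h2 (α, γ)
      simp only [hB₂] at h
      rw [if_pos hαγ, Set.mem_ofPred_eq, not_lt] at h
      exact hav h
    · have h := h3 (α, γ)
      simp only [hB₃] at h
      rw [if_pos hα, Set.mem_ofPred_eq, not_lt] at h
      exact hav h
    · rw [hB₄, Set.mem_ofPred_eq, not_and, not_le] at h4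
      exact abs_form_le_of_trace
        (phaseDeviation_isHermitian fun i => ansatz_isHermitian (μ i) hF (y i)) hp hT0.le
        (h4 hc).le φ

/-- The window form holds for contractions that follow the ansatz with typical Gaussians. -/
theorem IsTypical.windowForm [Nonempty W] {m : ℕ} (hm : 0 < m) {μ : Fin m → W → ℝ}
    {F : W → W → ℝ} {ρ t : ℝ} (hμ : ∀ i α β, |μ i α - μ i β| ≤ ρ)
    (hF : ∀ α β, 0 ≤ F α β ∧ F α β ≤ 1) (ht : t ≤ 1) {y : Fin m → UpperPair W → ℂ}
    (hy : IsTypical μ F t y) (hc : ∀ i, PairContraction (ansatz (μ i) F (y i)))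
    (hdiag : ∀ i α, ‖ansatz (μ i) F (y i) α α‖ ≤ 1) :
    ∃ μ₂, 0 ≤ μ₂ ∧ μ₂ ≤ 6 ∧ WindowForm (fun i => ansatz (μ i) F (y i))
      (fun α β => F α β ^ 2 / Fintype.card W) μ₂ (5 * t + 7 * ρ) := by
  have hm' : (0 : ℝ) < m := by exact_mod_cast hm
  have hsD : 1 ≤ Real.sqrt (Fintype.card W) :=
    Real.one_le_sqrt.2 (by exact_mod_cast Fintype.card_pos)
  have him : ∀ i α, (hermArray (y i) α α).im = 0 := fun i α => by
    rw [hermArray_self, Complex.ofReal_im]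
  have hsq : ∀ α, ∑ i, μ i α ^ 2 ≤ 6 * m := by
    intro α
    -- No bound on μ is assumed. A diagonal entry of a reflection is at most 1, so a large μ would
    -- have to be compensated by a large Gaussian, and the mean square of the Gaussians is at most
    -- 2.
    have h1 : ∀ i, μ i α ^ 2 ≤ 2 + 2 * ‖hermArray (y i) α α‖ ^ 2 := by
      intro i
      set c := F α α / Real.sqrt (Fintype.card W) with hcdef
      have hc0 : 0 ≤ c := div_nonneg (hF α α).1 (Real.sqrt_nonneg _)
      have hc1 : c ≤ 1 := by
        rw [hcdef, div_le_one (by linarith)]; exact (hF α α).2.trans hsD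
      have e1 : (μ i α : ℂ) = ansatz (μ i) F (y i) α α + -((c : ℂ) * hermArray (y i) α α) := by
        rw [ansatz, Matrix.of_apply, if_pos rfl, hcdef]; push_cast; ring
      have e2 : |μ i α| ≤ 1 + ‖hermArray (y i) α α‖ := by
        rw [← Real.norm_eq_abs, ← Complex.norm_real, e1]
        refine (norm_add_le _ _).trans (add_le_add (hdiag i α) ?_)
        rw [norm_neg, norm_mul, Complex.norm_real, Real.norm_of_nonneg hc0]
        exact mul_le_of_le_one_left (norm_nonneg _) hc1
      have e3 := pow_le_pow_left₀ (abs_nonneg _) e2 2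
      rw [sq_abs] at e3
      nlinarith [sq_nonneg (1 - ‖hermArray (y i) α α‖)]
    have h2 := (abs_le.1 (hy.norm_sq α α)).2
    have h3 : ∑ i, ‖hermArray (y i) α α‖ ^ 2 ≤ 2 * m := by
      have : 1 / (m : ℝ) * ∑ i, ‖hermArray (y i) α α‖ ^ 2 ≤ 2 := by linarith
      rw [one_div, inv_mul_le_iff₀ hm'] at this
      linarith
    calc ∑ i, μ i α ^ 2 ≤ ∑ i, (2 + 2 * ‖hermArray (y i) α α‖ ^ 2) :=
          Finset.sum_le_sum fun i _ => h1 i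
      _ = 2 * m + 2 * ∑ i, ‖hermArray (y i) α α‖ ^ 2 := by
          rw [Finset.sum_add_distrib, ← Finset.mul_sum, Finset.sum_const, Finset.card_univ,
            Fintype.card_fin, nsmul_eq_mul]; ring
      _ ≤ 6 * m := by linarith
  refine windowForm_of_entries hm hμ hF (G := fun i => hermArray (y i)) him (fun i α β => rfl)
    (fun α => ?_) hy.norm_sq hy.re_mul_re (fun α γ => hy.mul_re α γ (hsq α)) (fun φ => ?_)
  · rw [one_div, inv_mul_le_iff₀ hm']
    linarith [hsq α]
  · rw [abs_mul, abs_of_pos (by positivity : (0 : ℝ) < 1 / m), one_div, inv_mul_le_iff₀ hm']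
    have h := hy.deviation hc φ
    rw [phaseDeviation, map_sub, LinearMap.sub_apply, inner_sub_right, Complex.sub_re] at h
    rw [← mul_assoc]
    exact h

end Good

/-! ### The probability of the good event -/

/-- With M = m^{1/3}, s = 1/(4M) and t = 100/M, the Chernoff exponent is M/4 − 25M. The moment term
is (8p/(10⁴M))^p with M ≤ p ≤ 2M, whose base is at most 1/625 < e^{-6}. Both decay rates exceed the
dimension factor 4ⁿ ≤ e^{2M}. -/
theorem failure_probability_le {n m p : ℕ} {d M : ℝ} (hM : 1 ≤ M) (hmM : (m : ℝ) = M ^ 3)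
    (hn : (n : ℝ) ≤ M) (hp : M ≤ p) (hp' : (p : ℝ) ≤ M + 1) (hd0 : 0 ≤ d) (hd : d ≤ 2 ^ n) :
    6 * d ^ 2 * Real.exp (4 * m * (1 / (4 * M)) ^ 2 - 1 / (4 * M) * (m * (100 / M))) +
      d ^ 2 * (8 * p * m) ^ p / (m * (100 / M)) ^ (2 * p) ≤ Real.exp (-M) := by
  have hM0 : 0 < M := by linarith
  have he1 : Real.exp 1 < 2.72 := lt_trans Real.exp_one_lt_d9 (by norm_num)
  have he1' : 2.7 < Real.exp 1 := lt_trans (by norm_num) Real.exp_one_gt_d9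
  have hexp : ∀ k : ℕ, Real.exp (k : ℝ) = Real.exp 1 ^ k := fun k => by
    rw [← Real.exp_nat_mul, mul_one]
  have hd2 : d ^ 2 ≤ Real.exp (2 * M) := by
    calc d ^ 2 ≤ (2 ^ n) ^ 2 := pow_le_pow_left₀ hd0 hd 2
      _ ≤ (Real.exp 1 ^ n) ^ 2 := by gcongr; linarith
      _ = Real.exp (2 * n) := by rw [← hexp, ← Real.exp_nat_mul]; norm_num
      _ ≤ Real.exp (2 * M) := Real.exp_le_exp.2 (by linarith)
  have e1 : 4 * (m : ℝ) * (1 / (4 * M)) ^ 2 - 1 / (4 * M) * (m * (100 / M)) = -(99 / 4) * M := by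
    rw [hmM]; field_simp; norm_num
  have e2 : (8 * (p : ℝ) * m) ^ p / (m * (100 / M)) ^ (2 * p) = (8 * p / (10000 * M)) ^ p := by
    rw [pow_mul, ← div_pow, hmM]
    congr 1
    field_simp
    norm_num
  have h6 : Real.exp 1 ^ 6 ≤ 625 := by
    calc Real.exp 1 ^ 6 ≤ 2.72 ^ 6 := by gcongr
      _ ≤ 625 := by norm_num
  have e3 : 8 * (p : ℝ) / (10000 * M) ≤ Real.exp (-6) := by
    rw [div_le_iff₀ (by positivity), Real.exp_neg]
    have h7 : Real.exp 6 ≤ 625 := by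
      have := hexp 6
      push_cast at this
      rw [this]; exact h6
    have h8 : (1 / 625 : ℝ) ≤ (Real.exp 6)⁻¹ := by
      rw [one_div]; exact inv_anti₀ (Real.exp_pos _) h7
    calc 8 * (p : ℝ) ≤ 1 / 625 * (10000 * M) := by linarith
      _ ≤ _ := mul_le_mul_of_nonneg_right h8 (by positivity)
  have e4 : (8 * (p : ℝ) / (10000 * M)) ^ p ≤ Real.exp (-6 * M) := by
    calc _ ≤ Real.exp (-6) ^ p := pow_le_pow_left₀ (by positivity) e3 p
      _ = Real.exp (p * (-6)) := by rw [← Real.exp_nat_mul]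
      _ ≤ Real.exp (-6 * M) := Real.exp_le_exp.2 (by linarith)
  have h6' : 6 ≤ Real.exp (2 * M) := by
    calc (6 : ℝ) ≤ Real.exp 1 ^ 2 := by nlinarith
      _ = Real.exp (2 : ℕ) := (hexp 2).symm
      _ ≤ Real.exp (2 * M) := Real.exp_le_exp.2 (by push_cast; linarith)
  have t1 : 6 * d ^ 2 * Real.exp (-(99 / 4) * M) ≤ Real.exp (-4 * M) := by
    calc 6 * d ^ 2 * Real.exp (-(99 / 4) * M) ≤
          Real.exp (2 * M) * Real.exp (2 * M) * Real.exp (-(99 / 4) * M) := by gcongr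
      _ = Real.exp (2 * M + 2 * M + -(99 / 4) * M) := by rw [Real.exp_add, Real.exp_add]
      _ ≤ Real.exp (-4 * M) := Real.exp_le_exp.2 (by linarith)
  have t2 : d ^ 2 * (8 * (p : ℝ) / (10000 * M)) ^ p ≤ Real.exp (-4 * M) := by
    calc _ ≤ Real.exp (2 * M) * Real.exp (-6 * M) := by gcongr
      _ = Real.exp (-4 * M) := by rw [← Real.exp_add]; congr 1; ring
  have t3 : 2 * Real.exp (-4 * M) ≤ Real.exp (-M) := by
    calc 2 * Real.exp (-4 * M) ≤ Real.exp (2 * M) * Real.exp (-4 * M) := by gcongr; linarith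
      _ = Real.exp (2 * M + -4 * M) := by rw [Real.exp_add]
      _ ≤ Real.exp (-M) := Real.exp_le_exp.2 (by linarith)
  rw [e1, mul_div_assoc, e2]
  linarith

/-- The Gaussians are only almost everywhere measurable, so the preimage is null-measurable and is
replaced by a measurable subset of the same probability. -/
theorem exists_measurable_good {Ω V : Type*} [MeasurableSpace Ω] [MeasurableSpace V]
    {P : Measure Ω} [IsProbabilityMeasure P] {ν : Measure V} {G : Ω → V} (hG : HasLaw G ν P)
    {𝒢 : Set V} (h𝒢 : MeasurableSet 𝒢) {r : ℝ} (hr : 0 ≤ r) (h : ν 𝒢ᶜ ≤ ENNReal.ofReal r) :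
    ∃ good : Set Ω, MeasurableSet good ∧ 1 - r ≤ P.real good ∧ ∀ ω ∈ good, G ω ∈ 𝒢 := by
  have hnull : NullMeasurableSet (G ⁻¹' 𝒢) P := hG.aemeasurable.nullMeasurableSet_preimage h𝒢
  obtain ⟨t, ht, htm, hta⟩ := hnull.exists_measurable_subset_ae_eq
  refine ⟨t, htm, ?_, fun ω hω => ht hω⟩
  have h1 : P tᶜ ≤ ENNReal.ofReal r := by
    rw [measure_congr hta.compl, ← Set.preimage_compl,
      ← Measure.map_apply_of_aemeasurable hG.aemeasurable h𝒢.compl, hG.map_eq]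
    exact h
  have h2 : P.real tᶜ ≤ r := ENNReal.toReal_le_of_le_ofReal hr h1
  rw [probReal_compl_eq_one_sub htm] at h2
  linarith

theorem SinglesOut.mono {V : Type*} [NormedAddCommGroup V] [InnerProductSpace ℂ V] {acc : V → ℝ}
    {p δ δ' : ℝ} (h : SinglesOut acc p δ) (hδ : δ' ≤ δ) : SinglesOut acc p δ' := by
  obtain ⟨Ψ, h1, h2, h3, h4⟩ := h
  exact ⟨Ψ, h1, h2, h3, fun Φ hΦ hΨΦ => (h4 Φ hΦ hΨΦ).trans (by linarith)⟩

theorem WindowForm.mono {W : Type*} [Fintype W] [DecidableEq W] {m : ℕ} {a : Fin m → Matrix W W ℂ}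
    {B : W → W → ℝ} {μ₂ δ δ' : ℝ} (h : WindowForm a B μ₂ δ) (hδ : δ ≤ δ') :
    WindowForm a B μ₂ δ' :=
  fun φ => (h φ).trans (mul_le_mul_of_nonneg_right hδ (sq_nonneg _))

/-- The block is the compression of the unitary A ⊗ conj A by an isometry. -/
theorem IsReflection.pairContraction_submatrix {ι W : Type*} [Fintype ι] [DecidableEq ι] [Fintype W]
    [DecidableEq W] {A : Matrix ι ι ℂ} (hA : IsReflection A) {e : W → ι}
    (he : Function.Injective e) : PairContraction (A.submatrix e e) := by
  intro φ
  have h : A.submatrix e e ⊗ₖ (A.submatrix e e).map star =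
      (windowInclusion e).conjTranspose * (A ⊗ₖ A.map star * windowInclusion e) := by
    rw [← Matrix.mul_assoc, windowInclusion_compress]
    rfl
  rw [h, toEuclideanLin_mul_apply, toEuclideanLin_mul_apply]
  refine (norm_windowInclusion_conjTranspose_le he _).trans ?_
  rw [norm_reflection hA.kronecker_map_star,
    norm_toEuclideanLin_isometry (windowInclusion_isometry he)]

theorem IsReflection.norm_inBasis_self_le {ι : Type*} [Fintype ι] [DecidableEq ι] {A : Matrix ι ι ℂ}
    (hA : IsReflection A) (ν : OrthonormalBasis ι ℂ (EuclideanSpace ℂ ι)) (α : ι) :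
    ‖EnergyTest.inBasis ν A α α‖ ≤ 1 := by
  rw [inBasis_apply]
  refine (norm_inner_le_norm _ _).trans ?_
  rw [norm_reflection hA, ν.norm_eq_one, one_mul]

end EnergyTest

end

/-! ### The theorem: choice of constants, and the cases of large and small m. -/

theorem mainTheorem6 (a b : ℝ) (ha : 0 < a) (hab : a ≤ b) :
    ∃ f₀ C c κ : ℝ, 0 < f₀ ∧ 0 < C ∧ 0 < c ∧ 0 < κ ∧
      ∀ (n : ℕ), 0 < n →
      -- the Hamiltonian, an eigenbasis, and its energies
      ∀ (H : Matrix (Fin (2 ^ n)) (Fin (2 ^ n)) ℂ)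
        (ν : OrthonormalBasis (Fin (2 ^ n)) ℂ (EuclideanSpace ℂ (Fin (2 ^ n))))
        (E : Fin (2 ^ n) → ℝ),
      H.IsHermitian →
      (∀ α, Matrix.toEuclideanLin H (ν α) = (E α : ℂ) • ν α) →
      (∀ α, E α ∈ Set.Icc (0 : ℝ) 1) →
      -- the transition amplitude, the step size, the energy window and the resolution
      ∀ (f ε e₀ Δ η : ℝ) (L : ℕ),
      0 < f → f ≤ f₀ →
      a * f ^ 7 ≤ ε → ε ≤ b * f ^ 7 →
      0 ≤ e₀ - Δ / 2 → e₀ + Δ / 2 ≤ 1 →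
      1 - f ^ 25 ≤
        (EnergyTest.windowDim E e₀ (Δ - η) : ℝ) / (EnergyTest.windowDim E e₀ Δ : ℝ) →
      3 / Real.sqrt L ≤ η → 1 ≤ f ^ 28 * (L : ℝ) →
      -- the coefficients of the ansatz
      ∀ (μ : Fin (n ^ 7) → EnergyTest.Window E e₀ Δ → ℝ)
        (F : EnergyTest.Window E e₀ Δ → EnergyTest.Window E e₀ Δ → ℝ),
      (∀ i α β, |μ i α - μ i β| ≤ f ^ 7) →
      (∀ α β, F α β = F β α) → (∀ α β, f ≤ F α β ∧ F α β ≤ 1) →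
      -- the Gaussians
      ∀ (Ω : Type*) [MeasurableSpace Ω] (P : Measure Ω) [IsProbabilityMeasure P]
        (g : Fin (n ^ 7) → EnergyTest.Window E e₀ Δ → EnergyTest.Window E e₀ Δ → Ω → ℂ),
      EnergyTest.IsHermitianGaussian P g →
      ∃ good : Set Ω, MeasurableSet good ∧
        1 - Real.exp (-κ * ((n ^ 7 : ℕ) : ℝ) ^ (1 / 3 : ℝ)) ≤ P.real good ∧
        ∀ ω ∈ good,
        -- a realization `A'` of the ansatz, and operators `A` which the test cannot tell from it
        ∀ (A' A : Fin (n ^ 7) → Matrix (Fin (2 ^ n)) (Fin (2 ^ n)) ℂ) (εETH : ℝ),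
        EnergyTest.IsRealization ν E e₀ Δ μ F (fun i α β => g i α β ω) A' →
        (∀ i, EnergyTest.IsReflection (A i)) →
        0 ≤ εETH →
        EnergyTest.diamondNorm
            (EnergyTest.testChannel H A ε e₀ Δ L - EnergyTest.testChannel H A' ε e₀ Δ L) ≤
          ENNReal.ofReal εETH →
        ∃ p : ℝ, 1 - C * f ^ 14 - εETH ≤ p ∧ p ≤ 1 ∧
          EnergyTest.SinglesOut (EnergyTest.acceptProb H A ε e₀ Δ L) p
            (c * f ^ 20 - εETH -
              C * (((n ^ 7 : ℕ) : ℝ) ^ (-(1 / 3) : ℝ) + 1 / Real.sqrt L)) := by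
  have hb : 0 < b := ha.trans_le hab
  -- The second entry keeps the errors of order f²¹ below half of the gap; the third keeps the top
  -- eigenvalue at least 1/2.
  set f₀ : ℝ := min (1 / 2) (min (a ^ 2 / 8 / (22 * b ^ 2 + 14)) (1 / 2 / (17 * b ^ 2 + 206)))
    with hf₀
  -- In C, the first summand accounts for the loss f¹⁴ in p, and 840000 = 8400 · 100 is the constant
  -- of `margin_bounds` times that in t = 100/M.
  refine ⟨f₀, 2 * (17 * b ^ 2 + 206) + 840000, a ^ 2 / 16, 1, by positivity, by positivity,
    by positivity, one_pos, ?_⟩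
  intro n hn H ν E _ hE hE01 f ε e₀ Δ η L hf hff₀ hε1 hε2 h0 h1 hdim hη hL μ F hμ hFs hF Ω _ P _ g hg
  have hf1 : f ≤ 1 / 2 := hff₀.trans (min_le_left _ _)
  have hfa : (22 * b ^ 2 + 14) * f ≤ a ^ 2 / 8 := by
    have := hff₀.trans ((min_le_right _ _).trans (min_le_left _ _))
    rw [le_div_iff₀ (by positivity)] at this
    linarith
  have hfb : (17 * b ^ 2 + 206) * f ^ 14 ≤ 1 / 2 := by
    have h := hff₀.trans ((min_le_right _ _).trans (min_le_right _ _))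
    rw [le_div_iff₀ (by positivity)] at h
    have h14 : f ^ 14 ≤ f := pow_le_of_le_one hf.le (by linarith) (by norm_num)
    have := mul_le_mul_of_nonneg_left h14 (by positivity : 0 ≤ 17 * b ^ 2 + 206)
    linarith
  have : Fintype (EnergyTest.Window E e₀ Δ) := Fintype.ofFinite _
  have hm : 0 < n ^ 7 := pow_pos hn 7
  have : Nonempty (Fin (2 ^ n)) := ⟨⟨0, by positivity⟩⟩
  set M : ℝ := ((n ^ 7 : ℕ) : ℝ) ^ (1 / 3 : ℝ) with hMdef
  have hm1 : (1 : ℝ) ≤ ((n ^ 7 : ℕ) : ℝ) := by exact_mod_cast hm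
  have hM3 : ((n ^ 7 : ℕ) : ℝ) = M ^ 3 := by
    rw [hMdef, ← Real.rpow_natCast, ← Real.rpow_mul (by positivity)]
    norm_num
  have hM1 : 1 ≤ M := Real.one_le_rpow hm1 (by norm_num)
  have hM0 : 0 < M := by linarith
  have hMinv : ((n ^ 7 : ℕ) : ℝ) ^ (-(1 / 3) : ℝ) = 1 / M := by
    rw [Real.rpow_neg (by positivity), ← hMdef, one_div M]
  have hnM : (n : ℝ) ≤ M := by
    have h3 : (n : ℝ) ^ 3 ≤ M ^ 3 := by
      rw [← hM3]
      exact_mod_cast Nat.pow_le_pow_right hn (by norm_num : 3 ≤ 7)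
    exact (pow_le_pow_iff_left₀ (by positivity) hM0.le (by norm_num)).1 h3
  have hcard : EnergyTest.windowDim E e₀ Δ = Fintype.card (EnergyTest.Window E e₀ Δ) :=
    Nat.card_eq_fintype_card
  have hD : (Fintype.card (EnergyTest.Window E e₀ Δ) : ℝ) ≤ 2 ^ n := by
    have := Fintype.card_subtype_le
      fun α : Fin (2 ^ n) => E α ∈ Set.Icc (e₀ - Δ / 2) (e₀ + Δ / 2)
    rw [Fintype.card_fin] at this
    calc (Fintype.card (EnergyTest.Window E e₀ Δ) : ℝ) ≤ ((2 ^ n : ℕ) : ℝ) := by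
          exact_mod_cast (Fintype.card_congr (Equiv.refl _)).le.trans this
      _ = 2 ^ n := by push_cast; rfl
  -- For an empty window the quotient of dimensions would be 0/0 = 0.
  have hWne : Nonempty (EnergyTest.Window E e₀ Δ) := by
    by_contra hne
    rw [not_nonempty_iff] at hne
    rw [hcard, Fintype.card_eq_zero, Nat.cast_zero, div_zero] at hdim
    have := pow_lt_one₀ hf.le (by linarith : f < 1) (by norm_num : 25 ≠ 0)
    linarith
  have hF' : ∀ α β, 0 ≤ F α β ∧ F α β ≤ 1 := fun α β => ⟨hf.le.trans (hF α β).1, (hF α β).2⟩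
  have hx0 : 0 ≤ 1 / Real.sqrt L := by positivity
  have hM0' : 0 < 1 / M := by positivity
  -- it suffices to find a window form with error `5 t + 11 f ^ 7`, where `t ≤ 100 / M`
  have key : ∀ (A' A : Fin (n ^ 7) → Matrix (Fin (2 ^ n)) (Fin (2 ^ n)) ℂ) (εETH μ₂ t : ℝ),
      (∀ i, EnergyTest.IsReflection (A' i)) → (∀ i, EnergyTest.IsReflection (A i)) → 0 ≤ εETH →
      EnergyTest.diamondNorm
        (EnergyTest.testChannel H A ε e₀ Δ L - EnergyTest.testChannel H A' ε e₀ Δ L) ≤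
          ENNReal.ofReal εETH →
      0 ≤ μ₂ → μ₂ ≤ 6 → 0 ≤ t → t ≤ 1 → t ≤ 100 * (1 / M) →
      EnergyTest.WindowForm (fun i => (EnergyTest.inBasis ν (A' i)).submatrix
        (Subtype.val : EnergyTest.Window E e₀ Δ → Fin (2 ^ n)) Subtype.val)
          (fun α β => F α β ^ 2 / EnergyTest.windowDim E e₀ Δ) μ₂ (5 * t + 11 * f ^ 7) →
      ∃ p : ℝ, 1 - (2 * (17 * b ^ 2 + 206) + 840000) * f ^ 14 - εETH ≤ p ∧ p ≤ 1 ∧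
        EnergyTest.SinglesOut (EnergyTest.acceptProb H A ε e₀ Δ L) p
          (a ^ 2 / 16 * f ^ 20 - εETH - (2 * (17 * b ^ 2 + 206) + 840000) *
            (((n ^ 7 : ℕ) : ℝ) ^ (-(1 / 3) : ℝ) + 1 / Real.sqrt L)) := by
    intro A' A εETH μ₂ t hA' hA hε hdiam hμ0 hμ6 ht0 ht1 htM hform
    obtain ⟨p, hp1, hp2, hp3⟩ := EnergyTest.exists_singlesOut hm ν hE hE01 ha hab hf hf1 hfa hfb
      hε1 hε2 h0 h1 hdim hη hL hFs hF hA' hA hμ0 hμ6 ht0 ht1 hform hε hdiam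
    refine ⟨p, ?_, hp2, hp3.mono ?_⟩
    · have : 0 ≤ f ^ 14 := by positivity
      linarith
    · rw [hMinv]
      have h5 : 0 ≤ 2 * (17 * b ^ 2 + 206) * (1 / M + 1 / Real.sqrt L) := by positivity
      linarith
  -- The concentration argument requires t = 100/M ≤ 1.
  by_cases hMK : 100 ≤ M
  · have ht1 : 100 / M ≤ 1 := (div_le_one hM0).2 hMK
    have hp0 : ⌈M⌉₊ ≠ 0 := (Nat.ceil_pos.2 hM0).ne'
    have hs : 1 / (4 * M) ≤ 1 / 4 := by
      rw [div_le_div_iff₀ (by positivity) (by norm_num)]; linarith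
    -- The moment order is p = ⌈M⌉, large enough for an exponential decay e^{-6M} that beats the
    -- dimension.
    obtain ⟨𝒢, h𝒢m, h𝒢, htyp⟩ := EnergyTest.exists_typical hm μ hFs
      (by positivity : 0 < 1 / (4 * M)) hs (by positivity : 0 < 100 / M) hp0
    have hfail := EnergyTest.failure_probability_le (n := n) hM1 hM3 hnM (Nat.le_ceil M)
      (Nat.ceil_lt_add_one hM0.le).le (Nat.cast_nonneg _) hD
    obtain ⟨good, hgm, hgP, hgood⟩ := EnergyTest.exists_measurable_good hg.hasLaw h𝒢m
      (Real.exp_pos (-M)).le (h𝒢.trans (ENNReal.ofReal_le_ofReal hfail))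
    refine ⟨good, hgm, by rwa [neg_one_mul], ?_⟩
    intro ω hω A' A εETH hreal hA hε hdiam
    have hy := htyp _ (hgood ω hω)
    have hblock : ∀ i, EnergyTest.ansatz (μ i) F
        (fun p : EnergyTest.UpperPair (EnergyTest.Window E e₀ Δ) => g i p.1.1 p.1.2 ω) =
        (EnergyTest.inBasis ν (A' i)).submatrix
          (Subtype.val : EnergyTest.Window E e₀ Δ → Fin (2 ^ n)) Subtype.val := by
      intro i
      ext α β
      rw [Matrix.submatrix_apply, EnergyTest.inBasis_apply, hreal.2, EnergyTest.ansatz,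
        Matrix.of_apply,
        EnergyTest.hermArray_eq (fun α β => g i α β ω) (fun α β => hg.hermitian i α β ω), hcard]
      rfl
    obtain ⟨μ₂, hμ0, hμ6, hform⟩ := hy.windowForm hm hμ hF' ht1
      (fun i => by
        rw [hblock]
        exact ((hreal.1 i).inBasis ν).pairContraction_submatrix Subtype.val_injective)
      (fun i α => by
        rw [hblock]
        exact (hreal.1 i).norm_inBasis_self_le ν α)
    simp only [hblock] at hform
    refine key A' A εETH μ₂ (100 / M) hreal.1 hA hε hdiam hμ0 hμ6 (by positivity) ht1
      (by rw [mul_one_div]) ?_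
    rw [hcard]
    exact hform.mono (by have : 0 ≤ f ^ 7 := by positivity
                         linarith)
  -- For bounded m no randomness is used: the trivial window form with error 2 serves with μ₂ = 0
  -- and t = 1 ≤ 100/M. The bound on p survives because it holds for every t ≤ 1, and the term C/M
  -- in the margin absorbs the rest.
  · refine ⟨Set.univ, MeasurableSet.univ, ?_, ?_⟩
    · rw [probReal_univ]
      have := Real.exp_pos (-1 * M)
      linarith
    · intro ω _ A' A εETH hreal hA hε hdiam
      have h100 : 1 ≤ 100 * (1 / M) := by
        rw [mul_one_div, le_div_iff₀ hM0]; linarith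
      refine key A' A εETH 0 1 hreal.1 hA hε hdiam le_rfl (by norm_num) zero_le_one le_rfl h100 ?_
      refine (EnergyTest.windowForm_two hm Subtype.val_injective
        (fun i => (hreal.1 i).inBasis ν) fun α β => ?_).mono (by
          have : 0 ≤ f ^ 7 := by positivity
          linarith)
      rw [hcard, abs_of_nonneg (by positivity)]
      gcongr
      exact pow_le_one₀ (hF' α β).1 (hF' α β).2
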